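/- **Setting.** Let $\mathcal V=\mathbb R^3\ni V=(g,z,\mu)$ with the supremum norm. For real coefficients $\eta_j,\gamma_j,\lambda_j,\beta_j,\theta_j,\zeta_j,\upsilon^{gg}_j,\upsilon^{gz}_j,\upsilon^{g\mu}_j,\upsilon^{zz}_j,\upsilon^{z\mu}_j$ $(j\in\mathbb N_0)$ let $\bar\varphi_j(V)=(g',z',\mu')$ with $$g'=g-\beta_jg^2,\qquad z'=z-\theta_jg^2-\zeta_jgz,$$ $$\mu'=\eta_jg+\gamma_jz+\lambda_j\mu-\upsilon^{gg}_jg^2-\upsilon^{gz}_jgz-\upsilon^{g\mu}_jg\mu-\upsilon^{zz}_jz^2-\upsilon^{z\mu}_jz\mu .$$ Fix $\Omega>1$ and put $\|\beta\|_\infty=\sup_j|\beta_j|$, $j_\Omega=\inf\{k\in\mathbb N_0:|\beta_j|\le\Omega^{-(j-k)_+}\|\beta\|_\infty\ \forall j\ge0\}\in\mathbb N_0\cup\{\infty\}$ (with $\inf\emptyset=\infty$) and $\chi_j=\Omega^{-(j-j_\Omega)_+}$. For small $g_0>0$ let $\bar V=(\bar g_j,\bar z_j,\bar\mu_j)_{j\ge0}$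 be the unique solution of $\bar V_{j+1}=\bar\varphi_j(\bar V_j)$ with $\bar g_0=g_0$, $\bar z_j\to0$, $\bar\mu_j\to0$. Let $\mathcal W_j$ be real Banach spaces and $X_j=\mathcal W_j\oplus\mathcal V$, with elements $x_j=(K_j,g_j,z_j,\mu_j)$. For $a,h>0$ let $D_j=D_j(g_0,a,h)\subset X_j$ be the set of $x_j$ with $\|K_j\|\le a\chi_j\bar g_j^3$, $|g_j-\bar g_j|\le h\bar g_j^2|\log\bar g_j|$, $|z_j-\bar z_j|\le h\chi_j\bar g_j^2|\log\bar g_j|$ and $|\mu_j-\bar\mu_j|\le h\chi_j\bar g_j^2|\log\bar g_j|$. For $\psi_j:D_j\to\mathcal W_{j+1}$ and $\rho_j:D_j\to\mathcal V$ let $\Phi_j(K,V)=(\psi_j(K,V),\bar\varphi_j(V)+\rho_j(K,V))$. **Assumptions**, with constants $\Omega,B,c,\lambda,C,a,h,\kappa,R,M,g_0$: * (A1) $|\beta_j|\le B$ for all $j$, and $\beta_j\ge c$ for all but at most $c^{-1}$ values of $j\le j_\Omega$. * (A2) $\lambda_j\ge\lambda$ for all $j$; $\zeta_j\le0$ for all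 but at most $c^{-1}$ values of $j\le j_\Omega$; and $|\eta_j|,|\gamma_j|,|\theta_j|,|\zeta_j|,|\upsilon^{\alpha\alpha'}_j|\le C\chi_j$ for all $j$. * (A3) $\psi_j,\rho_j$ are three times continuously Fréchet differentiable on $D_j=D_j(g_0,a,h)$, and for all $j$ and all $x=(K,V)\in D_j$: $\|\psi_j(0,V)\|\le R\chi_{j+1}\bar g_{j+1}^3$, $\|\rho_j(x)\|\le M\chi_{j+1}\bar g_{j+1}^3$, $\|D_K\psi_j(x)\|\le\kappa$, $\|D_K\rho_j(x)\|\le M$, and, for $\phi=\psi,\rho$, $\|D_V\phi_j(x)\|\le M\chi_{j+1}\bar g_{j+1}^2$ and, for $2\le n+m\le3$, $\|D_V^mD_K^n\phi_j(x)\|\le M(\chi_{j+1}\bar g_{j+1}^3)^{1-n}(\bar g_{j+1}^2|\log\bar g_{j+1}|)^{-m}$. **Statement.** Let $\Omega>1$, $c>0$, $\lambda>1$, $B,C\in\mathbb R$, $a>0$, $\kappa\in(0,\Omega^{-1})$, $R\in(0,a(1-\kappa\Omega))$, $M>0$, $a_*\in(R/(1-\kappa\Omega),a)$, $b\in(0,1)$.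 There is $h_*>0$ such that for every $h\ge h_*$ there is $g_*>0$, where $h_*$ depends only on these constants and $g_*$ only on these constants and $h$, such that the following holds. Let $g_0'\in(0,g_*]$ and $\|K_0'\|_{\mathcal W_0}\le a_*g_0'^3$. Let $M_{\rm ext}$ be a metric space. Suppose that the coefficients of $\bar\varphi_j$ are continuous functions of $m\in M_{\rm ext}$, that $\psi_j,\rho_j$ depend on $m$, that for every $j$ the map $(x,m)\mapsto\Phi_j(x,m)$ is continuous on $\big(\bigcup_{m'\in M_{\rm ext}}D_j(m')\big)\times M_{\rm ext}$, where $D_j(m')$ is the domain $D_j(g_0',a,h)$ for the parameter $m'$, and that for every $m\in M_{\rm ext}$ the assumptions (A1)–(A3) hold with the above constants and $g_0=g_0'$ (all independent of $m$). Then there is a neighbourhood $\mathsf N\subset\mathcal W_0\oplus\mathbb R$ of $(K_0',g_0')$, independent of $m$, such that: 1. For all $m\in M_{\rm ext}$ and $u_0=(K_0,g_0)\in\mathsf N$, the flow $\bar V=\bar V(m,g_0)$ exists and is unique; the sequence $\bar x=(\bar K,\bar V)$ with $\bar K_0=K_0$, $\bar K_{j+1}=\psi_j(\bar K_j,\bar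 V_j)$ is well defined with $\bar x_j\in D_j(m)$; and there is a unique sequence $x=x(m,u_0)=(K_j,g_j,z_j,\mu_j)_{j\ge0}$ with $x_{j+1}=\Phi_j(x_j,m)$ for all $j$, with the prescribed initial values $(K_0,g_0)=u_0$, with $z_j\to0$ and $\mu_j\to0$, and with $$\|K_j-\bar K_j\|\le b(a-a_*)\chi_j\bar g_j^3,\qquad |g_j-\bar g_j|\le bh\bar g_j^2|\log\bar g_j|,$$ $$|z_j-\bar z_j|\le bh\chi_j\bar g_j^2|\log\bar g_j|,\qquad |\mu_j-\bar\mu_j|\le bh\chi_j\bar g_j^2|\log\bar g_j|$$ for all $j$ (where $\chi_j$ and $\bar x_j$ belong to the parameter $m$ and the initial condition $u_0$); moreover $x_j\in D_j(m)$ for all $j$. 2. For every $j\in\mathbb N_0$ the map $(m,u_0)\mapsto x_j(m,u_0)\in X_j$ is continuous on $M_{\rm ext}\times\mathsf N$. -/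

import Mathlib

open Filter Topology

noncomputable section

namespace QuadFlow

/-- The coupling space `ℝ³` with elements `V = (g, z, μ)`; the product norm is the supremum norm. -/
abbrev Coupling : Type := ℝ × ℝ × ℝ

/-- The real coefficients of the quadratic maps, one sequence in the scale `j` for each. -/
structure Coeffs where
  eta : ℕ → ℝ
  gamma : ℕ → ℝ
  lam : ℕ → ℝ
  beta : ℕ → ℝ
  theta : ℕ → ℝ
  zeta : ℕ → ℝ
  ups_gg : ℕ → ℝ
  ups_gz : ℕ → ℝ
  ups_gmu : ℕ → ℝ
  ups_zz : ℕ → ℝ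
  ups_zmu : ℕ → ℝ

/-- The quadratic map `φ̄_j`, written out in the coordinates `V = (g, z, μ)`. -/
def quadMap (P : Coeffs) (j : ℕ) (V : Coupling) : Coupling :=
  (V.1 - P.beta j * V.1 ^ 2,
    V.2.1 - (P.theta j * V.1 ^ 2 + P.zeta j * V.1 * V.2.1),
    P.eta j * V.1 + P.gamma j * V.2.1 + P.lam j * V.2.2
      - (P.ups_gg j * V.1 ^ 2 + P.ups_gz j * V.1 * V.2.1 + P.ups_gmu j * V.1 * V.2.2
        + P.ups_zz j * V.2.1 ^ 2 + P.ups_zmu j * V.2.1 * V.2.2))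

/-- The cut-off time `j_Ω` of a sequence `β`; it is `⊤` if no `k` qualifies. The natural number
`j - k` is the positive part of the difference. -/
def cutoffTime (Ω : ℝ) (β : ℕ → ℝ) : ℕ∞ :=
  sInf ((fun k : ℕ => (k : ℕ∞)) '' {k : ℕ | ∀ j, |β j| ≤ (Ω ^ (j - k))⁻¹ * ⨆ i, |β i|})

/-- `χ_j = Ω ^ (-(j - j_Ω)₊)`; the subtraction in `ℕ∞` is truncated and `j - ⊤ = 0`. -/
def chi (Ω : ℝ) (β : ℕ → ℝ) (j : ℕ) : ℝ :=
  (Ω ^ ((j : ℕ∞) - cutoffTime Ω β).toNat)⁻¹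

/-- Assumption (A1) with constants `Ω`, `B`, `c`. -/
structure AssumptionA1 (Ω B c : ℝ) (P : Coeffs) : Prop where
  beta_bdd : ∀ j, |P.beta j| ≤ B
  exceptional_finite : {j : ℕ | (j : ℕ∞) ≤ cutoffTime Ω P.beta ∧ P.beta j < c}.Finite
  exceptional_card :
    ({j : ℕ | (j : ℕ∞) ≤ cutoffTime Ω P.beta ∧ P.beta j < c}.ncard : ℝ) ≤ c⁻¹

/-- Assumption (A2) with constants `Ω`, `c`, `lam₀` (the lower bound on the `λ_j`) and `C` (the
constant in the bounds `O(χ_j)`). -/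
structure AssumptionA2 (Ω c lam₀ C : ℝ) (P : Coeffs) : Prop where
  le_lam : ∀ j, lam₀ ≤ P.lam j
  exceptional_finite : {j : ℕ | (j : ℕ∞) ≤ cutoffTime Ω P.beta ∧ 0 < P.zeta j}.Finite
  exceptional_card :
    ({j : ℕ | (j : ℕ∞) ≤ cutoffTime Ω P.beta ∧ 0 < P.zeta j}.ncard : ℝ) ≤ c⁻¹
  eta_le : ∀ j, |P.eta j| ≤ C * chi Ω P.beta j
  gamma_le : ∀ j, |P.gamma j| ≤ C * chi Ω P.beta j
  theta_le : ∀ j, |P.theta j| ≤ C * chi Ω P.beta j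
  zeta_le : ∀ j, |P.zeta j| ≤ C * chi Ω P.beta j
  ups_gg_le : ∀ j, |P.ups_gg j| ≤ C * chi Ω P.beta j
  ups_gz_le : ∀ j, |P.ups_gz j| ≤ C * chi Ω P.beta j
  ups_gmu_le : ∀ j, |P.ups_gmu j| ≤ C * chi Ω P.beta j
  ups_zz_le : ∀ j, |P.ups_zz j| ≤ C * chi Ω P.beta j
  ups_zmu_le : ∀ j, |P.ups_zmu j| ≤ C * chi Ω P.beta j

/-- Every coefficient is a continuous function of the external parameter. -/
structure ContinuousCoeffs {E : Type*} [TopologicalSpace E] (P : E → Coeffs) : Prop where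
  eta : ∀ j, Continuous fun m => (P m).eta j
  gamma : ∀ j, Continuous fun m => (P m).gamma j
  lam : ∀ j, Continuous fun m => (P m).lam j
  beta : ∀ j, Continuous fun m => (P m).beta j
  theta : ∀ j, Continuous fun m => (P m).theta j
  zeta : ∀ j, Continuous fun m => (P m).zeta j
  ups_gg : ∀ j, Continuous fun m => (P m).ups_gg j
  ups_gz : ∀ j, Continuous fun m => (P m).ups_gz j
  ups_gmu : ∀ j, Continuous fun m => (P m).ups_gmu j
  ups_zz : ∀ j, Continuous fun m => (P m).ups_zz j
  ups_zmu : ∀ j, Continuous fun m => (P m).ups_zmu j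

/-- `V` is a global flow of `φ̄` with initial condition `g₀` and final condition
`(z_∞, μ_∞) = (0, 0)`. -/
structure IsQuadFlow (P : Coeffs) (g₀ : ℝ) (V : ℕ → Coupling) : Prop where
  init : (V 0).1 = g₀
  step : ∀ j, V (j + 1) = quadMap P j (V j)
  z_lim : Tendsto (fun j => (V j).2.1) atTop (𝓝 0)
  mu_lim : Tendsto (fun j => (V j).2.2) atTop (𝓝 0)

/-- The flow `V̄ = (ḡ, z̄, μ̄)` with initial condition `g₀`: the flow described by `IsQuadFlow`
(used only where it exists and is unique). -/
def quadFlow (P : Coeffs) (g₀ : ℝ) : ℕ → Coupling :=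
  Classical.epsilon (IsQuadFlow P g₀)

/-- The sequence `ḡ` with initial condition `g₀`. -/
def gbar (P : Coeffs) (g₀ : ℝ) (j : ℕ) : ℝ := (quadFlow P g₀ j).1

section Perturbation

variable {W : ℕ → Type*} [∀ j, NormedAddCommGroup (W j)] [∀ j, NormedSpace ℝ (W j)]

/-- The domain `D_j(g₀, a, h) ⊆ X_j = W_j ⊕ ℝ³`. -/
def domain (W : ℕ → Type*) [∀ j, NormedAddCommGroup (W j)]
    (Ω a h g₀ : ℝ) (P : Coeffs) (j : ℕ) : Set (W j × Coupling) :=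
  {x | ‖x.1‖ ≤ a * (chi Ω P.beta j * gbar P g₀ j ^ 3) ∧
    |x.2.1 - gbar P g₀ j| ≤ h * (gbar P g₀ j ^ 2 * |Real.log (gbar P g₀ j)|) ∧
    |x.2.2.1 - (quadFlow P g₀ j).2.1|
      ≤ h * (chi Ω P.beta j * gbar P g₀ j ^ 2 * |Real.log (gbar P g₀ j)|) ∧
    |x.2.2.2 - (quadFlow P g₀ j).2.2|
      ≤ h * (chi Ω P.beta j * gbar P g₀ j ^ 2 * |Real.log (gbar P g₀ j)|)}

/-- The partial Fréchet derivative `D_K f(x)` of a map defined on `s ⊆ A ⊕ ℝ³`. -/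
def derivK {A F : Type*} [NormedAddCommGroup A] [NormedSpace ℝ A] [NormedAddCommGroup F]
    [NormedSpace ℝ F] (f : A × Coupling → F) (s : Set (A × Coupling)) (x : A × Coupling) :
    A →L[ℝ] F :=
  (fderivWithin ℝ f s x).comp (ContinuousLinearMap.inl ℝ A Coupling)

/-- The partial Fréchet derivative `D_V f(x)` of a map defined on `s ⊆ A ⊕ ℝ³`. -/
def derivV {A F : Type*} [NormedAddCommGroup A] [NormedSpace ℝ A] [NormedAddCommGroup F]
    [NormedSpace ℝ F] (f : A × Coupling → F) (s : Set (A × Coupling)) (x : A × Coupling) :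
    Coupling →L[ℝ] F :=
  (fderivWithin ℝ f s x).comp (ContinuousLinearMap.inr ℝ A Coupling)

/-- The operator norm of the multilinear map `D_V^m D_K^n f(x)` is at most `C`: the total derivative
of order `n + m` is evaluated on `n` vectors of `A` and `m` vectors of `ℝ³`. -/
def MixedDerivBound {A F : Type*} [NormedAddCommGroup A] [NormedSpace ℝ A] [NormedAddCommGroup F]
    [NormedSpace ℝ F] (f : A × Coupling → F) (s : Set (A × Coupling)) (x : A × Coupling)
    (n m : ℕ) (C : ℝ) : Prop :=
  ∀ (k : Fin n → A) (v : Fin m → Coupling),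
    ‖iteratedFDerivWithin ℝ (n + m) f s x
        (Fin.append (fun i => ((k i, 0) : A × Coupling)) (fun i => ((0, v i) : A × Coupling)))‖
      ≤ C * ((∏ i, ‖k i‖) * ∏ i, ‖v i‖)

/-- Assumption (A3) on the perturbation `(ψ_j, ρ_j)`, with parameters `(g₀, a, h, κ, Ω, R, M)`.
The maps are total functions of which only the restrictions to the domains `D_j` matter. -/
structure AssumptionA3 (Ω a h κ R M g₀ : ℝ) (P : Coeffs)
    (ψ : ∀ j, W j × Coupling → W (j + 1)) (ρ : ∀ j, W j × Coupling → Coupling) : Prop where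
  psi_contDiff : ∀ j, ContDiffOn ℝ 3 (ψ j) (domain W Ω a h g₀ P j)
  rho_contDiff : ∀ j, ContDiffOn ℝ 3 (ρ j) (domain W Ω a h g₀ P j)
  psi_le : ∀ j, ∀ x ∈ domain W Ω a h g₀ P j,
    ‖ψ j (0, x.2)‖ ≤ R * (chi Ω P.beta (j + 1) * gbar P g₀ (j + 1) ^ 3)
  rho_le : ∀ j, ∀ x ∈ domain W Ω a h g₀ P j,
    ‖ρ j x‖ ≤ M * (chi Ω P.beta (j + 1) * gbar P g₀ (j + 1) ^ 3)
  derivK_psi_le : ∀ j, ∀ x ∈ domain W Ω a h g₀ P j,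
    ‖derivK (ψ j) (domain W Ω a h g₀ P j) x‖ ≤ κ
  derivK_rho_le : ∀ j, ∀ x ∈ domain W Ω a h g₀ P j,
    ‖derivK (ρ j) (domain W Ω a h g₀ P j) x‖ ≤ M
  derivV_psi_le : ∀ j, ∀ x ∈ domain W Ω a h g₀ P j,
    ‖derivV (ψ j) (domain W Ω a h g₀ P j) x‖
      ≤ M * (chi Ω P.beta (j + 1) * gbar P g₀ (j + 1) ^ 2)
  derivV_rho_le : ∀ j, ∀ x ∈ domain W Ω a h g₀ P j,
    ‖derivV (ρ j) (domain W Ω a h g₀ P j) x‖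
      ≤ M * (chi Ω P.beta (j + 1) * gbar P g₀ (j + 1) ^ 2)
  higher_psi_le : ∀ j, ∀ x ∈ domain W Ω a h g₀ P j, ∀ n m : ℕ, 2 ≤ n + m → n + m ≤ 3 →
    MixedDerivBound (ψ j) (domain W Ω a h g₀ P j) x n m
      (M * (chi Ω P.beta (j + 1) * gbar P g₀ (j + 1) ^ 3) ^ (1 - (n : ℤ))
        * (gbar P g₀ (j + 1) ^ 2 * |Real.log (gbar P g₀ (j + 1))|) ^ (-(m : ℤ)))
  higher_rho_le : ∀ j, ∀ x ∈ domain W Ω a h g₀ P j, ∀ n m : ℕ, 2 ≤ n + m → n + m ≤ 3 →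
    MixedDerivBound (ρ j) (domain W Ω a h g₀ P j) x n m
      (M * (chi Ω P.beta (j + 1) * gbar P g₀ (j + 1) ^ 3) ^ (1 - (n : ℤ))
        * (gbar P g₀ (j + 1) ^ 2 * |Real.log (gbar P g₀ (j + 1))|) ^ (-(m : ℤ)))

/-- The evolution map `Φ_j(K, V) = (ψ_j(K, V), φ̄_j(V) + ρ_j(K, V))`. -/
def evolution (P : Coeffs) (ψ : ∀ j, W j × Coupling → W (j + 1))
    (ρ : ∀ j, W j × Coupling → Coupling) (j : ℕ) (x : W j × Coupling) : W (j + 1) × Coupling :=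
  (ψ j x, quadMap P j x.2 + ρ j x)

/-- The sequence `K̄_0 = K₀`, `K̄_{j+1} = ψ_j(K̄_j, V̄_j)`. -/
def approxK (ψ : ∀ j, W j × Coupling → W (j + 1)) (V : ℕ → Coupling) (K₀ : W 0) : ∀ j, W j
  | 0 => K₀
  | j + 1 => ψ j (approxK ψ V K₀ j, V j)

/-- The approximate flow `x̄ = (K̄, V̄)`, the flow of `Φ̄ = (ψ, φ̄)` with initial condition
`u₀ = (K₀, g₀)` and final condition `(z̄_∞, μ̄_∞) = (0, 0)`. -/
def approxFlow (P : Coeffs) (ψ : ∀ j, W j × Coupling → W (j + 1)) (u₀ : W 0 × ℝ) (j : ℕ) :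
    W j × Coupling :=
  (approxK ψ (quadFlow P u₀.2) u₀.1 j, quadFlow P u₀.2 j)

/-- `x` is a global flow of `Φ` with initial condition `(K_0, g_0) = u₀` and final condition
`(z_∞, μ_∞) = (0, 0)`. -/
structure IsGlobalFlow (P : Coeffs) (ψ : ∀ j, W j × Coupling → W (j + 1))
    (ρ : ∀ j, W j × Coupling → Coupling) (u₀ : W 0 × ℝ) (x : ∀ j, W j × Coupling) : Prop where
  init_K : (x 0).1 = u₀.1
  init_g : (x 0).2.1 = u₀.2
  step : ∀ j, x (j + 1) = evolution P ψ ρ j (x j)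
  z_lim : Tendsto (fun j => (x j).2.2.1) atTop (𝓝 0)
  mu_lim : Tendsto (fun j => (x j).2.2.2) atTop (𝓝 0)

/-- The bounds on the distance of `x` from the approximate flow with initial condition `u₀`. -/
structure FlowBounds (Ω a aStar h b : ℝ) (P : Coeffs) (ψ : ∀ j, W j × Coupling → W (j + 1))
    (u₀ : W 0 × ℝ) (x : ∀ j, W j × Coupling) : Prop where
  K_le : ∀ j, ‖(x j).1 - (approxFlow P ψ u₀ j).1‖
    ≤ b * (a - aStar) * (chi Ω P.beta j * gbar P u₀.2 j ^ 3)
  g_le : ∀ j, |(x j).2.1 - (approxFlow P ψ u₀ j).2.1|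
    ≤ b * h * (gbar P u₀.2 j ^ 2 * |Real.log (gbar P u₀.2 j)|)
  z_le : ∀ j, |(x j).2.2.1 - (approxFlow P ψ u₀ j).2.2.1|
    ≤ b * h * (chi Ω P.beta j * gbar P u₀.2 j ^ 2 * |Real.log (gbar P u₀.2 j)|)
  mu_le : ∀ j, |(x j).2.2.2 - (approxFlow P ψ u₀ j).2.2.2|
    ≤ b * h * (chi Ω P.beta j * gbar P u₀.2 j ^ 2 * |Real.log (gbar P u₀.2 j)|)

end Perturbation

end QuadFlow

end

open QuadFlow

/-!
As long as `χ_j = 1`, the inverse coupling `1 / ḡ_j` grows at least linearly up to the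
exceptional scales; afterwards `χ_j` decays geometrically. In both regimes
`∑_{k ≥ j} χ_k ḡ_k² = O(χ_j ḡ_j)` and `∑_{k < j} χ_k ḡ_k = O(|log ḡ_j|)`. Given `ḡ`, the equations
for `z̄` and `μ̄` are linear recursions, and the final conditions select the solutions that are
summed backwards from infinity.

A flow of `Φ` is a fixed point of a Picard map on sequences: `K_{j+1}` is `ψ_j` of the previous
iterate, and the couplings solve the equations linearised at `V̄`, forwards for `g` and backwards
from infinity for `z` and `μ`, with the nonlinear remainder and `ρ_j` evaluated at the previous
iterate. Measured in units of `χ_j ḡ_j³` for `K` and `χ_j ḡ_j² |log ḡ_j|` for the couplings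
(without `χ_j` for `g`), this map is a contraction near `(0, V̄)`: in the `K`-component because
`κ Ω < 1`, for the couplings because the sums of the perturbation cost only a fixed multiple of
these units, which is small relative to `h`.

The approximate flow is the fixed point for `ρ = 0`, so both flows lie in a common small tube
around `(0, V̄)`. Since `V̄` can be started at `g₀'` instead of `g₀`, one tube serves all initial
conditions near `(K₀', g₀')`; the Picard iterates are continuous in `(m, u₀)` and converge
uniformly, hence so is their limit.
-/

noncomputable section

namespace QuadFlow

/-! ### The cut-off weights -/

theorem chi_cases (Ω : ℝ) (β : ℕ → ℝ) :
    (cutoffTime Ω β = ⊤ ∧ ∀ j, chi Ω β j = 1) ∨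
      ∃ N : ℕ, cutoffTime Ω β = N ∧ (∀ j, chi Ω β j = (Ω ^ (j - N))⁻¹) ∧
        ∀ j, |β j| ≤ (Ω ^ (j - N))⁻¹ * ⨆ i, |β i| := by
  rcases Set.eq_empty_or_nonempty {k : ℕ | ∀ j, |β j| ≤ (Ω ^ (j - k))⁻¹ * ⨆ i, |β i|}
    with hempty | hne
  · have htop : cutoffTime Ω β = ⊤ := by
      rw [cutoffTime, hempty, Set.image_empty, sInf_empty]
    exact Or.inl ⟨htop, fun j => by simp [chi, htop]⟩
  · obtain ⟨N, hN, hNe⟩ := csInf_mem (hne.image (fun k : ℕ => (k : ℕ∞)))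
    have ht : cutoffTime Ω β = N := hNe.symm
    refine Or.inr ⟨N, ht, fun j => ?_, hN⟩
    rw [chi, ht, ← ENat.natCast_sub, ENat.toNat_natCast]

/-- The properties of the weights `χ_j` that the analysis uses: they start at `1`, are antitone,
lose at most a factor `Ω` per scale, and decay geometrically once they are below `1`. -/
structure CutoffWeight (Ω : ℝ) (χ : ℕ → ℝ) : Prop where
  zero : χ 0 = 1
  pos : ∀ j, 0 < χ j
  antitone : Antitone χ
  le_mul_succ : ∀ j, χ j ≤ Ω * χ (j + 1)
  eq_one_or : ∀ j, χ j = 1 ∨ ∀ l, χ (j + l) = χ j * (Ω ^ l)⁻¹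

theorem CutoffWeight.le_one {Ω : ℝ} {χ : ℕ → ℝ} (hχ : CutoffWeight Ω χ) (j : ℕ) : χ j ≤ 1 :=
  hχ.zero ▸ hχ.antitone (Nat.zero_le j)

theorem cutoffWeight_chi {Ω : ℝ} (hΩ : 1 < Ω) (β : ℕ → ℝ) : CutoffWeight Ω (chi Ω β) := by
  have := one_pos.trans hΩ
  rcases chi_cases Ω β with ⟨-, h⟩ | ⟨N, -, h, -⟩
  · exact ⟨h 0, fun j => by simp [h], fun i j _ => by simp [h], fun j => by simpa [h] using hΩ.le,
      fun j => Or.inl (h j)⟩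
  · refine ⟨by simp [h], fun j => ?_, fun i j hij => ?_, fun j => ?_, fun j => ?_⟩
    · rw [h]; positivity
    · rw [h, h]
      exact inv_anti₀ (by positivity) (pow_le_pow_right₀ hΩ.le (by omega))
    · rw [h, h, ← div_eq_mul_inv, inv_eq_one_div, div_le_div_iff₀ (by positivity) (by positivity),
        one_mul, ← pow_succ']
      exact pow_le_pow_right₀ hΩ.le (by omega)
    · rcases le_total N j with hj | hj
      · refine Or.inr fun l => ?_
        rw [h, h, ← mul_inv, ← pow_add]
        congr 2
        omega
      · exact Or.inl (by rw [h, Nat.sub_eq_zero_of_le hj, pow_zero, inv_one])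

theorem abs_beta_le_chi {Ω B : ℝ} (hΩ : 1 < Ω) {β : ℕ → ℝ} (hβ : ∀ j, |β j| ≤ B) (j : ℕ) :
    |β j| ≤ B * chi Ω β j := by
  have := one_pos.trans hΩ
  rcases chi_cases Ω β with ⟨-, h⟩ | ⟨N, -, h, h'⟩
  · simpa [h] using hβ j
  · rw [h, mul_comm]
    refine (h' j).trans ?_
    gcongr
    exact ciSup_le hβ

/-- The positive parts of `f` have total mass at most `S`: up to an error of mass `S`, the sequence
`f` is nonpositive. -/
def PosPartSumLE (S : ℝ) (f : ℕ → ℝ) : Prop :=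
  ∀ F : Finset ℕ, ∑ j ∈ F, max (f j) 0 ≤ S

namespace PosPartSumLE

variable {S : ℝ} {f : ℕ → ℝ}

theorem nonneg (h : PosPartSumLE S f) : 0 ≤ S := by
  simpa using h ∅

theorem sum_range_le (h : PosPartSumLE S f) (j n : ℕ) :
    ∑ k ∈ Finset.range n, max (f (j + k)) 0 ≤ S := by
  simpa using h ((Finset.range n).map (addLeftEmbedding j))

end PosPartSumLE

theorem chi_eq_one_of_le_cutoffTime {Ω : ℝ} {β : ℕ → ℝ} {j : ℕ}
    (hj : (j : ℕ∞) ≤ cutoffTime Ω β) : chi Ω β j = 1 := by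
  rcases chi_cases Ω β with ⟨-, h⟩ | ⟨N, hN, h, -⟩
  · exact h j
  · have hjN : j ≤ N := by exact_mod_cast hN ▸ hj
    rw [h, Nat.sub_eq_zero_of_le hjN, pow_zero, inv_one]

theorem sum_inv_pow_sub_le {Ω : ℝ} (hΩ : 1 < Ω) (N : ℕ) (F : Finset ℕ) (hF : ∀ j ∈ F, N < j) :
    ∑ j ∈ F, (Ω ^ (j - N))⁻¹ ≤ (Ω - 1)⁻¹ := by
  have h0 : 0 < Ω := by linarith
  have hq : Ω⁻¹ < 1 := inv_lt_one_of_one_lt₀ hΩ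
  have hinj : Set.InjOn (fun j => j - N - 1) (F : Set ℕ) := by
    intro x hx y hy hxy
    have := hF x hx
    have := hF y hy
    simp only at hxy
    omega
  have hsum := (hasSum_geometric_of_lt_one (inv_nonneg.2 h0.le) hq).mul_left Ω⁻¹
  calc ∑ j ∈ F, (Ω ^ (j - N))⁻¹ = ∑ n ∈ F.image (fun j => j - N - 1), Ω⁻¹ * Ω⁻¹ ^ n := by
        rw [Finset.sum_image hinj]
        refine Finset.sum_congr rfl fun j hj => ?_
        have := hF j hj
        rw [← pow_succ', show j - N - 1 + 1 = j - N by omega, inv_pow]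
    _ ≤ Ω⁻¹ * (1 - Ω⁻¹)⁻¹ := sum_le_hasSum _ (fun n _ => by positivity) hsum
    _ = (Ω - 1)⁻¹ := by
        have : Ω - 1 ≠ 0 := by linarith
        field_simp

theorem sum_chi_after_cutoffTime_le {Ω : ℝ} (hΩ : 1 < Ω) (β : ℕ → ℝ) (F : Finset ℕ)
    (hF : ∀ j ∈ F, ¬ (j : ℕ∞) ≤ cutoffTime Ω β) : ∑ j ∈ F, chi Ω β j ≤ (Ω - 1)⁻¹ := by
  rcases chi_cases Ω β with ⟨htop, -⟩ | ⟨N, hN, h, -⟩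
  · have hempty : F = ∅ := Finset.eq_empty_of_forall_notMem fun j hj => hF j hj (htop ▸ le_top)
    rw [hempty, Finset.sum_empty, inv_nonneg]
    linarith
  · simp only [h]
    exact sum_inv_pow_sub_le hΩ N F fun j hj => by simpa [hN] using hF j hj

theorem posPartSumLE_of_le_chi {Ω A s : ℝ} (hΩ : 1 < Ω) (hA : 0 ≤ A) {β f : ℕ → ℝ}
    (hle : ∀ j, f j ≤ A * chi Ω β j)
    (hfin : {j : ℕ | (j : ℕ∞) ≤ cutoffTime Ω β ∧ 0 < f j}.Finite)
    (hcard : ({j : ℕ | (j : ℕ∞) ≤ cutoffTime Ω β ∧ 0 < f j}.ncard : ℝ) ≤ s) :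
    PosPartSumLE (A * (s + (Ω - 1)⁻¹)) f := by
  classical
  intro F
  let early : ℕ → Prop := fun j => (j : ℕ∞) ≤ cutoffTime Ω β
  have hmax : ∀ j, max (f j) 0 ≤ A * chi Ω β j := fun j =>
    max_le (hle j) (mul_nonneg hA ((cutoffWeight_chi hΩ β).pos j).le)
  have hbefore : ∑ j ∈ F with early j, max (f j) 0 ≤ A * s := by
    calc ∑ j ∈ F with early j, max (f j) 0
        ≤ ∑ j ∈ F with early j, if 0 < f j then A else 0 := by
          refine Finset.sum_le_sum fun j hj => ?_
          split_ifs with hpos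
          · simpa [chi_eq_one_of_le_cutoffTime (Finset.mem_filter.1 hj).2] using hmax j
          · exact max_le (not_lt.1 hpos) le_rfl
      _ = A * ((F.filter early).filter fun j => 0 < f j).card := by
          rw [← Finset.sum_filter, Finset.sum_const, nsmul_eq_mul, mul_comm]
      _ ≤ A * s := by
          refine mul_le_mul_of_nonneg_left (le_trans ?_ hcard) hA
          rw [Set.ncard_eq_toFinset_card _ hfin, Nat.cast_le]
          refine Finset.card_le_card fun j hj => ?_
          simp only [Finset.mem_filter] at hj
          exact hfin.mem_toFinset.2 ⟨hj.1.2, hj.2⟩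
  have hafter : ∑ j ∈ F with ¬ early j, max (f j) 0 ≤ A * (Ω - 1)⁻¹ := by
    refine (Finset.sum_le_sum fun j _ => hmax j).trans ?_
    rw [← Finset.mul_sum]
    exact mul_le_mul_of_nonneg_left
      (sum_chi_after_cutoffTime_le hΩ β _ fun j hj => (Finset.mem_filter.1 hj).2) hA
  rw [← Finset.sum_filter_add_sum_filter_not F early, mul_add]
  exact add_le_add hbefore hafter

theorem exists_sq_mul_inv_pow_le {Ω : ℝ} (hΩ : 1 < Ω) :
    ∃ A : ℝ, ∀ n : ℕ, ((n : ℝ) + 1) ^ 2 * (Ω ^ n)⁻¹ ≤ A := by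
  have := one_pos.trans hΩ
  obtain ⟨A, hA⟩ := (tendsto_pow_const_div_const_pow_of_one_lt 2 hΩ).bddAbove_range
  refine ⟨A * Ω, fun n => ?_⟩
  have h := hA ⟨n + 1, rfl⟩
  simp only [Nat.cast_add, Nat.cast_one] at h
  rw [div_le_iff₀ (by positivity), pow_succ Ω] at h
  rw [← div_eq_mul_inv, div_le_iff₀ (by positivity)]
  linarith

theorem natCast_le_sum_chi {Ω : ℝ} (hΩ : 1 < Ω) {β : ℕ → ℝ} {n l : ℕ} (hnl : n ≤ l)
    (h : ∀ k < n, chi Ω β k = 1) : (n : ℝ) ≤ ∑ k ∈ Finset.range l, chi Ω β k := by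
  calc (n : ℝ) = ∑ k ∈ Finset.range n, chi Ω β k := by
        rw [Finset.sum_congr rfl fun k hk => h k (Finset.mem_range.1 hk), Finset.sum_const,
          Finset.card_range, nsmul_one]
    _ ≤ _ := Finset.sum_le_sum_of_subset_of_nonneg (by simpa using hnl)
        fun k _ _ => ((cutoffWeight_chi hΩ β).pos k).le

/-- The sum of the weights may stop growing with `l`, but only where `χ_l` is exponentially small,
so the weight pays for the missing growth. -/
theorem exists_chi_mul_sq_le {Ω : ℝ} (hΩ : 1 < Ω) :
    ∃ A : ℝ, ∀ β : ℕ → ℝ, ∀ l : ℕ,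
      chi Ω β l * ((l : ℝ) + 1) ^ 2 ≤ A * (1 + ∑ k ∈ Finset.range l, chi Ω β k) ^ 2 := by
  have := one_pos.trans hΩ
  obtain ⟨A, hA⟩ := exists_sq_mul_inv_pow_le hΩ
  have hA1 : 1 ≤ A := by simpa using hA 0
  refine ⟨A, fun β l => ?_⟩
  have before_cutoff : (∀ k ≤ l, chi Ω β k = 1) →
      chi Ω β l * ((l : ℝ) + 1) ^ 2 ≤ A * (1 + ∑ k ∈ Finset.range l, chi Ω β k) ^ 2 := by
    intro h
    have hsum := natCast_le_sum_chi hΩ le_rfl fun k hk => h k hk.le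
    rw [h l le_rfl, add_comm]
    gcongr
  rcases chi_cases Ω β with ⟨-, h⟩ | ⟨N, -, h, -⟩
  · exact before_cutoff fun k _ => h k
  have h_one : ∀ k ≤ N, chi Ω β k = 1 := fun k hk => by
    rw [h, Nat.sub_eq_zero_of_le hk, pow_zero, inv_one]
  rcases le_total l N with hlN | hNl
  · exact before_cutoff fun k hk => h_one k (hk.trans hlN)
  obtain ⟨n, rfl⟩ := Nat.exists_eq_add_of_le hNl
  have hsum := natCast_le_sum_chi hΩ hNl fun k hk => h_one k hk.le
  have hprod : ((N + n : ℕ) : ℝ) + 1 ≤ (N + 1) * (n + 1) := by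
    push_cast
    nlinarith [mul_nonneg (Nat.cast_nonneg (α := ℝ) N) (Nat.cast_nonneg (α := ℝ) n)]
  calc chi Ω β (N + n) * (((N + n : ℕ) : ℝ) + 1) ^ 2
      ≤ (Ω ^ n)⁻¹ * (((N : ℝ) + 1) * (n + 1)) ^ 2 := by
        rw [h, Nat.add_sub_cancel_left]
        gcongr
    _ = ((n : ℝ) + 1) ^ 2 * (Ω ^ n)⁻¹ * (1 + (N : ℝ)) ^ 2 := by ring
    _ ≤ A * (1 + (N : ℝ)) ^ 2 := by
        gcongr
        exact hA n
    _ ≤ _ := by gcongr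

/-! ### The running coupling `ḡ` -/

/-- The solution of `g_{j+1} = g_j - β_j g_j²` with initial value `g₀`. -/
def gSeq (β : ℕ → ℝ) (g₀ : ℝ) : ℕ → ℝ
  | 0 => g₀
  | j + 1 => gSeq β g₀ j - β j * gSeq β g₀ j ^ 2

/-- The sequence `β` is bounded by the weights, and bounded below by them up to an error of total
mass at most `S`. -/
structure BetaBounds (Ω B c S : ℝ) (χ β : ℕ → ℝ) : Prop where
  c_pos : 0 < c
  weight : CutoffWeight Ω χ
  abs_beta_le : ∀ j, |β j| ≤ B * χ j
  lower : PosPartSumLE S fun j => c * χ j - β j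

/-- The initial coupling `g₀` is small relative to the bound `B` on `β` and to the mass `S` of the
scales at which `β` has no lower bound. -/
structure IsSmallCoupling (B S g₀ : ℝ) : Prop where
  pos : 0 < g₀
  mul_B_le : 4 * B * g₀ ≤ 1
  mul_S_le : 4 * S * g₀ ≤ 1
  le : 8 * g₀ ≤ 1

theorem inv_add_le_inv_quadratic_step {b t : ℝ} (ht : 0 < t) (h : |b * t| ≤ 1 / 2) :
    0 < t - b * t ^ 2 ∧ 1 / t + b ≤ 1 / (t - b * t ^ 2) := by
  have h_pos : 0 < 1 - b * t := by linarith [(abs_le.1 h).2]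
  rw [show t - b * t ^ 2 = t * (1 - b * t) by ring]
  refine ⟨by positivity, ?_⟩
  rw [le_div_iff₀ (by positivity),
    show (1 / t + b) * (t * (1 - b * t)) = 1 - (b * t) ^ 2 by field_simp; ring]
  linarith [sq_nonneg (b * t)]

theorem gSeq_add (β : ℕ → ℝ) (g₀ : ℝ) (j n : ℕ) :
    ∑ k ∈ Finset.range n, β (j + k) * gSeq β g₀ (j + k) ^ 2
      = gSeq β g₀ j - gSeq β g₀ (j + n) := by
  induction n with
  | zero => simp
  | succ n ih =>
    rw [Finset.sum_range_succ, ih, ← add_assoc j n 1, gSeq]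
    ring

theorem continuous_gSeq {E : Type*} [TopologicalSpace E] {β : E → ℕ → ℝ}
    (hβ : ∀ j, Continuous fun m => β m j) (g₀ : ℝ) (j : ℕ) :
    Continuous fun m => gSeq (β m) g₀ j := by
  induction j with
  | zero => exact continuous_const
  | succ j ih => exact ih.sub ((hβ j).mul (ih.pow 2))

namespace BetaBounds

variable {Ω B c S g₀ : ℝ} {χ β : ℕ → ℝ}

theorem mass_nonneg (hb : BetaBounds Ω B c S χ β) : 0 ≤ S :=
  hb.lower.nonneg

theorem abs_mul_le_half (hb : BetaBounds Ω B c S χ β) (hg : IsSmallCoupling B S g₀) {t : ℝ}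
    (ht : 0 < t) (ht2 : t ≤ 2 * g₀) (j : ℕ) : |β j * t| ≤ 1 / 2 := by
  have hB : 0 ≤ B := by
    simpa [hb.weight.zero] using (abs_nonneg (β 0)).trans (hb.abs_beta_le 0)
  have hβ : |β j| ≤ B := (hb.abs_beta_le j).trans (mul_le_of_le_one_right hB (hb.weight.le_one j))
  calc |β j * t| = |β j| * t := by rw [abs_mul, abs_of_pos ht]
    _ ≤ B * (2 * g₀) := by gcongr
    _ ≤ 1 / 2 := by linarith [hg.mul_B_le]

theorem half_inv_le_inv_sub (hb : BetaBounds Ω B c S χ β) (hg : IsSmallCoupling B S g₀) {t : ℝ}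
    (ht : 0 < t) (ht2 : t ≤ 2 * g₀) : 1 / (2 * t) ≤ 1 / t - S := by
  rw [le_sub_iff_add_le, div_add' _ _ _ (by positivity), div_le_div_iff₀ (by positivity) ht]
  nlinarith [mul_le_mul_of_nonneg_left ht2 hb.mass_nonneg, hg.mul_S_le]

theorem mul_sum_chi_le (hb : BetaBounds Ω B c S χ β) {w : ℕ → ℝ} {W : ℝ} (j n : ℕ)
    (hw0 : ∀ k, 0 ≤ w (j + k)) (hw : ∀ k, w (j + k) ≤ W) :
    c * ∑ k ∈ Finset.range n, χ (j + k) * w (j + k)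
      ≤ (∑ k ∈ Finset.range n, β (j + k) * w (j + k)) + S * W := by
  set e : ℕ → ℝ := fun i => max (c * χ i - β i) 0
  have hW : 0 ≤ W := (hw0 0).trans (hw 0)
  calc c * ∑ k ∈ Finset.range n, χ (j + k) * w (j + k)
      = ∑ k ∈ Finset.range n, (c * χ (j + k)) * w (j + k) := by
        rw [Finset.mul_sum]
        exact Finset.sum_congr rfl fun k _ => by ring
    _ ≤ ∑ k ∈ Finset.range n, (β (j + k) * w (j + k) + e (j + k) * W) := by
        refine Finset.sum_le_sum fun k _ => ?_
        have h1 := mul_le_mul_of_nonneg_right (le_max_left (c * χ (j + k) - β (j + k)) 0) (hw0 k)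
        have h2 := mul_le_mul_of_nonneg_left (hw k) (le_max_right (c * χ (j + k) - β (j + k)) 0)
        linarith
    _ = (∑ k ∈ Finset.range n, β (j + k) * w (j + k)) + (∑ k ∈ Finset.range n, e (j + k)) * W := by
        rw [Finset.sum_add_distrib, Finset.sum_mul]
    _ ≤ _ := by
        gcongr
        exact hb.lower.sum_range_le j n

theorem inv_gSeq_add_le_of_bounds (hb : BetaBounds Ω B c S χ β) (hg : IsSmallCoupling B S g₀)
    {j n : ℕ} (h : ∀ k < n, 0 < gSeq β g₀ (j + k) ∧ gSeq β g₀ (j + k) ≤ 2 * g₀) :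
    1 / gSeq β g₀ j + c * (∑ k ∈ Finset.range n, χ (j + k)) - S ≤ 1 / gSeq β g₀ (j + n) := by
  have hβ : 1 / gSeq β g₀ j + ∑ k ∈ Finset.range n, β (j + k) ≤ 1 / gSeq β g₀ (j + n) := by
    induction n with
    | zero => simp
    | succ n ih =>
      obtain ⟨hpos, hle⟩ := h n n.lt_succ_self
      have hstep := (inv_add_le_inv_quadratic_step hpos (hb.abs_mul_le_half hg hpos hle (j + n))).2
      have hprev := ih fun k hk => h k (hk.trans n.lt_succ_self)
      rw [Finset.sum_range_succ, ← add_assoc j n 1, gSeq]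
      linarith
  have hlower := hb.mul_sum_chi_le (w := 1) (W := 1) j n (fun _ => zero_le_one) (fun _ => le_rfl)
  simp only [Pi.one_apply, mul_one] at hlower
  linarith

theorem gSeq_bounds (hb : BetaBounds Ω B c S χ β) (hg : IsSmallCoupling B S g₀) (j : ℕ) :
    0 < gSeq β g₀ j ∧ gSeq β g₀ j ≤ 2 * g₀ := by
  induction j using Nat.strong_induction_on with
  | _ j ih =>
    have hg0 := hg.pos
    cases j with
    | zero => exact ⟨hg0, by rw [gSeq]; linarith⟩
    | succ j =>
      obtain ⟨hpos, hle⟩ := ih j j.lt_succ_self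
      have hpos' : 0 < gSeq β g₀ (j + 1) :=
        (inv_add_le_inv_quadratic_step hpos (hb.abs_mul_le_half hg hpos hle j)).1
      have hinv := hb.inv_gSeq_add_le_of_bounds hg (j := 0) (n := j + 1)
        fun k hk => by simpa using ih k hk
      have hχ : 0 ≤ c * ∑ k ∈ Finset.range (j + 1), χ (0 + k) :=
        mul_nonneg hb.c_pos.le (Finset.sum_nonneg fun k _ => (hb.weight.pos _).le)
      have hhalf := hb.half_inv_le_inv_sub hg hg0 (by linarith)
      rw [zero_add, gSeq] at hinv
      exact ⟨hpos', (one_div_le_one_div (by positivity) hpos').1 (by linarith)⟩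

theorem inv_gSeq_add_le (hb : BetaBounds Ω B c S χ β) (hg : IsSmallCoupling B S g₀) (j n : ℕ) :
    1 / gSeq β g₀ j + c * (∑ k ∈ Finset.range n, χ (j + k)) - S ≤ 1 / gSeq β g₀ (j + n) :=
  hb.inv_gSeq_add_le_of_bounds hg fun _ _ => hb.gSeq_bounds hg _

theorem gSeq_quasi_antitone (hb : BetaBounds Ω B c S χ β) (hg : IsSmallCoupling B S g₀)
    (j n : ℕ) : gSeq β g₀ (j + n) ≤ 2 * gSeq β g₀ j := by
  obtain ⟨hpos, hle⟩ := hb.gSeq_bounds hg j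
  have hinv := hb.inv_gSeq_add_le hg j n
  have hχ : 0 ≤ c * ∑ k ∈ Finset.range n, χ (j + k) :=
    mul_nonneg hb.c_pos.le (Finset.sum_nonneg fun k _ => (hb.weight.pos _).le)
  have hhalf := hb.half_inv_le_inv_sub hg hpos hle
  exact (one_div_le_one_div (by positivity) (hb.gSeq_bounds hg (j + n)).1).1 (by linarith)

theorem sum_chi_gSeq_le (hb : BetaBounds Ω B c S χ β) (hg : IsSmallCoupling B S g₀)
    (hlog : Real.log g₀ ≤ -1) (j : ℕ) :
    ∑ k ∈ Finset.range j, χ k * gSeq β g₀ k ≤ c⁻¹ * -Real.log (gSeq β g₀ j) := by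
  have hlogs : ∑ k ∈ Finset.range j, β k * gSeq β g₀ k
      ≤ Real.log g₀ - Real.log (gSeq β g₀ j) := by
    induction j with
    | zero => simp [gSeq]
    | succ j ih =>
      obtain ⟨hpos, hle⟩ := hb.gSeq_bounds hg j
      have hfactor : 0 < 1 - β j * gSeq β g₀ j := by
        linarith [(abs_le.1 (hb.abs_mul_le_half hg hpos hle j)).2]
      have hstep : gSeq β g₀ (j + 1) = gSeq β g₀ j * (1 - β j * gSeq β g₀ j) := by
        rw [gSeq]
        ring
      rw [Finset.sum_range_succ, hstep, Real.log_mul hpos.ne' hfactor.ne']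
      linarith [Real.log_le_sub_one_of_pos hfactor]
  have hlower := hb.mul_sum_chi_le (w := gSeq β g₀) (W := 2 * g₀) 0 j
    (fun k => (hb.gSeq_bounds hg _).1.le) (fun k => (hb.gSeq_bounds hg _).2)
  simp only [zero_add] at hlower
  rw [inv_mul_eq_div, le_div_iff₀ hb.c_pos]
  linarith [hg.mul_S_le]

theorem gSeq_sq_le (hb : BetaBounds Ω B c S χ β) (hg : IsSmallCoupling B S g₀) (j k : ℕ) :
    gSeq β g₀ (j + k) ^ 2 ≤ 4 * gSeq β g₀ j ^ 2 := by
  have := pow_le_pow_left₀ (hb.gSeq_bounds hg (j + k)).1.le (hb.gSeq_quasi_antitone hg j k) 2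
  linarith

theorem sum_chi_gSeq_sq_le_of_eq_one (hb : BetaBounds Ω B c S χ β) (hg : IsSmallCoupling B S g₀)
    {j : ℕ} (hj : χ j = 1) (n : ℕ) :
    ∑ k ∈ Finset.range n, χ (j + k) * gSeq β g₀ (j + k) ^ 2
      ≤ 3 * c⁻¹ * (χ j * gSeq β g₀ j) := by
  obtain ⟨hpos, hle⟩ := hb.gSeq_bounds hg j
  have hlower := hb.mul_sum_chi_le (w := fun k => gSeq β g₀ k ^ 2) j n
    (fun k => sq_nonneg _) (hb.gSeq_sq_le hg j)
  rw [gSeq_add] at hlower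
  have hend := (hb.gSeq_bounds hg (j + n)).1
  have hmass : S * (4 * gSeq β g₀ j ^ 2) ≤ 2 * gSeq β g₀ j := by
    nlinarith [mul_le_mul_of_nonneg_left hle hb.mass_nonneg, hg.mul_S_le]
  rw [hj, one_mul, mul_comm 3, mul_assoc, inv_mul_eq_div, le_div_iff₀ hb.c_pos]
  linarith

theorem sum_chi_gSeq_sq_le_of_decay (hb : BetaBounds Ω B c S χ β) (hΩ : 1 < Ω)
    (hg : IsSmallCoupling B S g₀) {j : ℕ} (hj : ∀ l, χ (j + l) = χ j * (Ω ^ l)⁻¹) (n : ℕ) :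
    ∑ k ∈ Finset.range n, χ (j + k) * gSeq β g₀ (j + k) ^ 2
      ≤ (1 - Ω⁻¹)⁻¹ * (χ j * gSeq β g₀ j) := by
  obtain ⟨hpos, hle⟩ := hb.gSeq_bounds hg j
  have hΩ0 : 0 ≤ Ω⁻¹ := by positivity
  have hΩ1 : Ω⁻¹ < 1 := inv_lt_one_of_one_lt₀ hΩ
  have hχ := hb.weight.pos j
  calc ∑ k ∈ Finset.range n, χ (j + k) * gSeq β g₀ (j + k) ^ 2
      ≤ ∑ k ∈ Finset.range n, Ω⁻¹ ^ k * (χ j * (4 * gSeq β g₀ j ^ 2)) := by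
        refine Finset.sum_le_sum fun k _ => ?_
        rw [hj k, inv_pow, mul_comm (χ j), mul_assoc]
        gcongr
        exact hb.gSeq_sq_le hg j k
    _ = (∑ k ∈ Finset.range n, Ω⁻¹ ^ k) * (χ j * (4 * gSeq β g₀ j ^ 2)) := by
        rw [Finset.sum_mul]
    _ ≤ (1 - Ω⁻¹)⁻¹ * (χ j * (4 * gSeq β g₀ j ^ 2)) := by
        gcongr
        exact sum_le_hasSum _ (fun k _ => by positivity) (hasSum_geometric_of_lt_one hΩ0 hΩ1)
    _ ≤ _ := by
        have : 0 ≤ (1 - Ω⁻¹)⁻¹ := inv_nonneg.2 (by linarith)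
        gcongr
        nlinarith [hg.le]

theorem sum_chi_gSeq_sq_le (hb : BetaBounds Ω B c S χ β) (hΩ : 1 < Ω)
    (hg : IsSmallCoupling B S g₀) (j n : ℕ) :
    ∑ k ∈ Finset.range n, χ (j + k) * gSeq β g₀ (j + k) ^ 2
      ≤ (3 * c⁻¹ + (1 - Ω⁻¹)⁻¹) * (χ j * gSeq β g₀ j) := by
  have hχg : 0 ≤ χ j * gSeq β g₀ j := mul_nonneg (hb.weight.pos j).le (hb.gSeq_bounds hg j).1.le
  have hc : 0 ≤ c⁻¹ := inv_nonneg.2 hb.c_pos.le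
  have hΩ' : 0 ≤ (1 - Ω⁻¹)⁻¹ := inv_nonneg.2 (by linarith [inv_lt_one_of_one_lt₀ hΩ])
  rw [add_mul]
  rcases hb.weight.eq_one_or j with hj | hj
  · exact (hb.sum_chi_gSeq_sq_le_of_eq_one hg hj n).trans (le_add_of_nonneg_right (by positivity))
  · exact (hb.sum_chi_gSeq_sq_le_of_decay hΩ hg hj n).trans
      (le_add_of_nonneg_left (by positivity))

theorem chi_gSeq_sq_decay (hb : BetaBounds Ω B c S χ β) (hg : IsSmallCoupling B S g₀) {A : ℝ}
    {l : ℕ} (hA : χ l * ((l : ℝ) + 1) ^ 2 ≤ A * (1 + ∑ k ∈ Finset.range l, χ k) ^ 2) :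
    χ l * gSeq β g₀ l ^ 2 ≤ A / (min 1 c) ^ 2 * (1 / ((l : ℝ) + 1) ^ 2) := by
  have hinv := hb.inv_gSeq_add_le hg 0 l
  have hs : 0 ≤ ∑ k ∈ Finset.range l, χ k := Finset.sum_nonneg fun k _ => (hb.weight.pos _).le
  simp only [zero_add, gSeq] at hinv
  have hpos := (hb.gSeq_bounds hg l).1
  set s := ∑ k ∈ Finset.range l, χ k
  set g := gSeq β g₀ l
  have hm : 0 < min 1 c := lt_min one_pos hb.c_pos
  have hone : 1 ≤ 1 / g₀ - S := by
    rw [le_sub_iff_add_le, le_div_iff₀ hg.pos]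
    nlinarith [hg.mul_S_le, hg.le]
  have hle : min 1 c * (1 + s) ≤ 1 / g := by
    linarith [min_le_left 1 c, mul_le_mul_of_nonneg_right (min_le_right 1 c) hs]
  rw [le_div_iff₀ hpos] at hle
  have hA0 : 0 ≤ A := by
    have h : 0 ≤ A * (1 + s) ^ 2 := le_trans (by have := hb.weight.pos l; positivity) hA
    exact nonneg_of_mul_nonneg_left h (by positivity)
  rw [div_mul_div_comm, le_div_iff₀ (by positivity)]
  calc χ l * g ^ 2 * (min 1 c ^ 2 * ((l : ℝ) + 1) ^ 2)
      = (χ l * ((l : ℝ) + 1) ^ 2) * (g ^ 2 * min 1 c ^ 2) := by ring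
    _ ≤ (A * (1 + s) ^ 2) * (g ^ 2 * min 1 c ^ 2) := by gcongr
    _ = A * (min 1 c * (1 + s) * g) ^ 2 := by ring
    _ ≤ A * 1 := by
        gcongr
        exact pow_le_one₀ (by positivity) hle

end BetaBounds

/-! ### Linear recursions solved from infinity -/

/-- The term of index `l` in the solution from infinity of `x_{j+1} = a_j x_j + f_j`. -/
def backTerm (a f : ℕ → ℝ) (j l : ℕ) : ℝ :=
  (∏ k ∈ Finset.range (l + 1), a (j + k))⁻¹ * f (j + l)

/-- The solution of the recursion `x_{j+1} = a_j x_j + f_j` that vanishes at infinity. -/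
def backSum (a f : ℕ → ℝ) (j : ℕ) : ℝ := -∑' l, backTerm a f j l

/-- All products of consecutive terms of `a` are at least `1/2`: the recursion
`x_{j+1} = a_j x_j + f_j` is then solved stably from infinity. -/
def HalfLeProd (a : ℕ → ℝ) : Prop := ∀ j l, 1 / 2 ≤ ∏ k ∈ Finset.range l, a (j + k)

theorem HalfLeProd.ne_zero {a : ℕ → ℝ} (ha : HalfLeProd a) (j : ℕ) : a j ≠ 0 := by
  have h := ha j 1
  rw [Finset.prod_range_one, add_zero] at h
  linarith

theorem one_sub_sum_le_prod {a e : ℕ → ℝ} (h : ∀ k, 1 - e k ≤ a k) (he : ∀ k, 0 ≤ e k)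
    (hs : ∀ n, ∑ k ∈ Finset.range n, e k ≤ 1) (n : ℕ) :
    1 - ∑ k ∈ Finset.range n, e k ≤ ∏ k ∈ Finset.range n, a k := by
  induction n with
  | zero => simp
  | succ n ih =>
    have hprod : 0 ≤ ∏ k ∈ Finset.range n, a k := by linarith [hs n]
    have hlast := mul_le_mul_of_nonneg_left (h n) hprod
    have hsum : 0 ≤ ∑ k ∈ Finset.range n, e k := Finset.sum_nonneg fun k _ => he k
    have hen : e n ≤ 1 := by
      have := hs (n + 1)
      rw [Finset.sum_range_succ] at this
      linarith
    rw [Finset.sum_range_succ, Finset.prod_range_succ]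
    nlinarith [mul_le_mul_of_nonneg_right ih (sub_nonneg.2 hen), mul_nonneg hsum (he n)]

theorem halfLeProd_one_sub_mul {f g : ℕ → ℝ} {S G : ℝ} (hf : PosPartSumLE S f)
    (hg : ∀ j, 0 < g j) (hG : ∀ j, g j ≤ G) (hS : 2 * S * G ≤ 1) :
    HalfLeProd fun j => 1 - f j * g j := by
  intro j l
  have hsum : ∀ n, ∑ k ∈ Finset.range n, max (f (j + k)) 0 * g (j + k) ≤ 1 / 2 := fun n =>
    calc ∑ k ∈ Finset.range n, max (f (j + k)) 0 * g (j + k)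
        ≤ ∑ k ∈ Finset.range n, max (f (j + k)) 0 * G :=
          Finset.sum_le_sum fun k _ => mul_le_mul_of_nonneg_left (hG _) (le_max_right _ _)
      _ = (∑ k ∈ Finset.range n, max (f (j + k)) 0) * G := by rw [Finset.sum_mul]
      _ ≤ S * G :=
          mul_le_mul_of_nonneg_right (hf.sum_range_le j n) ((hg 0).le.trans (hG 0))
      _ ≤ 1 / 2 := by linarith
  refine le_trans (by linarith [hsum l]) (one_sub_sum_le_prod
    (e := fun k => max (f (j + k)) 0 * g (j + k)) (fun k => ?_)
    (fun k => mul_nonneg (le_max_right _ _) (hg _).le)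
    (fun n => (hsum n).trans (by norm_num)) l)
  have := mul_le_mul_of_nonneg_right (le_max_left (f (j + k)) 0) (hg (j + k)).le
  linarith

theorem eq_zero_of_recursion {a d : ℕ → ℝ} {m : ℝ} (hm : 0 < m)
    (ha : ∀ j l, m ≤ |∏ k ∈ Finset.range l, a (j + k)|) (hd : ∀ j, d (j + 1) = a j * d j)
    (hlim : Tendsto d atTop (𝓝 0)) (j : ℕ) : d j = 0 := by
  have hprod : ∀ l, d (j + l) = (∏ k ∈ Finset.range l, a (j + k)) * d j := by
    intro l
    induction l with
    | zero => simp
    | succ l ih =>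
      rw [← add_assoc, hd, ih, Finset.prod_range_succ]
      ring
  have hshift : Tendsto (fun l => |d (j + l)|) atTop (𝓝 0) := by
    simpa [Function.comp_def, add_comm] using (hlim.comp (tendsto_add_atTop_nat j)).abs
  have hle : m * |d j| ≤ 0 := by
    refine ge_of_tendsto' hshift fun l => ?_
    rw [hprod, abs_mul]
    exact mul_le_mul_of_nonneg_right (ha j l) (abs_nonneg _)
  exact abs_nonpos_iff.1 (nonpos_of_mul_nonpos_right hle hm)

section BackSum

variable {a f f' : ℕ → ℝ} {j : ℕ} {Q : ℝ}

theorem backTerm_succ (a f : ℕ → ℝ) (j l : ℕ) :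
    backTerm a f j (l + 1) = (a j)⁻¹ * backTerm a f (j + 1) l := by
  have hshift : ∀ k, j + (k + 1) = j + 1 + k := fun k => by omega
  rw [backTerm, backTerm, Finset.prod_range_succ' _ (l + 1), mul_inv_rev, ← mul_assoc, hshift l,
    Finset.prod_congr rfl fun k _ => by rw [hshift k], add_zero]

theorem backSum_succ (ha : a j ≠ 0) (hs : Summable (backTerm a f j)) :
    backSum a f (j + 1) = a j * backSum a f j + f j := by
  rw [backSum, backSum, hs.tsum_eq_zero_add]
  simp only [backTerm_succ, tsum_mul_left]
  simp only [backTerm, zero_add, Finset.range_one, Finset.prod_singleton, add_zero]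
  field_simp
  ring

theorem summable_backTerm (h : ∀ n, ∑ l ∈ Finset.range n, |backTerm a f j l| ≤ Q) :
    Summable (backTerm a f j) :=
  (summable_of_sum_range_le (fun _ => abs_nonneg _) h).of_abs

theorem abs_backSum_le (h : ∀ n, ∑ l ∈ Finset.range n, |backTerm a f j l| ≤ Q) :
    |backSum a f j| ≤ Q := by
  have hs : Summable fun l => |backTerm a f j l| :=
    summable_of_sum_range_le (fun _ => abs_nonneg _) h
  rw [backSum, abs_neg]
  exact (norm_tsum_le_tsum_norm (f := backTerm a f j) hs).trans (hs.tsum_le_of_sum_range_le h)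

theorem backSum_sub (h : Summable (backTerm a f j)) (h' : Summable (backTerm a f' j)) :
    backSum a f j - backSum a f' j = backSum a (fun i => f i - f' i) j := by
  have hterm : backTerm a (fun i => f i - f' i) j
      = fun l => backTerm a f j l - backTerm a f' j l :=
    funext fun l => mul_sub _ _ _
  rw [backSum, backSum, backSum, hterm, h.tsum_sub h']
  ring

theorem HalfLeProd.abs_backTerm_le (ha : HalfLeProd a) (f : ℕ → ℝ) (j l : ℕ) :
    |backTerm a f j l| ≤ 2 * |f (j + l)| := by
  have h := ha j (l + 1)
  rw [backTerm, abs_mul, abs_inv]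
  gcongr
  exact inv_le_of_inv_le₀ two_pos (by simpa using h.trans (le_abs_self _))

theorem HalfLeProd.sum_abs_backTerm_le (ha : HalfLeProd a)
    (hf : ∀ n, ∑ l ∈ Finset.range n, |f (j + l)| ≤ Q) (n : ℕ) :
    ∑ l ∈ Finset.range n, |backTerm a f j l| ≤ 2 * Q :=
  calc ∑ l ∈ Finset.range n, |backTerm a f j l|
      ≤ ∑ l ∈ Finset.range n, 2 * |f (j + l)| :=
        Finset.sum_le_sum fun l _ => ha.abs_backTerm_le f j l
    _ ≤ 2 * Q := by
        rw [← Finset.mul_sum]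
        linarith [hf n]

theorem abs_backTerm_le_of_pow {q : ℝ} (hq : 0 < q) (ha : ∀ j, q ≤ |a j|) (f : ℕ → ℝ)
    (j l : ℕ) : |backTerm a f j l| ≤ q⁻¹ ^ (l + 1) * |f (j + l)| := by
  rw [backTerm, abs_mul, abs_inv, inv_pow]
  gcongr
  rw [Finset.abs_prod]
  calc q ^ (l + 1) = ∏ _k ∈ Finset.range (l + 1), q := by simp
    _ ≤ _ := Finset.prod_le_prod (fun _ _ => hq.le) fun k _ => ha _

theorem sum_abs_backTerm_le_of_pow {q : ℝ} (hq : 1 < q) (ha : ∀ j, q ≤ |a j|)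
    (hf : ∀ l, |f (j + l)| ≤ Q) (n : ℕ) :
    ∑ l ∈ Finset.range n, |backTerm a f j l| ≤ Q / (q - 1) := by
  have hq0 : 0 < q := one_pos.trans hq
  have hQ : 0 ≤ Q := (abs_nonneg _).trans (hf 0)
  calc ∑ l ∈ Finset.range n, |backTerm a f j l|
      ≤ ∑ l ∈ Finset.range n, q⁻¹ ^ l * (q⁻¹ * Q) := by
        refine Finset.sum_le_sum fun l _ => (abs_backTerm_le_of_pow hq0 ha f j l).trans ?_
        rw [pow_succ, mul_assoc]
        gcongr
        exact hf l
    _ = (∑ l ∈ Finset.range n, q⁻¹ ^ l) * (q⁻¹ * Q) := by rw [Finset.sum_mul]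
    _ ≤ (1 - q⁻¹)⁻¹ * (q⁻¹ * Q) := by
        gcongr
        exact sum_le_hasSum _ (fun k _ => by positivity)
          (hasSum_geometric_of_lt_one (by positivity) (inv_lt_one_of_one_lt₀ hq))
    _ = Q / (q - 1) := by
        rw [← mul_assoc, ← mul_inv, sub_mul, one_mul, inv_mul_cancel₀ hq0.ne', inv_mul_eq_div]

theorem continuousOn_backSum {X : Type*} [TopologicalSpace X] {s : Set X} {a f : X → ℕ → ℝ}
    (ha : ∀ j, ContinuousOn (fun x => a x j) s) (hf : ∀ j, ContinuousOn (fun x => f x j) s)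
    (ha0 : ∀ x ∈ s, ∀ j, a x j ≠ 0) {u : ℕ → ℝ} (hu : Summable u)
    (hb : ∀ x ∈ s, ∀ l, |backTerm (a x) (f x) j l| ≤ u l) :
    ContinuousOn (fun x => backSum (a x) (f x) j) s := by
  refine (continuousOn_tsum (fun l => ?_) hu fun l x hx => hb x hx l).neg
  refine ContinuousOn.mul (ContinuousOn.inv₀ ?_ fun x hx => ?_) (hf _)
  · exact continuousOn_finsetProd _ fun k _ => ha _
  · exact Finset.prod_ne_zero_iff.2 fun k _ => ha0 x hx _

end BackSum

/-! ### The quadratic flow `V̄` -/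

/-- The bounds on the coefficients of the quadratic map, apart from those on `β` and apart from the
one-sided bound on `ζ`. -/
structure CoeffBounds (C lam₀ : ℝ) (χ : ℕ → ℝ) (P : Coeffs) : Prop where
  le_lam : ∀ j, lam₀ ≤ P.lam j
  eta_le : ∀ j, |P.eta j| ≤ C * χ j
  gamma_le : ∀ j, |P.gamma j| ≤ C * χ j
  theta_le : ∀ j, |P.theta j| ≤ C * χ j
  zeta_le : ∀ j, |P.zeta j| ≤ C * χ j
  ups_gg_le : ∀ j, |P.ups_gg j| ≤ C * χ j
  ups_gz_le : ∀ j, |P.ups_gz j| ≤ C * χ j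
  ups_gmu_le : ∀ j, |P.ups_gmu j| ≤ C * χ j
  ups_zz_le : ∀ j, |P.ups_zz j| ≤ C * χ j
  ups_zmu_le : ∀ j, |P.ups_zmu j| ≤ C * χ j

/-- The properties of `ḡ` on which the solution from infinity of the equations for `z` and `μ`
rests. -/
structure CouplingBounds (L A : ℝ) (χ g : ℕ → ℝ) : Prop where
  chi_pos : ∀ j, 0 < χ j
  chi_le_one : ∀ j, χ j ≤ 1
  chi_antitone : Antitone χ
  pos : ∀ j, 0 < g j
  le_one : ∀ j, g j ≤ 1
  quasi_antitone : ∀ j n, g (j + n) ≤ 2 * g j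
  sum_sq_le : ∀ j n, ∑ k ∈ Finset.range n, χ (j + k) * g (j + k) ^ 2 ≤ L * (χ j * g j)
  decay : ∀ l : ℕ, χ l * g l ^ 2 ≤ A * (1 / ((l : ℝ) + 1) ^ 2)

/-- The multiplier of `z` in the quadratic flow. -/
def zCoeff (P : Coeffs) (g : ℕ → ℝ) (j : ℕ) : ℝ := 1 - P.zeta j * g j

/-- The `z`-component of the quadratic flow with given `g`-component. -/
def zBar (P : Coeffs) (g : ℕ → ℝ) : ℕ → ℝ :=
  backSum (zCoeff P g) fun j => -(P.theta j * g j ^ 2)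

/-- The `μ`-component of the quadratic map without its leading term `λ_j μ`. -/
def muForcing (P : Coeffs) (j : ℕ) (V : Coupling) : ℝ :=
  P.eta j * V.1 + P.gamma j * V.2.1
    - (P.ups_gg j * V.1 ^ 2 + P.ups_gz j * V.1 * V.2.1 + P.ups_gmu j * V.1 * V.2.2
      + P.ups_zz j * V.2.1 ^ 2 + P.ups_zmu j * V.2.1 * V.2.2)

/-- The multiplier of `μ` in the quadratic flow. -/
def muCoeff (P : Coeffs) (g z : ℕ → ℝ) (j : ℕ) : ℝ :=
  P.lam j - P.ups_gmu j * g j - P.ups_zmu j * z j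

/-- The inhomogeneity of the equation for `μ` in the quadratic flow. -/
def muSource (P : Coeffs) (g z : ℕ → ℝ) (j : ℕ) : ℝ := muForcing P j (g j, z j, 0)

/-- The `μ`-component of the quadratic flow with given `g`- and `z`-components. -/
def muBar (P : Coeffs) (g z : ℕ → ℝ) : ℕ → ℝ := backSum (muCoeff P g z) (muSource P g z)

/-- The quadratic flow with given `g`-component whose `z`- and `μ`-components vanish at
infinity. -/
def barFlow (P : Coeffs) (g : ℕ → ℝ) (j : ℕ) : Coupling := (g j, zBar P g j, muBar P g (zBar P g) j)

theorem quadMap_mu (P : Coeffs) (j : ℕ) (V : Coupling) :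
    (quadMap P j V).2.2 = P.lam j * V.2.2 + muForcing P j V := by
  simp only [quadMap, muForcing]
  ring

theorem quadMap_mu_eq_muCoeff_mul (P : Coeffs) (V : ℕ → Coupling) (j : ℕ) :
    (quadMap P j (V j)).2.2
      = muCoeff P (fun i => (V i).1) (fun i => (V i).2.1) j * (V j).2.2
        + muSource P (fun i => (V i).1) (fun i => (V i).2.1) j := by
  simp only [quadMap, muCoeff, muSource, muForcing]
  ring

theorem abs_fst_le_norm (V : Coupling) : |V.1| ≤ ‖V‖ := norm_fst_le V

theorem abs_snd_fst_le_norm (V : Coupling) : |V.2.1| ≤ ‖V‖ :=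
  (norm_fst_le V.2).trans (norm_snd_le V)

theorem abs_snd_snd_le_norm (V : Coupling) : |V.2.2| ≤ ‖V‖ :=
  (norm_snd_le V.2).trans (norm_snd_le V)

theorem abs_mul_sub_mul_le {x y x' y' G T : ℝ} (hx : |x| ≤ G) (hy' : |y'| ≤ G)
    (hxx' : |x - x'| ≤ T) (hyy' : |y - y'| ≤ T) : |x * y - x' * y'| ≤ 2 * (G * T) :=
  calc |x * y - x' * y'| = |x * (y - y') + (x - x') * y'| := by ring_nf
    _ ≤ |x| * |y - y'| + |x - x'| * |y'| := by
        simpa only [abs_mul] using abs_add_le (x * (y - y')) ((x - x') * y')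
    _ ≤ G * T + T * G := by
        have hG : 0 ≤ G := (abs_nonneg _).trans hx
        have hT : 0 ≤ T := (abs_nonneg _).trans hxx'
        gcongr
    _ = 2 * (G * T) := by ring

section Flow

variable {C lam₀ L A Z : ℝ} {χ g z : ℕ → ℝ} {P : Coeffs}

theorem CouplingBounds.mass_nonneg (hg : CouplingBounds L A χ g) : 0 ≤ L := by
  have h := hg.sum_sq_le 0 0
  rw [Finset.range_zero, Finset.sum_empty] at h
  exact nonneg_of_mul_nonneg_left h (mul_pos (hg.chi_pos 0) (hg.pos 0))

theorem CouplingBounds.nonneg_of_abs_le (hg : CouplingBounds L A χ g)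
    (hz : ∀ j, |z j| ≤ Z * (χ j * g j)) : 0 ≤ Z :=
  nonneg_of_mul_nonneg_left ((abs_nonneg _).trans (hz 0)) (mul_pos (hg.chi_pos 0) (hg.pos 0))

theorem CouplingBounds.abs_le_mul (hg : CouplingBounds L A χ g)
    (hz : ∀ j, |z j| ≤ Z * (χ j * g j)) (j : ℕ) : |z j| ≤ Z * g j :=
  (hz j).trans (mul_le_mul_of_nonneg_left
    (mul_le_of_le_one_left (hg.pos j).le (hg.chi_le_one j)) (hg.nonneg_of_abs_le hz))

theorem CouplingBounds.chi_mul_quasi_antitone (hg : CouplingBounds L A χ g) (j l : ℕ) :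
    χ (j + l) * g (j + l) ≤ 2 * (χ j * g j) := by
  have := mul_le_mul (hg.chi_antitone (Nat.le_add_right j l)) (hg.quasi_antitone j l)
    (hg.pos _).le (hg.chi_pos j).le
  linarith

theorem CouplingBounds.coeff_nonneg (hg : CouplingBounds L A χ g) (hP : CoeffBounds C lam₀ χ P) :
    0 ≤ C :=
  nonneg_of_mul_nonneg_left ((abs_nonneg _).trans (hP.theta_le 0)) (hg.chi_pos 0)

theorem summable_one_div_succ_sq : Summable fun l : ℕ => 1 / ((l : ℝ) + 1) ^ 2 := by
  simpa using (summable_nat_add_iff 1).2 (Real.summable_one_div_nat_pow.2 one_lt_two)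

theorem CouplingBounds.tendsto_chi_mul (hg : CouplingBounds L A χ g) :
    Tendsto (fun j => χ j * g j) atTop (𝓝 0) := by
  have hdecay : Tendsto (fun l : ℕ => A * (1 / ((l : ℝ) + 1) ^ 2)) atTop (𝓝 0) := by
    simpa using summable_one_div_succ_sq.tendsto_atTop_zero.const_mul A
  have hsqrt : Tendsto (fun l : ℕ => √(A * (1 / ((l : ℝ) + 1) ^ 2))) atTop (𝓝 0) := by
    simpa [Function.comp_def] using (Real.continuous_sqrt.tendsto 0).comp hdecay
  refine squeeze_zero (fun j => mul_nonneg (hg.chi_pos j).le (hg.pos j).le) (fun j => ?_) hsqrt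
  refine Real.le_sqrt_of_sq_le (le_trans ?_ (hg.decay j))
  rw [mul_pow]
  gcongr
  exact pow_le_of_le_one (hg.chi_pos j).le (hg.chi_le_one j) two_ne_zero

theorem CouplingBounds.tendsto_zero_of_abs_le (hg : CouplingBounds L A χ g)
    (hz : ∀ j, |z j| ≤ Z * (χ j * g j)) : Tendsto z atTop (𝓝 0) :=
  squeeze_zero_norm hz (by simpa using hg.tendsto_chi_mul.const_mul Z)

theorem CouplingBounds.sum_abs_backTerm_le (hg : CouplingBounds L A χ g) {a f : ℕ → ℝ} {Q : ℝ}
    (ha : HalfLeProd a) (hQ : 0 ≤ Q) (hf : ∀ j, |f j| ≤ Q * (χ j * g j ^ 2)) (j n : ℕ) :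
    ∑ l ∈ Finset.range n, |backTerm a f j l| ≤ 2 * Q * L * (χ j * g j) := by
  have hsource : ∀ n, ∑ l ∈ Finset.range n, |f (j + l)| ≤ Q * (L * (χ j * g j)) := fun n =>
    calc ∑ l ∈ Finset.range n, |f (j + l)|
        ≤ ∑ l ∈ Finset.range n, Q * (χ (j + l) * g (j + l) ^ 2) :=
          Finset.sum_le_sum fun l _ => hf (j + l)
      _ ≤ Q * (L * (χ j * g j)) := by
          rw [← Finset.mul_sum]
          exact mul_le_mul_of_nonneg_left (hg.sum_sq_le j n) hQ
  exact (ha.sum_abs_backTerm_le hsource n).trans_eq (by ring)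

theorem abs_zForcing_le (hP : CoeffBounds C lam₀ χ P) (j : ℕ) :
    |-(P.theta j * g j ^ 2)| ≤ C * (χ j * g j ^ 2) := by
  rw [abs_neg, abs_mul, abs_sq, ← mul_assoc]
  exact mul_le_mul_of_nonneg_right (hP.theta_le j) (sq_nonneg _)

theorem sum_abs_zTerm_le (hP : CoeffBounds C lam₀ χ P) (hg : CouplingBounds L A χ g)
    (hprod : HalfLeProd (zCoeff P g)) (j n : ℕ) :
    ∑ l ∈ Finset.range n, |backTerm (zCoeff P g) (fun j => -(P.theta j * g j ^ 2)) j l|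
      ≤ 2 * C * L * (χ j * g j) :=
  hg.sum_abs_backTerm_le hprod (hg.coeff_nonneg hP) (abs_zForcing_le hP) j n

theorem muForcing_sub_le (hP : CoeffBounds C lam₀ χ P) (j : ℕ) {V V' : Coupling} {G T : ℝ}
    (hV : ‖V‖ ≤ G) (hV' : ‖V'‖ ≤ G) (hT : ‖V - V'‖ ≤ T) :
    |muForcing P j V - muForcing P j V'|
      ≤ C * χ j * (|V.1 - V'.1| + |V.2.1 - V'.2.1|) + 10 * (C * χ j * (G * T)) := by
  have hK : 0 ≤ C * χ j := (abs_nonneg _).trans (hP.eta_le j)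
  have hprod : ∀ {u x y x' y' : ℝ}, |u| ≤ C * χ j → |x| ≤ ‖V‖ → |y'| ≤ ‖V'‖ →
      |x - x'| ≤ ‖V - V'‖ → |y - y'| ≤ ‖V - V'‖ →
      |u * (x * y - x' * y')| ≤ 2 * (C * χ j * (G * T)) := by
    intro u x y x' y' hu hx hy' hxx' hyy'
    rw [abs_mul]
    have h := abs_mul_sub_mul_le (hx.trans hV) (hy'.trans hV') (hxx'.trans hT) (hyy'.trans hT)
    exact (mul_le_mul hu h (abs_nonneg _) hK).trans_eq (by ring)
  have hadd : ∀ {x y r s : ℝ}, |x| ≤ r → |y| ≤ s → |x + y| ≤ r + s := fun hx hy =>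
    (abs_add_le _ _).trans (add_le_add hx hy)
  have hlin : ∀ {u x : ℝ}, |u| ≤ C * χ j → |u * x| ≤ C * χ j * |x| := fun {u x} hu => by
    rw [abs_mul]
    exact mul_le_mul_of_nonneg_right hu (abs_nonneg x)
  have hg := abs_fst_le_norm V
  have hz := abs_snd_fst_le_norm V
  have hg' := abs_fst_le_norm V'
  have hz' := abs_snd_fst_le_norm V'
  have hm' := abs_snd_snd_le_norm V'
  have hdg := abs_fst_le_norm (V - V')
  have hdz := abs_snd_fst_le_norm (V - V')
  have hdm := abs_snd_snd_le_norm (V - V')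
  calc |muForcing P j V - muForcing P j V'|
      = |P.eta j * (V.1 - V'.1) + P.gamma j * (V.2.1 - V'.2.1)
          - (P.ups_gg j * (V.1 * V.1 - V'.1 * V'.1) + P.ups_gz j * (V.1 * V.2.1 - V'.1 * V'.2.1)
            + P.ups_gmu j * (V.1 * V.2.2 - V'.1 * V'.2.2)
            + P.ups_zz j * (V.2.1 * V.2.1 - V'.2.1 * V'.2.1)
            + P.ups_zmu j * (V.2.1 * V.2.2 - V'.2.1 * V'.2.2))| := by
        simp only [muForcing]
        ring_nf
    _ ≤ C * χ j * |V.1 - V'.1| + C * χ j * |V.2.1 - V'.2.1|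
          + (2 * (C * χ j * (G * T)) + 2 * (C * χ j * (G * T)) + 2 * (C * χ j * (G * T))
            + 2 * (C * χ j * (G * T)) + 2 * (C * χ j * (G * T))) := by
        refine (abs_sub _ _).trans (add_le_add (hadd ?_ ?_) (hadd
          (hadd (hadd (hadd ?_ ?_) ?_) ?_) ?_))
        · exact hlin (hP.eta_le j)
        · exact hlin (hP.gamma_le j)
        · exact hprod (hP.ups_gg_le j) hg hg' hdg hdg
        · exact hprod (hP.ups_gz_le j) hg hz' hdg hdz
        · exact hprod (hP.ups_gmu_le j) hg hm' hdg hdm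
        · exact hprod (hP.ups_zz_le j) hz hz' hdz hdz
        · exact hprod (hP.ups_zmu_le j) hz hm' hdz hdm
    _ = _ := by ring

theorem abs_muSource_le (hP : CoeffBounds C lam₀ χ P) (hg : CouplingBounds L A χ g)
    (hz : ∀ j, |z j| ≤ Z * (χ j * g j)) (j : ℕ) :
    |muSource P g z j| ≤ 11 * C * (1 + Z) ^ 2 * (χ j * g j) := by
  have hC := hg.coeff_nonneg hP
  have hZ := hg.nonneg_of_abs_le hz
  have hgj := hg.pos j
  have hχj := hg.chi_pos j
  have hzj := hg.abs_le_mul hz j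
  have hgsq : g j ^ 2 ≤ g j := pow_le_of_le_one hgj.le (hg.le_one j) two_ne_zero
  have hnorm : ‖((g j, z j, 0) : Coupling)‖ ≤ (1 + Z) * g j := by
    have hZg : 0 ≤ Z * g j := by positivity
    simp only [Prod.norm_def, Real.norm_eq_abs, abs_of_pos hgj, abs_zero]
    exact max_le (by linarith) (max_le (by linarith) (by positivity))
  have h := muForcing_sub_le hP j (V' := 0) (T := (1 + Z) * g j) hnorm
    (by rw [norm_zero]; positivity) (by rwa [sub_zero])
  simp only [muForcing, Prod.fst_zero, Prod.snd_zero, mul_zero, sub_zero, add_zero, ne_eq,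
    OfNat.ofNat_ne_zero, not_false_eq_true, zero_pow, abs_of_pos hgj] at h
  rw [muSource, muForcing]
  simp only [mul_zero, add_zero]
  calc _ ≤ C * χ j * (g j + |z j|) + 10 * (C * χ j * ((1 + Z) * g j * ((1 + Z) * g j))) := h
    _ = C * χ j * (g j + |z j|) + 10 * (C * χ j * ((1 + Z) ^ 2 * g j ^ 2)) := by ring
    _ ≤ C * χ j * (g j + Z * g j) + 10 * (C * χ j * ((1 + Z) ^ 2 * g j)) := by gcongr
    _ ≤ 11 * C * (1 + Z) ^ 2 * (χ j * g j) := by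
        have : 0 ≤ C * χ j * (g j * (Z + Z ^ 2)) := by positivity
        linarith

theorem le_muCoeff (hP : CoeffBounds C lam₀ χ P) (hg : CouplingBounds L A χ g)
    (hz : ∀ j, |z j| ≤ Z * (χ j * g j)) (hsmall : ∀ j, 2 * C * (1 + Z) * g j ≤ lam₀ - 1)
    (j : ℕ) : (1 + lam₀) / 2 ≤ muCoeff P g z j := by
  have hC := hg.coeff_nonneg hP
  have hle : ∀ {u x t : ℝ}, |u| ≤ C * χ j → |x| ≤ t → u * x ≤ C * t := fun {u x t} hu hx => by
    have hu' : |u| ≤ C := hu.trans (mul_le_of_le_one_right hC (hg.chi_le_one j))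
    have := mul_le_mul hu' hx (abs_nonneg _) hC
    exact (le_abs_self _).trans ((abs_mul u x).trans_le this)
  have hgmu := hle (hP.ups_gmu_le j) (abs_of_pos (hg.pos j)).le
  have hzmu := hle (hP.ups_zmu_le j) (hg.abs_le_mul hz j)
  rw [muCoeff]
  linarith [hP.le_lam j, hsmall j]

theorem sum_abs_muTerm_le (hP : CoeffBounds C lam₀ χ P) (hg : CouplingBounds L A χ g)
    (hlam : 1 < lam₀) (hz : ∀ j, |z j| ≤ Z * (χ j * g j))
    (hsmall : ∀ j, 2 * C * (1 + Z) * g j ≤ lam₀ - 1) (j n : ℕ) :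
    ∑ l ∈ Finset.range n, |backTerm (muCoeff P g z) (muSource P g z) j l|
      ≤ 44 * C * (1 + Z) ^ 2 / (lam₀ - 1) * (χ j * g j) := by
  have hsource : ∀ l, |muSource P g z (j + l)| ≤ 22 * C * (1 + Z) ^ 2 * (χ j * g j) := fun l => by
    have hK : 0 ≤ 11 * C * (1 + Z) ^ 2 := by
      have := hg.coeff_nonneg hP
      positivity
    have := mul_le_mul_of_nonneg_left (hg.chi_mul_quasi_antitone j l) hK
    linarith [abs_muSource_le hP hg hz (j + l)]
  have hcoeff : ∀ j, (1 + lam₀) / 2 ≤ |muCoeff P g z j| := fun j =>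
    (le_muCoeff hP hg hz hsmall j).trans (le_abs_self _)
  refine (sum_abs_backTerm_le_of_pow (by linarith) hcoeff hsource n).trans_eq ?_
  have h1 : lam₀ - 1 ≠ 0 := by linarith
  rw [show (1 + lam₀) / 2 - 1 = (lam₀ - 1) / 2 by ring]
  field_simp
  ring

theorem IsQuadFlow.fst_eq {g₀ : ℝ} {V : ℕ → Coupling} (hV : IsQuadFlow P g₀ V) (j : ℕ) :
    (V j).1 = gSeq P.beta g₀ j := by
  induction j with
  | zero => exact hV.init
  | succ j ih => rw [hV.step j, quadMap, gSeq, ih]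

theorem IsQuadFlow.eq {g₀ : ℝ} {V V' : ℕ → Coupling} (hV : IsQuadFlow P g₀ V)
    (hV' : IsQuadFlow P g₀ V') (hprod : HalfLeProd (zCoeff P (gSeq P.beta g₀)))
    (hcoeff : ∀ j, 1 ≤ |muCoeff P (gSeq P.beta g₀) (fun i => (V i).2.1) j|) : V' = V := by
  have hz : ∀ j, (V' j).2.1 = (V j).2.1 := fun j => sub_eq_zero.1 <| by
    refine eq_zero_of_recursion (a := zCoeff P (gSeq P.beta g₀))
      (d := fun j => (V' j).2.1 - (V j).2.1) one_half_pos
      (fun j l => (hprod j l).trans (le_abs_self _)) (fun j => ?_)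
      (by simpa using hV'.z_lim.sub hV.z_lim) j
    simp only [hV.step j, hV'.step j, quadMap, hV.fst_eq, hV'.fst_eq, zCoeff]
    ring
  have hmu : ∀ j, (V' j).2.2 = (V j).2.2 := fun j => sub_eq_zero.1 <| by
    refine eq_zero_of_recursion (a := muCoeff P (gSeq P.beta g₀) fun i => (V i).2.1)
      (d := fun j => (V' j).2.2 - (V j).2.2) one_pos (fun j l => ?_) (fun j => ?_)
      (by simpa using hV'.mu_lim.sub hV.mu_lim) j
    · rw [Finset.abs_prod]
      exact Finset.one_le_prod fun k _ => hcoeff (j + k)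
    · simp only [hV.step j, hV'.step j, quadMap_mu_eq_muCoeff_mul, hV.fst_eq, hV'.fst_eq, hz]
      ring
  exact funext fun j =>
    Prod.ext ((hV'.fst_eq j).trans (hV.fst_eq j).symm) (Prod.ext (hz j) (hmu j))

theorem zBar_succ (hP : CoeffBounds C lam₀ χ P) (hg : CouplingBounds L A χ g)
    (hprod : HalfLeProd (zCoeff P g)) (j : ℕ) :
    zBar P g (j + 1) = zCoeff P g j * zBar P g j + -(P.theta j * g j ^ 2) :=
  backSum_succ (hprod.ne_zero j) (summable_backTerm (sum_abs_zTerm_le hP hg hprod j))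

theorem muBar_succ (hP : CoeffBounds C lam₀ χ P) (hg : CouplingBounds L A χ g)
    (hlam : 1 < lam₀) (hz : ∀ j, |z j| ≤ Z * (χ j * g j))
    (hsmall : ∀ j, 2 * C * (1 + Z) * g j ≤ lam₀ - 1) (j : ℕ) :
    muBar P g z (j + 1) = muCoeff P g z j * muBar P g z j + muSource P g z j :=
  backSum_succ (by linarith [le_muCoeff hP hg hz hsmall j])
    (summable_backTerm (sum_abs_muTerm_le hP hg hlam hz hsmall j))

theorem abs_zBar_le (hP : CoeffBounds C lam₀ χ P) (hg : CouplingBounds L A χ g)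
    (hprod : HalfLeProd (zCoeff P g)) (j : ℕ) : |zBar P g j| ≤ 2 * C * L * (χ j * g j) :=
  abs_backSum_le (sum_abs_zTerm_le hP hg hprod j)

theorem abs_muBar_le (hP : CoeffBounds C lam₀ χ P) (hg : CouplingBounds L A χ g)
    (hlam : 1 < lam₀) (hz : ∀ j, |z j| ≤ Z * (χ j * g j))
    (hsmall : ∀ j, 2 * C * (1 + Z) * g j ≤ lam₀ - 1) (j : ℕ) :
    |muBar P g z j| ≤ 44 * C * (1 + Z) ^ 2 / (lam₀ - 1) * (χ j * g j) :=
  abs_backSum_le (sum_abs_muTerm_le hP hg hlam hz hsmall j)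

theorem isQuadFlow_barFlow {g₀ : ℝ} (hP : CoeffBounds C lam₀ χ P)
    (hg : CouplingBounds L A χ (gSeq P.beta g₀)) (hlam : 1 < lam₀)
    (hprod : HalfLeProd (zCoeff P (gSeq P.beta g₀)))
    (hsmall : ∀ j, 2 * C * (1 + 2 * C * L) * gSeq P.beta g₀ j ≤ lam₀ - 1) :
    IsQuadFlow P g₀ (barFlow P (gSeq P.beta g₀)) := by
  have hz := abs_zBar_le hP hg hprod
  refine ⟨rfl, fun j => Prod.ext rfl (Prod.ext ?_ ?_), hg.tendsto_zero_of_abs_le hz,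
    hg.tendsto_zero_of_abs_le (abs_muBar_le hP hg hlam hz hsmall)⟩
  · simp only [barFlow, zBar_succ hP hg hprod, quadMap, zCoeff]
    ring
  · rw [quadMap_mu_eq_muCoeff_mul]
    exact muBar_succ hP hg hlam hz hsmall j

end Flow

/-! ### The Picard map for the couplings -/

/-- The weight `t² |log t|` of the deviations of the couplings. -/
def logWeight (t : ℝ) : ℝ := t ^ 2 * |Real.log t|

/-- The deviations `(g, z, μ)` at scale `j` of relative size at most `r`. -/
def couplingBox (χ g : ℕ → ℝ) (r : ℝ) (j : ℕ) : Set Coupling :=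
  {v | |v.1| ≤ r * logWeight (g j) ∧ |v.2.1| ≤ r * (χ j * logWeight (g j)) ∧
    |v.2.2| ≤ r * (χ j * logWeight (g j))}

/-- The properties of the quadratic flow `barFlow P g` used in the construction of a flow near it;
`δ` measures the smallness of `g`. -/
structure ReferenceFlow (Ω B C lam₀ L D Z δ : ℝ) (P : Coeffs) (χ g : ℕ → ℝ) : Prop where
  weight : CutoffWeight Ω χ
  beta_le : ∀ j, |P.beta j| ≤ B * χ j
  coeff : CoeffBounds C lam₀ χ P
  one_lt_lam : 1 < lam₀
  coupling : CouplingBounds L D χ g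
  step : ∀ j, barFlow P g (j + 1) = quadMap P j (barFlow P g j)
  z_le : ∀ j, |zBar P g j| ≤ Z * (χ j * g j)
  mu_le : ∀ j, |muBar P g (zBar P g) j| ≤ Z * (χ j * g j)
  half_le_prod : HalfLeProd (zCoeff P g)
  sum_le_log : ∀ j, ∑ k ∈ Finset.range j, χ k * g k ≤ L * |Real.log (g j)|
  one_le_log : ∀ j, 1 ≤ |Real.log (g j)|
  log_sq_le : ∀ j, g j * |Real.log (g j)| ^ 2 ≤ δ
  delta_le_one : δ ≤ 1
  succ_le : ∀ j, g (j + 1) ≤ (1 + δ) * g j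
  le_succ : ∀ j, g j ≤ (1 + δ) * g (j + 1)
  log_succ_le : ∀ j, |Real.log (g (j + 1))| ≤ (1 + δ) * |Real.log (g j)|

theorem mul_abs_log_le {s t : ℝ} (hs : 0 < s) (ht : 0 < t) (hts : t ≤ 2 * s) (ht1 : t ≤ 1)
    (hs1 : s ≤ 1) (hlog : 1 ≤ |Real.log s|) : t * |Real.log t| ≤ 2 * (s * |Real.log s|) := by
  rw [abs_of_nonpos (Real.log_nonpos hs.le hs1)] at hlog ⊢
  rw [abs_of_nonpos (Real.log_nonpos ht.le ht1)]
  have hlog_sub : Real.log s - Real.log t ≤ s / t - 1 := by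
    rw [← Real.log_div hs.ne' ht.ne']
    exact Real.log_le_sub_one_of_pos (by positivity)
  have hmul : t * (Real.log s - Real.log t) ≤ s - t := by
    have := mul_le_mul_of_nonneg_left hlog_sub ht.le
    rwa [mul_sub t (s / t), mul_div_cancel₀ _ ht.ne', mul_one] at this
  nlinarith

namespace ReferenceFlow

variable {Ω B C lam₀ L D Z δ : ℝ} {P : Coeffs} {χ g : ℕ → ℝ}

section Sizes

variable (hE : ReferenceFlow Ω B C lam₀ L D Z δ P χ g)
include hE

theorem coeff_nonneg : 0 ≤ C := hE.coupling.coeff_nonneg hE.coeff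

theorem size_nonneg : 0 ≤ Z := hE.coupling.nonneg_of_abs_le hE.z_le

theorem beta_bound_nonneg : 0 ≤ B :=
  nonneg_of_mul_nonneg_left ((abs_nonneg _).trans (hE.beta_le 0)) (hE.weight.pos 0)

theorem g_succ (j : ℕ) : g (j + 1) = g j - P.beta j * g j ^ 2 := congrArg Prod.fst (hE.step j)

theorem mul_log_le (j : ℕ) : g j * |Real.log (g j)| ≤ δ := by
  refine le_trans ?_ (hE.log_sq_le j)
  have hlog := hE.one_le_log j
  have hg := (hE.coupling.pos j).le
  gcongr
  exact le_self_pow₀ hlog two_ne_zero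

theorem g_le (j : ℕ) : g j ≤ δ :=
  (le_mul_of_one_le_right (hE.coupling.pos j).le (hE.one_le_log j)).trans (hE.mul_log_le j)

theorem delta_pos : 0 < δ := (hE.coupling.pos 0).trans_le (hE.g_le 0)

theorem one_add_delta_pow_three_le : (1 + δ) ^ 3 ≤ 1 + 7 * δ := by
  have hδ := hE.delta_pos
  have hδ1 := hE.delta_le_one
  nlinarith [mul_pos hδ hδ]

theorem logWeight_pos (j : ℕ) : 0 < logWeight (g j) :=
  mul_pos (pow_pos (hE.coupling.pos j) 2) (one_pos.trans_le (hE.one_le_log j))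

theorem logWeight_le (j : ℕ) : logWeight (g j) ≤ δ * g j := by
  have := mul_le_mul_of_nonneg_right (hE.mul_log_le j) (hE.coupling.pos j).le
  rwa [mul_right_comm, ← sq] at this

theorem sq_le_logWeight (j : ℕ) : g j ^ 2 ≤ logWeight (g j) :=
  le_mul_of_one_le_right (sq_nonneg _) (hE.one_le_log j)

theorem mul_logWeight_le {h : ℝ} (hh : 0 ≤ h) (hhδ : h * δ ≤ 1) (j : ℕ) :
    h * logWeight (g j) ≤ g j :=
  calc h * logWeight (g j) ≤ h * (δ * g j) := mul_le_mul_of_nonneg_left (hE.logWeight_le j) hh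
    _ = h * δ * g j := by ring
    _ ≤ g j := mul_le_of_le_one_left (hE.coupling.pos j).le hhδ

theorem le_two_mul_succ (j : ℕ) : g j ≤ 2 * g (j + 1) :=
  (hE.le_succ j).trans
    (mul_le_mul_of_nonneg_right (by linarith [hE.delta_le_one]) (hE.coupling.pos _).le)

theorem chi_mul_logWeight_succ_le (j : ℕ) :
    χ (j + 1) * logWeight (g (j + 1)) ≤ (1 + 7 * δ) * (χ j * logWeight (g j)) := by
  have hg := hE.coupling.pos j
  have hg' := hE.coupling.pos (j + 1)
  have hδ := hE.delta_pos
  have hω := hE.logWeight_pos j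
  have hχ := (hE.weight.pos j).le
  have hstep : logWeight (g (j + 1)) ≤ (1 + δ) ^ 3 * logWeight (g j) :=
    calc g (j + 1) ^ 2 * |Real.log (g (j + 1))|
        ≤ ((1 + δ) * g j) ^ 2 * ((1 + δ) * |Real.log (g j)|) := by
          gcongr
          · exact hE.succ_le j
          · exact hE.log_succ_le j
      _ = _ := by rw [logWeight]; ring
  calc χ (j + 1) * logWeight (g (j + 1)) ≤ χ j * ((1 + δ) ^ 3 * logWeight (g j)) :=
        mul_le_mul (hE.weight.antitone (Nat.le_succ j)) hstep (hE.logWeight_pos _).le hχ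
    _ ≤ χ j * ((1 + 7 * δ) * logWeight (g j)) := by
        gcongr
        exact hE.one_add_delta_pow_three_le
    _ = _ := by ring

theorem sum_chi_mul_logWeight_le (j n : ℕ) :
    ∑ k ∈ Finset.range n, χ (j + k) * (g (j + k) * logWeight (g (j + k)))
      ≤ 2 * L * (χ j * logWeight (g j)) := by
  have hg := hE.coupling
  have hterm : ∀ k, χ (j + k) * (g (j + k) * logWeight (g (j + k)))
      ≤ χ (j + k) * g (j + k) ^ 2 * (2 * (g j * |Real.log (g j)|)) := fun k =>
    calc χ (j + k) * (g (j + k) * logWeight (g (j + k)))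
        = χ (j + k) * g (j + k) ^ 2 * (g (j + k) * |Real.log (g (j + k))|) := by
          rw [logWeight]; ring
      _ ≤ _ := mul_le_mul_of_nonneg_left
          (mul_abs_log_le (hg.pos j) (hg.pos _) (hg.quasi_antitone j k) (hg.le_one _)
            (hg.le_one _) (hE.one_le_log j))
          (mul_nonneg (hg.chi_pos _).le (sq_nonneg _))
  calc ∑ k ∈ Finset.range n, χ (j + k) * (g (j + k) * logWeight (g (j + k)))
      ≤ ∑ k ∈ Finset.range n, χ (j + k) * g (j + k) ^ 2 * (2 * (g j * |Real.log (g j)|)) :=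
        Finset.sum_le_sum fun k _ => hterm k
    _ ≤ (L * (χ j * g j)) * (2 * (g j * |Real.log (g j)|)) := by
        rw [← Finset.sum_mul]
        have := hg.pos j
        gcongr
        exact hg.sum_sq_le j n
    _ = _ := by rw [logWeight]; ring

theorem sum_abs_backTerm_le {f : ℕ → ℝ} {Q : ℝ} (hQ : 0 ≤ Q)
    (hf : ∀ j, |f j| ≤ Q * (χ j * (g j * logWeight (g j)))) (j n : ℕ) :
    ∑ l ∈ Finset.range n, |backTerm (zCoeff P g) f j l|
      ≤ 4 * L * Q * (χ j * logWeight (g j)) := by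
  have hsource : ∀ n, ∑ l ∈ Finset.range n, |f (j + l)|
      ≤ Q * (2 * L * (χ j * logWeight (g j))) := fun n =>
    calc ∑ l ∈ Finset.range n, |f (j + l)|
        ≤ ∑ l ∈ Finset.range n, Q * (χ (j + l) * (g (j + l) * logWeight (g (j + l)))) :=
          Finset.sum_le_sum fun l _ => hf (j + l)
      _ ≤ Q * (2 * L * (χ j * logWeight (g j))) := by
          rw [← Finset.mul_sum]
          exact mul_le_mul_of_nonneg_left (hE.sum_chi_mul_logWeight_le j n) hQ
  exact (hE.half_le_prod.sum_abs_backTerm_le hsource n).trans_eq (by ring)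

theorem couplingBox_mono {r r' : ℝ} (hr : r ≤ r') (j : ℕ) :
    couplingBox χ g r j ⊆ couplingBox χ g r' j := by
  have hω := (hE.logWeight_pos j).le
  have hχω := mul_nonneg (hE.weight.pos j).le hω
  rintro v ⟨h1, h2, h3⟩
  exact ⟨h1.trans (by gcongr), h2.trans (by gcongr), h3.trans (by gcongr)⟩

theorem zero_mem_couplingBox {r : ℝ} (hr : 0 ≤ r) (j : ℕ) : 0 ∈ couplingBox χ g r j := by
  have hω := (hE.logWeight_pos j).le
  have hχ := (hE.weight.pos j).le
  simp only [couplingBox, Set.mem_ofPred_eq, Prod.fst_zero, Prod.snd_zero, abs_zero]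
  exact ⟨by positivity, by positivity, by positivity⟩

theorem radius_nonneg {r : ℝ} {j : ℕ} {v : Coupling} (hv : v ∈ couplingBox χ g r j) : 0 ≤ r :=
  nonneg_of_mul_nonneg_left ((abs_nonneg _).trans hv.1) (hE.logWeight_pos j)

theorem norm_le_of_mem_couplingBox {r : ℝ} {j : ℕ} {v : Coupling}
    (hv : v ∈ couplingBox χ g r j) : ‖v‖ ≤ r * logWeight (g j) := by
  have hle : r * (χ j * logWeight (g j)) ≤ r * logWeight (g j) :=
    mul_le_mul_of_nonneg_left
      (mul_le_of_le_one_left (hE.logWeight_pos j).le (hE.weight.le_one j)) (hE.radius_nonneg hv)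
  exact max_le hv.1 (max_le (hv.2.1.trans hle) (hv.2.2.trans hle))

theorem norm_barFlow_le (j : ℕ) : ‖barFlow P g j‖ ≤ (Z + 1) * g j := by
  have hZ := hE.size_nonneg
  have hg := hE.coupling.pos j
  have hle : Z * g j ≤ (Z + 1) * g j := by linarith
  refine max_le ?_ (max_le ((hE.coupling.abs_le_mul hE.z_le j).trans hle)
    ((hE.coupling.abs_le_mul hE.mu_le j).trans hle))
  rw [barFlow, Real.norm_eq_abs, abs_of_pos hg]
  linarith [mul_nonneg hZ hg.le]

theorem norm_le_of_sub_mem_couplingBox {h : ℝ} (hhδ : h * δ ≤ 1) {j : ℕ} {V : Coupling}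
    (hV : V - barFlow P g j ∈ couplingBox χ g h j) : ‖V‖ ≤ (Z + 2) * g j := by
  have hdev := (hE.norm_le_of_mem_couplingBox hV).trans
    (hE.mul_logWeight_le (hE.radius_nonneg hV) hhδ j)
  have htri := norm_add_le (V - barFlow P g j) (barFlow P g j)
  rw [sub_add_cancel] at htri
  linarith [hE.norm_barFlow_le j]

end Sizes

end ReferenceFlow

/-- The data of the Picard map for the couplings: the initial value of `g`, the perturbation of the
quadratic map along the sequence, and the sequence of couplings itself. -/
structure PicardInput where
  init : ℝ
  source : ℕ → Coupling
  arg : ℕ → Coupling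

/-- The input that the Picard map sends to the quadratic flow. -/
def centerInput (P : Coeffs) (g : ℕ → ℝ) : PicardInput := ⟨g 0, 0, barFlow P g⟩

/-- What remains of the `g`-equation after linearisation at the quadratic flow. -/
def gRemainder (P : Coeffs) (g : ℕ → ℝ) (I : PicardInput) (j : ℕ) : ℝ :=
  (I.source j).1 - (P.beta j * g j) ^ 2 * ((I.arg j).1 - g j) - P.beta j * ((I.arg j).1 - g j) ^ 2

/-- The `g`-component of the Picard map. The multiplier `(1 - β g)²` differs from the derivative
`1 - 2 β g` of the flow by a term in `gRemainder`; it is chosen because the products of consecutive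
multipliers are exactly the quotients of the `g²`. -/
def picardG (P : Coeffs) (g : ℕ → ℝ) (I : PicardInput) : ℕ → ℝ
  | 0 => I.init
  | j + 1 => g (j + 1) + (1 - P.beta j * g j) ^ 2 * (picardG P g I j - g j) + gRemainder P g I j

/-- The inhomogeneity of the equation for the `z`-component of the Picard map. -/
def zSource (P : Coeffs) (g : ℕ → ℝ) (I : PicardInput) (j : ℕ) : ℝ :=
  -(P.theta j * picardG P g I j ^ 2) - P.zeta j * ((picardG P g I j - g j) * (I.arg j).2.1)
    + (I.source j).2.1

/-- The `z`-component of the Picard map. -/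
def picardZ (P : Coeffs) (g : ℕ → ℝ) (I : PicardInput) : ℕ → ℝ :=
  backSum (zCoeff P g) (zSource P g I)

/-- The `μ`-component of the Picard map: the equation for `μ` expands, and is solved backwards. -/
def picardMu (P : Coeffs) (g : ℕ → ℝ) (I : PicardInput) (j : ℕ) : ℝ :=
  (P.lam j)⁻¹ * ((I.arg (j + 1)).2.2
    - muForcing P j (picardG P g I j, picardZ P g I j, (I.arg j).2.2) - (I.source j).2.2)

/-- The Picard map for the couplings. -/
def couplingPicard (P : Coeffs) (g : ℕ → ℝ) (I : PicardInput) (j : ℕ) : Coupling :=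
  (picardG P g I j, picardZ P g I j, picardMu P g I j)

/-- Two inputs of the Picard map have relative distance at most `d`. -/
structure InputDist (h A : ℝ) (χ g : ℕ → ℝ) (d : ℝ) (I I' : PicardInput) : Prop where
  init : |I.init - I'.init| ≤ d * (A * g 0 ^ 2)
  source : ∀ j, ‖I.source j - I'.source j‖ ≤ d * (A * (χ j * g j ^ 3))
  arg : ∀ j, I.arg j - I'.arg j ∈ couplingBox χ g (d * h) j

/-- The relative size of the change of the `g`-component of the Picard map. -/
def gConst (L A : ℝ) : ℝ := A * (1 + 8 * L)

/-- The relative size of the change of the `z`-component of the Picard map. -/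
def zConst (C L Z A : ℝ) : ℝ := 4 * L * (C * gConst L A * (3 * Z + 7) + A)

/-- The numerical conditions under which the Picard map for the couplings contracts by the factor
`q`. -/
structure CouplingConst (B C lam₀ L Z δ h A q : ℝ) : Prop where
  h_pos : 0 < h
  A_nonneg : 0 ≤ A
  q_le_one : q ≤ 1
  h_mul_le : h * δ ≤ 1
  g_cond : (B ^ 2 * h + 2 * B * h ^ 2) * δ ≤ A
  gConst_le : gConst L A ≤ q * h
  zConst_le : zConst C L Z A ≤ q * h
  mu_cond : h * (1 + 7 * δ) + C * (gConst L A + zConst C L Z A) + A + 10 * C * (Z + 2) * δ * h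
    ≤ lam₀ * (q * h)

namespace ReferenceFlow

variable {Ω B C lam₀ L D Z δ h A q d : ℝ} {P : Coeffs} {χ g : ℕ → ℝ} {I I' : PicardInput}

theorem inputDist_center (hE : ReferenceFlow Ω B C lam₀ L D Z δ P χ g)
    (hc : CouplingConst B C lam₀ L Z δ h A q) :
    InputDist h A χ g 1 (centerInput P g) (centerInput P g) := by
  have hA := hc.A_nonneg
  refine ⟨?_, fun j => ?_, fun j => ?_⟩
  · rw [sub_self, abs_zero]; positivity
  · rw [sub_self, norm_zero]
    have := hE.coupling.pos j
    have := hE.weight.pos j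
    positivity
  · rw [sub_self]
    exact hE.zero_mem_couplingBox (by simpa using hc.h_pos.le) j

theorem inputDist_nonneg (hE : ReferenceFlow Ω B C lam₀ L D Z δ P χ g)
    (hc : CouplingConst B C lam₀ L Z δ h A q) (hd : InputDist h A χ g d I I') : 0 ≤ d :=
  nonneg_of_mul_nonneg_left (hE.radius_nonneg (hd.arg 0)) hc.h_pos

theorem gConst_nonneg (hE : ReferenceFlow Ω B C lam₀ L D Z δ P χ g)
    (hc : CouplingConst B C lam₀ L Z δ h A q) : 0 ≤ gConst L A := by
  have hL := hE.coupling.mass_nonneg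
  have hA := hc.A_nonneg
  unfold gConst; positivity

theorem abs_sq_mul_le (hE : ReferenceFlow Ω B C lam₀ L D Z δ P χ g) (hh : 0 ≤ h) (hd : 0 ≤ d)
    {j : ℕ} {v : ℝ} (hv : |v| ≤ d * h * logWeight (g j)) :
    |(P.beta j * g j) ^ 2 * v| ≤ d * (B ^ 2 * h * δ * (χ j * g j ^ 3)) := by
  have hg := hE.coupling.pos j
  have hχ := hE.weight.pos j
  have hδ := hE.delta_pos
  have := hE.beta_bound_nonneg
  have hβg : |P.beta j * g j| ≤ B * χ j * g j := by
    rw [abs_mul, abs_of_pos hg]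
    exact mul_le_mul_of_nonneg_right (hE.beta_le j) hg.le
  rw [abs_mul, abs_pow]
  calc |P.beta j * g j| ^ 2 * |v|
      ≤ (B * χ j * g j) ^ 2 * (d * h * logWeight (g j)) := by gcongr
    _ = d * (B ^ 2 * h * (g j * |Real.log (g j)|) * (χ j * χ j * g j ^ 3)) := by
        rw [logWeight]; ring
    _ ≤ d * (B ^ 2 * h * δ * (χ j * 1 * g j ^ 3)) := by
        gcongr
        · exact hE.mul_log_le j
        · exact hE.weight.le_one j
    _ = _ := by ring

theorem abs_beta_mul_le (hE : ReferenceFlow Ω B C lam₀ L D Z δ P χ g) (hh : 0 ≤ h) (hd : 0 ≤ d)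
    {j : ℕ} {v w : ℝ} (hv : |v| ≤ d * h * logWeight (g j))
    (hw : |w| ≤ 2 * (h * logWeight (g j))) :
    |P.beta j * (v * w)| ≤ d * (2 * B * h ^ 2 * δ * (χ j * g j ^ 3)) := by
  have hg := hE.coupling.pos j
  have hχ := hE.weight.pos j
  have hω := hE.logWeight_pos j
  have hB := hE.beta_bound_nonneg
  have hb := hE.beta_le j
  rw [abs_mul, abs_mul]
  calc |P.beta j| * (|v| * |w|)
      ≤ (B * χ j) * ((d * h * logWeight (g j)) * (2 * (h * logWeight (g j)))) := by gcongr
    _ = d * (2 * B * h ^ 2 * (g j * |Real.log (g j)| ^ 2) * (χ j * g j ^ 3)) := by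
        rw [logWeight]; ring
    _ ≤ _ := by
        gcongr
        exact hE.log_sq_le j

theorem gRemainder_sub_le (hE : ReferenceFlow Ω B C lam₀ L D Z δ P χ g)
    (hc : CouplingConst B C lam₀ L Z δ h A q)
    (hI : InputDist h A χ g 1 I (centerInput P g))
    (hI' : InputDist h A χ g 1 I' (centerInput P g)) (hd : InputDist h A χ g d I I') (j : ℕ) :
    |gRemainder P g I j - gRemainder P g I' j| ≤ 2 * (d * (A * (χ j * g j ^ 3))) := by
  have hd0 := hE.inputDist_nonneg hc hd
  have hh := hc.h_pos.le
  have hg := hE.coupling.pos j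
  have hχ := hE.weight.pos j
  set y : ℝ := (I.arg j).1 - g j
  set y' : ℝ := (I'.arg j).1 - g j
  have hy : |y| ≤ 1 * h * logWeight (g j) := (hI.arg j).1
  have hy' : |y'| ≤ 1 * h * logWeight (g j) := (hI'.arg j).1
  have hadd : |y + y'| ≤ 2 * (h * logWeight (g j)) := by linarith [abs_add_le y y']
  have hsub : |y - y'| ≤ d * h * logWeight (g j) := by
    rw [show y - y' = (I.arg j - I'.arg j).1 from sub_sub_sub_cancel_right _ _ _]
    exact (hd.arg j).1
  have hsource : |(I.source j).1 - (I'.source j).1| ≤ d * (A * (χ j * g j ^ 3)) :=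
    (abs_fst_le_norm (I.source j - I'.source j)).trans (hd.source j)
  have hcond : d * ((B ^ 2 * h + 2 * B * h ^ 2) * δ * (χ j * g j ^ 3))
      ≤ d * (A * (χ j * g j ^ 3)) := by
    gcongr
    exact hc.g_cond
  calc |gRemainder P g I j - gRemainder P g I' j|
      = |((I.source j).1 - (I'.source j).1) - (P.beta j * g j) ^ 2 * (y - y')
          - P.beta j * ((y - y') * (y + y'))| := by
        simp only [gRemainder, y, y']; ring_nf
    _ ≤ |(I.source j).1 - (I'.source j).1| + |(P.beta j * g j) ^ 2 * (y - y')|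
          + |P.beta j * ((y - y') * (y + y'))| :=
        (abs_sub _ _).trans (add_le_add_left (abs_sub _ _) _)
    _ ≤ _ := by linarith [hE.abs_sq_mul_le hh hd0 hsub, hE.abs_beta_mul_le hh hd0 hsub hadd]

theorem picardG_sub_le_sq (hE : ReferenceFlow Ω B C lam₀ L D Z δ P χ g)
    (hc : CouplingConst B C lam₀ L Z δ h A q)
    (hI : InputDist h A χ g 1 I (centerInput P g))
    (hI' : InputDist h A χ g 1 I' (centerInput P g)) (hd : InputDist h A χ g d I I') (j : ℕ) :
    |picardG P g I j - picardG P g I' j|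
      ≤ d * A * (1 + 8 * ∑ k ∈ Finset.range j, χ k * g k) * g j ^ 2 := by
  have hd0 := hE.inputDist_nonneg hc hd
  have hA := hc.A_nonneg
  induction j with
  | zero => simpa [picardG, mul_assoc] using hd.init
  | succ j ih =>
    have hg := hE.coupling.pos j
    have hχ := hE.weight.pos j
    have hmult : (1 - P.beta j * g j) ^ 2 * g j ^ 2 = g (j + 1) ^ 2 := by
      rw [hE.g_succ j]; ring
    have hrem : |gRemainder P g I j - gRemainder P g I' j|
        ≤ d * A * (8 * (χ j * g j)) * g (j + 1) ^ 2 :=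
      calc |gRemainder P g I j - gRemainder P g I' j|
          ≤ d * A * (2 * (χ j * g j)) * g j ^ 2 :=
            (hE.gRemainder_sub_le hc hI hI' hd j).trans_eq (by ring)
        _ ≤ d * A * (2 * (χ j * g j)) * (2 * g (j + 1)) ^ 2 := by
            gcongr
            exact hE.le_two_mul_succ j
        _ = _ := by ring
    calc |picardG P g I (j + 1) - picardG P g I' (j + 1)|
        = |(1 - P.beta j * g j) ^ 2 * (picardG P g I j - picardG P g I' j)
            + (gRemainder P g I j - gRemainder P g I' j)| := by
          simp only [picardG]; ring_nf
      _ ≤ (1 - P.beta j * g j) ^ 2 * |picardG P g I j - picardG P g I' j|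
            + |gRemainder P g I j - gRemainder P g I' j| := by
          refine (abs_add_le _ _).trans_eq ?_
          rw [abs_mul, abs_of_nonneg (sq_nonneg (1 - P.beta j * g j))]
      _ ≤ (1 - P.beta j * g j) ^ 2
              * (d * A * (1 + 8 * ∑ k ∈ Finset.range j, χ k * g k) * g j ^ 2)
            + d * A * (8 * (χ j * g j)) * g (j + 1) ^ 2 := by gcongr
      _ = _ := by rw [← hmult, Finset.sum_range_succ]; ring

theorem picardG_sub_le (hE : ReferenceFlow Ω B C lam₀ L D Z δ P χ g)
    (hc : CouplingConst B C lam₀ L Z δ h A q)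
    (hI : InputDist h A χ g 1 I (centerInput P g))
    (hI' : InputDist h A χ g 1 I' (centerInput P g)) (hd : InputDist h A χ g d I I') (j : ℕ) :
    |picardG P g I j - picardG P g I' j| ≤ d * (gConst L A * logWeight (g j)) := by
  have hd0 := hE.inputDist_nonneg hc hd
  have hA := hc.A_nonneg
  calc |picardG P g I j - picardG P g I' j|
      ≤ d * A * (1 + 8 * ∑ k ∈ Finset.range j, χ k * g k) * g j ^ 2 :=
        hE.picardG_sub_le_sq hc hI hI' hd j
    _ ≤ d * A * (|Real.log (g j)| + 8 * (L * |Real.log (g j)|)) * g j ^ 2 := by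
        gcongr
        · exact hE.one_le_log j
        · exact hE.sum_le_log j
    _ = _ := by rw [gConst, logWeight]; ring

theorem picardG_center (P : Coeffs) (g : ℕ → ℝ) : picardG P g (centerInput P g) = g := by
  funext j
  induction j with
  | zero => rfl
  | succ j ih =>
    rw [picardG, ih]
    simp [gRemainder, centerInput, barFlow]

theorem picardG_sub_center_le (hE : ReferenceFlow Ω B C lam₀ L D Z δ P χ g)
    (hc : CouplingConst B C lam₀ L Z δ h A q)
    (hI : InputDist h A χ g 1 I (centerInput P g)) (j : ℕ) :
    |picardG P g I j - g j| ≤ gConst L A * logWeight (g j) := by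
  have := hE.picardG_sub_le hc hI (hE.inputDist_center hc) hI j
  rwa [picardG_center, one_mul] at this

theorem gConst_mul_logWeight_le (hE : ReferenceFlow Ω B C lam₀ L D Z δ P χ g)
    (hc : CouplingConst B C lam₀ L Z δ h A q) (j : ℕ) : gConst L A * logWeight (g j) ≤ g j :=
  (mul_le_mul_of_nonneg_right
    (hc.gConst_le.trans (mul_le_of_le_one_left hc.h_pos.le hc.q_le_one))
    (hE.logWeight_pos j).le).trans (hE.mul_logWeight_le hc.h_pos.le hc.h_mul_le j)

theorem abs_zSource_sub_le (P : Coeffs) (g : ℕ → ℝ) (I I' : PicardInput) (j : ℕ) :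
    |zSource P g I j - zSource P g I' j|
      ≤ |P.theta j| * (|picardG P g I j - picardG P g I' j| * |picardG P g I j + picardG P g I' j|)
        + |P.zeta j| * (|picardG P g I j - picardG P g I' j| * |(I.arg j).2.1|
          + |picardG P g I' j - g j| * |(I.arg j).2.1 - (I'.arg j).2.1|)
        + |(I.source j).2.1 - (I'.source j).2.1| := by
  set x := picardG P g I j
  set x' := picardG P g I' j
  set w := (I.arg j).2.1
  set w' := (I'.arg j).2.1
  have hsub : zSource P g I j - zSource P g I' j
      = (-(P.theta j * ((x - x') * (x + x')))
          - P.zeta j * ((x - x') * w + (x' - g j) * (w - w')))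
        + ((I.source j).2.1 - (I'.source j).2.1) := by
    simp only [zSource, x, x', w, w']; ring
  rw [hsub]
  refine (abs_add_le _ _).trans (add_le_add_left ((abs_sub _ _).trans ?_) _)
  rw [abs_neg, abs_mul, abs_mul, abs_mul]
  gcongr
  simpa only [abs_mul] using abs_add_le ((x - x') * w) ((x' - g j) * (w - w'))

theorem zSource_sub_le (hE : ReferenceFlow Ω B C lam₀ L D Z δ P χ g)
    (hc : CouplingConst B C lam₀ L Z δ h A q)
    (hI : InputDist h A χ g 1 I (centerInput P g))
    (hI' : InputDist h A χ g 1 I' (centerInput P g)) (hd : InputDist h A χ g d I I') (j : ℕ) :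
    |zSource P g I j - zSource P g I' j|
      ≤ d * (C * gConst L A * (3 * Z + 7) + A) * (χ j * (g j * logWeight (g j))) := by
  have hd0 := hE.inputDist_nonneg hc hd
  have hC := hE.coeff_nonneg
  have hZ := hE.size_nonneg
  have hG := hE.gConst_nonneg hc
  have hg := hE.coupling.pos j
  have hχ := hE.weight.pos j
  have hω := hE.logWeight_pos j
  have hx := (hE.picardG_sub_center_le hc hI j).trans (hE.gConst_mul_logWeight_le hc j)
  have hx' := hE.picardG_sub_center_le hc hI' j
  have hsum : |picardG P g I j + picardG P g I' j| ≤ 2 * (Z + 2) * g j := by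
    have := hx'.trans (hE.gConst_mul_logWeight_le hc j)
    rw [abs_le] at hx this ⊢
    constructor <;> nlinarith [mul_nonneg hZ hg.le]
  have hw : |(I.arg j).2.1| ≤ (Z + 2) * g j := by
    have hmem : I.arg j - barFlow P g j ∈ couplingBox χ g (1 * h) j := hI.arg j
    rw [one_mul] at hmem
    exact (abs_snd_fst_le_norm _).trans (hE.norm_le_of_sub_mem_couplingBox hc.h_mul_le hmem)
  have hww : |(I.arg j).2.1 - (I'.arg j).2.1| ≤ d * g j := by
    have h1 := (abs_snd_fst_le_norm _).trans (hE.norm_le_of_mem_couplingBox (hd.arg j))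
    have h2 := mul_le_mul_of_nonneg_left (hE.mul_logWeight_le hc.h_pos.le hc.h_mul_le j) hd0
    exact h1.trans (by linarith)
  have hsource : |(I.source j).2.1 - (I'.source j).2.1|
      ≤ d * (A * (χ j * (g j * logWeight (g j)))) := by
    refine ((abs_snd_fst_le_norm _).trans (hd.source j)).trans ?_
    have hA := hc.A_nonneg
    rw [pow_succ' (g j) 2]
    gcongr
    exact hE.sq_le_logWeight j
  calc |zSource P g I j - zSource P g I' j|
      ≤ C * χ j * ((d * (gConst L A * logWeight (g j))) * (2 * (Z + 2) * g j))
          + C * χ j * ((d * (gConst L A * logWeight (g j))) * ((Z + 2) * g j)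
            + (gConst L A * logWeight (g j)) * (d * g j))
          + d * (A * (χ j * (g j * logWeight (g j)))) := by
        refine (abs_zSource_sub_le P g I I' j).trans ?_
        have hxx := hE.picardG_sub_le hc hI hI' hd j
        gcongr
        · exact hE.coeff.theta_le j
        · exact hE.coeff.zeta_le j
    _ = _ := by ring

theorem zSource_center (P : Coeffs) (g : ℕ → ℝ) :
    zSource P g (centerInput P g) = fun j => -(P.theta j * g j ^ 2) := by
  funext j
  rw [zSource, picardG_center]
  simp [centerInput]

theorem abs_zSource_le (hE : ReferenceFlow Ω B C lam₀ L D Z δ P χ g)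
    (hc : CouplingConst B C lam₀ L Z δ h A q)
    (hI : InputDist h A χ g 1 I (centerInput P g)) (j : ℕ) :
    |zSource P g I j| ≤ (C + (C * gConst L A * (3 * Z + 7) + A)) * (χ j * g j ^ 2) := by
  have hdiff := hE.zSource_sub_le hc hI (hE.inputDist_center hc) hI j
  rw [zSource_center, one_mul] at hdiff
  have hC := hE.coeff_nonneg
  have hZ := hE.size_nonneg
  have hG := hE.gConst_nonneg hc
  have hA := hc.A_nonneg
  have hg := hE.coupling.pos j
  have hχ := hE.weight.pos j
  have hω : logWeight (g j) ≤ g j :=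
    (hE.logWeight_le j).trans (mul_le_of_le_one_left hg.le hE.delta_le_one)
  have hle : (C * gConst L A * (3 * Z + 7) + A) * (χ j * (g j * logWeight (g j)))
      ≤ (C * gConst L A * (3 * Z + 7) + A) * (χ j * g j ^ 2) := by
    rw [sq]
    gcongr
  have htri := abs_sub_abs_le_abs_sub (zSource P g I j) (-(P.theta j * g j ^ 2))
  linarith [abs_zForcing_le (g := g) hE.coeff j]

theorem sum_abs_zSourceTerm_le (hE : ReferenceFlow Ω B C lam₀ L D Z δ P χ g)
    (hc : CouplingConst B C lam₀ L Z δ h A q)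
    (hI : InputDist h A χ g 1 I (centerInput P g)) (j n : ℕ) :
    ∑ l ∈ Finset.range n, |backTerm (zCoeff P g) (zSource P g I) j l|
      ≤ 2 * (C + (C * gConst L A * (3 * Z + 7) + A)) * L * (χ j * g j) := by
  have hC := hE.coeff_nonneg
  have hZ := hE.size_nonneg
  have hG := hE.gConst_nonneg hc
  have hA := hc.A_nonneg
  exact hE.coupling.sum_abs_backTerm_le hE.half_le_prod (by positivity)
    (hE.abs_zSource_le hc hI) j n

theorem picardZ_sub_le (hE : ReferenceFlow Ω B C lam₀ L D Z δ P χ g)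
    (hc : CouplingConst B C lam₀ L Z δ h A q)
    (hI : InputDist h A χ g 1 I (centerInput P g))
    (hI' : InputDist h A χ g 1 I' (centerInput P g)) (hd : InputDist h A χ g d I I') (j : ℕ) :
    |picardZ P g I j - picardZ P g I' j| ≤ d * (zConst C L Z A * (χ j * logWeight (g j))) := by
  have hd0 := hE.inputDist_nonneg hc hd
  have hC := hE.coeff_nonneg
  have hZ := hE.size_nonneg
  have hG := hE.gConst_nonneg hc
  have hA := hc.A_nonneg
  rw [picardZ, picardZ, backSum_sub (summable_backTerm (hE.sum_abs_zSourceTerm_le hc hI j))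
    (summable_backTerm (hE.sum_abs_zSourceTerm_le hc hI' j))]
  refine (abs_backSum_le (hE.sum_abs_backTerm_le (by positivity)
    (hE.zSource_sub_le hc hI hI' hd) j)).trans_eq ?_
  rw [zConst]
  ring

theorem picardZ_center (P : Coeffs) (g : ℕ → ℝ) : picardZ P g (centerInput P g) = zBar P g := by
  rw [picardZ, zSource_center, zBar]

theorem picardArg_mem (hE : ReferenceFlow Ω B C lam₀ L D Z δ P χ g)
    (hc : CouplingConst B C lam₀ L Z δ h A q)
    (hI : InputDist h A χ g 1 I (centerInput P g))
    (hI' : InputDist h A χ g 1 I' (centerInput P g)) (hd : InputDist h A χ g d I I') (j : ℕ) :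
    ((picardG P g I j, picardZ P g I j, (I.arg j).2.2) : Coupling)
      - (picardG P g I' j, picardZ P g I' j, (I'.arg j).2.2) ∈ couplingBox χ g (d * h) j := by
  have hd0 := hE.inputDist_nonneg hc hd
  have hω := (hE.logWeight_pos j).le
  have hχ := (hE.weight.pos j).le
  have hqh : q * h ≤ h := mul_le_of_le_one_left hc.h_pos.le hc.q_le_one
  refine ⟨(hE.picardG_sub_le hc hI hI' hd j).trans ?_,
    (hE.picardZ_sub_le hc hI hI' hd j).trans ?_, (hd.arg j).2.2⟩
  · rw [mul_assoc]
    gcongr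
    exact hc.gConst_le.trans hqh
  · rw [mul_assoc]
    gcongr
    exact hc.zConst_le.trans hqh

theorem norm_picardArg_le (hE : ReferenceFlow Ω B C lam₀ L D Z δ P χ g)
    (hc : CouplingConst B C lam₀ L Z δ h A q)
    (hI : InputDist h A χ g 1 I (centerInput P g)) (j : ℕ) :
    ‖((picardG P g I j, picardZ P g I j, (I.arg j).2.2) : Coupling)‖ ≤ (Z + 2) * g j := by
  have hmem := hE.picardArg_mem hc hI (hE.inputDist_center hc) hI j
  rw [picardG_center, picardZ_center, one_mul] at hmem
  exact hE.norm_le_of_sub_mem_couplingBox hc.h_mul_le hmem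

theorem zConst_nonneg (hE : ReferenceFlow Ω B C lam₀ L D Z δ P χ g)
    (hc : CouplingConst B C lam₀ L Z δ h A q) : 0 ≤ zConst C L Z A := by
  have := hE.gConst_nonneg hc
  have := hE.coupling.mass_nonneg
  have := hE.coeff_nonneg
  have := hE.size_nonneg
  have := hc.A_nonneg
  unfold zConst; positivity

theorem muForcing_picardArg_sub_le (hE : ReferenceFlow Ω B C lam₀ L D Z δ P χ g)
    (hc : CouplingConst B C lam₀ L Z δ h A q)
    (hI : InputDist h A χ g 1 I (centerInput P g))
    (hI' : InputDist h A χ g 1 I' (centerInput P g)) (hd : InputDist h A χ g d I I') (j : ℕ) :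
    |muForcing P j (picardG P g I j, picardZ P g I j, (I.arg j).2.2)
        - muForcing P j (picardG P g I' j, picardZ P g I' j, (I'.arg j).2.2)|
      ≤ d * (C * (gConst L A + zConst C L Z A) + 10 * C * (Z + 2) * δ * h)
        * (χ j * logWeight (g j)) := by
  have hd0 := hE.inputDist_nonneg hc hd
  have hC := hE.coeff_nonneg
  have hZ := hE.size_nonneg
  have hh := hc.h_pos
  have hχ := hE.weight.pos j
  have hω := hE.logWeight_pos j
  have hz : |picardZ P g I j - picardZ P g I' j| ≤ d * (zConst C L Z A * logWeight (g j)) := by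
    have hzc := hE.zConst_nonneg hc
    refine (hE.picardZ_sub_le hc hI hI' hd j).trans ?_
    gcongr
    exact mul_le_of_le_one_left hω.le (hE.weight.le_one j)
  refine (muForcing_sub_le hE.coeff j (hE.norm_picardArg_le hc hI j)
    (hE.norm_picardArg_le hc hI' j)
    (hE.norm_le_of_mem_couplingBox (hE.picardArg_mem hc hI hI' hd j))).trans ?_
  calc C * χ j * (|picardG P g I j - picardG P g I' j| + |picardZ P g I j - picardZ P g I' j|)
        + 10 * (C * χ j * ((Z + 2) * g j * (d * h * logWeight (g j))))
      ≤ C * χ j * (d * (gConst L A * logWeight (g j)) + d * (zConst C L Z A * logWeight (g j)))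
        + 10 * (C * χ j * ((Z + 2) * δ * (d * h * logWeight (g j)))) := by
        gcongr
        · exact hE.picardG_sub_le hc hI hI' hd j
        · exact hE.g_le j
    _ = _ := by ring

theorem picardMu_sub_le (hE : ReferenceFlow Ω B C lam₀ L D Z δ P χ g)
    (hc : CouplingConst B C lam₀ L Z δ h A q)
    (hI : InputDist h A χ g 1 I (centerInput P g))
    (hI' : InputDist h A χ g 1 I' (centerInput P g)) (hd : InputDist h A χ g d I I') (j : ℕ) :
    |picardMu P g I j - picardMu P g I' j| ≤ d * (q * h) * (χ j * logWeight (g j)) := by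
  have hd0 := hE.inputDist_nonneg hc hd
  have hg := hE.coupling.pos j
  have hχω := mul_nonneg (hE.weight.pos j).le (hE.logWeight_pos j).le
  have hlam : 0 < lam₀ := one_pos.trans hE.one_lt_lam
  have hlamj : lam₀ ≤ P.lam j := hE.coeff.le_lam j
  have hforcing := hE.muForcing_picardArg_sub_le hc hI hI' hd j
  set F := muForcing P j (picardG P g I j, picardZ P g I j, (I.arg j).2.2)
  set F' := muForcing P j (picardG P g I' j, picardZ P g I' j, (I'.arg j).2.2)
  have hnext : |(I.arg (j + 1)).2.2 - (I'.arg (j + 1)).2.2|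
      ≤ d * (h * (1 + 7 * δ)) * (χ j * logWeight (g j)) :=
    (hd.arg (j + 1)).2.2.trans ((mul_le_mul_of_nonneg_left (hE.chi_mul_logWeight_succ_le j)
      (mul_nonneg hd0 hc.h_pos.le)).trans_eq (by ring))
  have hsource : |(I.source j).2.2 - (I'.source j).2.2| ≤ d * A * (χ j * logWeight (g j)) := by
    have hA := hc.A_nonneg
    have hχ := hE.weight.pos j
    refine ((abs_snd_snd_le_norm _).trans (hd.source j)).trans ?_
    rw [mul_assoc]
    gcongr
    exact (pow_le_pow_of_le_one hg.le (hE.coupling.le_one j) (by norm_num)).trans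
      (hE.sq_le_logWeight j)
  have hcond := mul_le_mul_of_nonneg_left hc.mu_cond (mul_nonneg hd0 hχω)
  have hdiff : picardMu P g I j - picardMu P g I' j
      = (P.lam j)⁻¹ * (((I.arg (j + 1)).2.2 - (I'.arg (j + 1)).2.2) - (F - F')
        - ((I.source j).2.2 - (I'.source j).2.2)) := by
    simp only [picardMu, F, F']; ring
  have htri : |((I.arg (j + 1)).2.2 - (I'.arg (j + 1)).2.2) - (F - F')
        - ((I.source j).2.2 - (I'.source j).2.2)|
      ≤ lam₀ * (d * (q * h) * (χ j * logWeight (g j))) := by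
    refine ((abs_sub _ _).trans (add_le_add_left (abs_sub _ _) _)).trans ?_
    linarith
  rw [hdiff, abs_mul, abs_inv, abs_of_pos (hlam.trans_le hlamj), inv_mul_le_iff₀ (by linarith)]
  refine htri.trans (mul_le_mul_of_nonneg_right hlamj ?_)
  exact nonneg_of_mul_nonneg_right ((abs_nonneg _).trans htri) hlam

theorem picardMu_center (hE : ReferenceFlow Ω B C lam₀ L D Z δ P χ g) :
    picardMu P g (centerInput P g) = muBar P g (zBar P g) := by
  funext j
  have hlam : P.lam j ≠ 0 := by linarith [hE.coeff.le_lam j, hE.one_lt_lam]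
  have hstep := congrArg (fun V : Coupling => V.2.2) (hE.step j)
  simp only [quadMap_mu] at hstep
  rw [picardMu, picardG_center, picardZ_center]
  simp only [centerInput, hstep, Pi.zero_apply, Prod.snd_zero, sub_zero]
  rw [barFlow, add_sub_cancel_right, inv_mul_cancel_left₀ hlam]

theorem couplingPicard_center (hE : ReferenceFlow Ω B C lam₀ L D Z δ P χ g) :
    couplingPicard P g (centerInput P g) = barFlow P g := by
  funext j
  rw [couplingPicard, picardG_center, picardZ_center, hE.picardMu_center, barFlow]

theorem couplingPicard_sub_mem (hE : ReferenceFlow Ω B C lam₀ L D Z δ P χ g)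
    (hc : CouplingConst B C lam₀ L Z δ h A q)
    (hI : InputDist h A χ g 1 I (centerInput P g))
    (hI' : InputDist h A χ g 1 I' (centerInput P g)) (hd : InputDist h A χ g d I I') (j : ℕ) :
    couplingPicard P g I j - couplingPicard P g I' j ∈ couplingBox χ g (d * (q * h)) j := by
  have hd0 := hE.inputDist_nonneg hc hd
  have hω := (hE.logWeight_pos j).le
  have hχ := (hE.weight.pos j).le
  refine ⟨(hE.picardG_sub_le hc hI hI' hd j).trans ?_,
    (hE.picardZ_sub_le hc hI hI' hd j).trans ?_, hE.picardMu_sub_le hc hI hI' hd j⟩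
  · rw [mul_assoc]
    gcongr
    exact hc.gConst_le
  · rw [mul_assoc]
    gcongr
    exact hc.zConst_le

end ReferenceFlow

/-! ### A contraction principle on sequence spaces -/

/-- `T` contracts differences of sequences in `S` by the factor `q`, where `U d` is the set of
sequences of size at most `d` and `D` bounds the size of `S`. -/
structure IsGaugeContraction {X : ℕ → Type*} [∀ j, NormedAddCommGroup (X j)]
    (T : (∀ j, X j) → ∀ j, X j) (S : Set (∀ j, X j)) (U : ℝ → Set (∀ j, X j)) (c q D : ℝ) :
    Prop where
  ratio_nonneg : 0 ≤ q
  ratio_lt_one : q < 1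
  diam_nonneg : 0 ≤ D
  isClosed : ∀ d, IsClosed (U d)
  norm_le : ∀ d, ∀ v ∈ U d, ∀ j, ‖v j‖ ≤ c * d
  sub_mem : ∀ x ∈ S, ∀ y ∈ S, x - y ∈ U D
  map_sub_mem : ∀ x ∈ S, ∀ y ∈ S, ∀ d, 0 ≤ d → x - y ∈ U d → T x - T y ∈ U (q * d)

namespace IsGaugeContraction

variable {X : ℕ → Type*} [∀ j, NormedAddCommGroup (X j)] {T : (∀ j, X j) → ∀ j, X j}
  {S S₀ : Set (∀ j, X j)} {U : ℝ → Set (∀ j, X j)} {c q D : ℝ} {x y : ∀ j, X j}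

theorem size_nonneg (hT : IsGaugeContraction T S U c q D) (k : ℕ) : 0 ≤ q ^ k * D :=
  mul_nonneg (pow_nonneg hT.ratio_nonneg k) hT.diam_nonneg

theorem tendsto_bound (hT : IsGaugeContraction T S U c q D) :
    Tendsto (fun k : ℕ => c * (q ^ k * D)) atTop (𝓝 0) := by
  simpa only [zero_mul, mul_zero] using
    ((tendsto_pow_atTop_nhds_zero_of_lt_one hT.ratio_nonneg hT.ratio_lt_one).mul_const D).const_mul
      c

theorem iterate_sub_mem (hT : IsGaugeContraction T S U c q D) (hx : ∀ k, T^[k] x ∈ S)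
    (hy : ∀ k, T^[k] y ∈ S) (k : ℕ) : T^[k] x - T^[k] y ∈ U (q ^ k * D) := by
  induction k with
  | zero =>
    rw [pow_zero, one_mul]
    exact hT.sub_mem _ (hx 0) _ (hy 0)
  | succ k ih =>
    rw [Function.iterate_succ_apply', Function.iterate_succ_apply', pow_succ', mul_assoc]
    exact hT.map_sub_mem _ (hx k) _ (hy k) _ (hT.size_nonneg k) ih

theorem eq_of_isFixedPt (hT : IsGaugeContraction T S U c q D) (hx : x ∈ S) (hTx : T x = x)
    (hy : y ∈ S) (hTy : T y = y) : x = y := by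
  have hxk : ∀ k, T^[k] x = x := Function.iterate_fixed hTx
  have hyk : ∀ k, T^[k] y = y := Function.iterate_fixed hTy
  funext j
  refine sub_eq_zero.1 (norm_le_zero_iff.1 (ge_of_tendsto' hT.tendsto_bound fun k => ?_))
  have hmem := hT.iterate_sub_mem (fun k => (hxk k).symm ▸ hx) (fun k => (hyk k).symm ▸ hy) k
  rw [hxk, hyk] at hmem
  exact hT.norm_le _ _ hmem j

theorem iterate_sub_iterate_add_mem (hT : IsGaugeContraction T S U c q D)
    (hx : ∀ k, T^[k] x ∈ S) (k n : ℕ) : T^[k] x - T^[k + n] x ∈ U (q ^ k * D) := by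
  rw [Function.iterate_add_apply]
  refine hT.iterate_sub_mem hx (fun l => ?_) k
  rw [← Function.iterate_add_apply]
  exact hx _

theorem cauchySeq_iterate (hT : IsGaugeContraction T S U c q D) (hx : ∀ k, T^[k] x ∈ S) (j : ℕ) :
    CauchySeq fun k => T^[k] x j := by
  refine cauchySeq_of_le_tendsto_0' (fun k => c * (q ^ k * D)) (fun k m hkm => ?_)
    hT.tendsto_bound
  obtain ⟨n, rfl⟩ := Nat.exists_eq_add_of_le hkm
  rw [dist_eq_norm]
  exact hT.norm_le _ _ (hT.iterate_sub_iterate_add_mem hx k n) j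

theorem iterate_sub_lim_mem (hT : IsGaugeContraction T S U c q D) (hx : ∀ k, T^[k] x ∈ S)
    (hy : Tendsto (fun k => T^[k] x) atTop (𝓝 y)) (k : ℕ) : T^[k] x - y ∈ U (q ^ k * D) := by
  have hlim : Tendsto (fun n => T^[k] x - T^[k + n] x) atTop (𝓝 (T^[k] x - y)) := by
    refine tendsto_const_nhds.sub ?_
    simpa only [Function.comp_def, add_comm k] using hy.comp (tendsto_add_atTop_nat k)
  exact (hT.isClosed _).mem_of_tendsto hlim
    (Eventually.of_forall fun n => hT.iterate_sub_iterate_add_mem hx k n)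

theorem isFixedPt_lim (hT : IsGaugeContraction T S U c q D) (hx : ∀ k, T^[k] x ∈ S) (hyS : y ∈ S)
    (hy : Tendsto (fun k => T^[k] x) atTop (𝓝 y)) : T y = y := by
  funext j
  have hstep : ∀ k, ‖T^[k + 1] x j - T y j‖ ≤ q * (c * (q ^ k * D)) := fun k => by
    rw [Function.iterate_succ_apply', mul_left_comm]
    exact hT.norm_le _ _ (hT.map_sub_mem _ (hx k) _ hyS _ (hT.size_nonneg k)
      (hT.iterate_sub_lim_mem hx hy k)) j
  refine tendsto_nhds_unique ?_ ((tendsto_pi_nhds.1 hy j).comp (tendsto_add_atTop_nat 1))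
  refine tendsto_iff_norm_sub_tendsto_zero.2
    (squeeze_zero (fun _ => norm_nonneg _) hstep ?_)
  simpa only [mul_zero] using hT.tendsto_bound.const_mul q

/-- The limit of the iterates is located in the closed invariant set `S₀`, but unique in `S`. -/
theorem exists_fixedPt [∀ j, CompleteSpace (X j)] (hT : IsGaugeContraction T S U c q D)
    (hS₀ : S₀ ⊆ S) (hclosed : IsClosed S₀) (hmaps : Set.MapsTo T S₀ S₀) (hx : x ∈ S₀) :
    ∃ y ∈ S₀, T y = y ∧ (∀ y' ∈ S, T y' = y' → y' = y) ∧
      ∀ k j, ‖T^[k] x j - y j‖ ≤ c * (q ^ k * D) := by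
  have hxk : ∀ k, T^[k] x ∈ S₀ := fun k => hmaps.iterate k hx
  have hxS : ∀ k, T^[k] x ∈ S := fun k => hS₀ (hxk k)
  choose y hlim using fun j => cauchySeq_tendsto_of_complete (hT.cauchySeq_iterate hxS j)
  have hy := tendsto_pi_nhds.2 hlim
  have hyS₀ : y ∈ S₀ := hclosed.mem_of_tendsto hy (Eventually.of_forall hxk)
  have hTy := hT.isFixedPt_lim hxS (hS₀ hyS₀) hy
  exact ⟨y, hyS₀, hTy, fun y' hy' hTy' => hT.eq_of_isFixedPt hy' hTy' (hS₀ hyS₀) hTy,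
    fun k j => hT.norm_le _ _ (hT.iterate_sub_lim_mem hxS hy k) j⟩

end IsGaugeContraction

/-! ### The Picard map -/

/-- The deviations `(K, g, z, μ)` at scale `j` of relative sizes at most `a` and `h`. -/
def tubeBox (W : ℕ → Type*) [∀ j, NormedAddCommGroup (W j)] (χ g : ℕ → ℝ) (a h : ℝ) (j : ℕ) :
    Set (W j × Coupling) :=
  {p | ‖p.1‖ ≤ a * (χ j * g j ^ 3) ∧ p.2 ∈ couplingBox χ g h j}

/-- The points at scale `j` near `(0, V̄_j)`. -/
def tube (W : ℕ → Type*) [∀ j, NormedAddCommGroup (W j)] (P : Coeffs) (χ g : ℕ → ℝ) (a h : ℝ)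
    (j : ℕ) : Set (W j × Coupling) :=
  {p | ‖p.1‖ ≤ a * (χ j * g j ^ 3) ∧ p.2 - barFlow P g j ∈ couplingBox χ g h j}

/-- The size and Lipschitz bounds on the perturbation that (A3) implies on the convex domains
`D`. -/
structure PertBounds {W : ℕ → Type*} [∀ j, NormedAddCommGroup (W j)] (κ R M : ℝ) (χ g : ℕ → ℝ)
    (D : ∀ j, Set (W j × Coupling)) (ψ : ∀ j, W j × Coupling → W (j + 1))
    (ρ : ∀ j, W j × Coupling → Coupling) : Prop where
  psi_zero_le : ∀ j, ∀ p ∈ D j, ‖ψ j (0, p.2)‖ ≤ R * (χ (j + 1) * g (j + 1) ^ 3)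
  psi_lip : ∀ j, ∀ p ∈ D j, ∀ p' ∈ D j, ‖ψ j p - ψ j p'‖
    ≤ κ * ‖p.1 - p'.1‖ + M * (χ (j + 1) * g (j + 1) ^ 2) * ‖p.2 - p'.2‖
  rho_le : ∀ j, ∀ p ∈ D j, ‖ρ j p‖ ≤ M * (χ (j + 1) * g (j + 1) ^ 3)
  rho_lip : ∀ j, ∀ p ∈ D j, ∀ p' ∈ D j, ‖ρ j p - ρ j p'‖
    ≤ M * ‖p.1 - p'.1‖ + M * (χ (j + 1) * g (j + 1) ^ 2) * ‖p.2 - p'.2‖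

/-- The numerical conditions under which the Picard map contracts the `K`-component by the factor
`q`, the perturbation of the couplings is of relative size `A`, and the tube of radii `a₁`, `r₀ h`
is mapped into itself. -/
structure PicardConst (Ω κ R M δ a h A q r₀ a₁ : ℝ) : Prop where
  κ_nonneg : 0 ≤ κ
  M_nonneg : 0 ≤ M
  q_nonneg : 0 ≤ q
  q_lt_one : q < 1
  r₀_nonneg : 0 ≤ r₀
  r₀_le : r₀ ≤ 1
  a₁_nonneg : 0 ≤ a₁
  a₁_le : a₁ ≤ a
  K_cond : κ * Ω * (1 + 7 * δ) * a + 2 * M * h * δ ≤ q * a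
  lip_le : M * (a + 4 * (h * δ)) ≤ A
  rho_le : 8 * M ≤ r₀ * A
  one_le : 1 ≤ r₀ * A
  K_self : R + κ * Ω * (1 + 7 * δ) * a₁ ≤ a₁

section Picard

variable {W : ℕ → Type*} [∀ j, NormedAddCommGroup (W j)]

/-- The `K`-component of the Picard map. -/
def picardK (ψ : ∀ j, W j × Coupling → W (j + 1)) (K₀ : W 0) (x : ∀ j, W j × Coupling) : ∀ j, W j
  | 0 => K₀
  | j + 1 => ψ j (x j)

/-- The input of the Picard map for the couplings along the sequence `x`. -/
def pertInput (ρ : ∀ j, W j × Coupling → Coupling) (g₀ : ℝ) (x : ∀ j, W j × Coupling) :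
    PicardInput := ⟨g₀, fun j => ρ j (x j), fun j => (x j).2⟩

/-- The Picard map, whose fixed points are the flows with the given boundary conditions. -/
def picard (P : Coeffs) (g : ℕ → ℝ) (ψ : ∀ j, W j × Coupling → W (j + 1))
    (ρ : ∀ j, W j × Coupling → Coupling) (u₀ : W 0 × ℝ) (x : ∀ j, W j × Coupling) (j : ℕ) :
    W j × Coupling :=
  (picardK ψ u₀.1 x j, couplingPicard P g (pertInput ρ u₀.2 x) j)

theorem isClosed_couplingBox (χ g : ℕ → ℝ) (r : ℝ) (j : ℕ) : IsClosed (couplingBox χ g r j) := by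
  refine IsClosed.and ?_ (IsClosed.and ?_ ?_) <;>
    exact isClosed_le (by fun_prop) continuous_const

theorem isClosed_tubeBox (χ g : ℕ → ℝ) (a h : ℝ) (j : ℕ) : IsClosed (tubeBox W χ g a h j) :=
  (isClosed_le continuous_fst.norm continuous_const).and
    ((isClosed_couplingBox χ g h j).preimage continuous_snd)

theorem isClosed_tube (P : Coeffs) (χ g : ℕ → ℝ) (a h : ℝ) (j : ℕ) :
    IsClosed (tube W P χ g a h j) :=
  (isClosed_le continuous_fst.norm continuous_const).and
    ((isClosed_couplingBox χ g h j).preimage (continuous_snd.sub continuous_const))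

theorem couplingBox_sub_mem {χ g : ℕ → ℝ} {r s : ℝ} {j : ℕ} {v w : Coupling}
    (hv : v ∈ couplingBox χ g r j) (hw : w ∈ couplingBox χ g s j) :
    v - w ∈ couplingBox χ g (r + s) j :=
  ⟨(abs_sub _ _).trans ((add_le_add hv.1 hw.1).trans_eq (add_mul _ _ _).symm),
    (abs_sub _ _).trans ((add_le_add hv.2.1 hw.2.1).trans_eq (add_mul _ _ _).symm),
    (abs_sub _ _).trans ((add_le_add hv.2.2 hw.2.2).trans_eq (add_mul _ _ _).symm)⟩

theorem tube_sub_mem {P : Coeffs} {χ g : ℕ → ℝ} {a h : ℝ} {j : ℕ} {p p' : W j × Coupling}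
    (hp : p ∈ tube W P χ g a h j) (hp' : p' ∈ tube W P χ g a h j) :
    p - p' ∈ tubeBox W χ g (2 * a) (2 * h) j := by
  refine ⟨(norm_sub_le _ _).trans ((add_le_add hp.1 hp'.1).trans_eq (by ring)), ?_⟩
  rw [Prod.snd_sub, ← sub_sub_sub_cancel_right p.2 p'.2 (barFlow P g j), two_mul]
  exact couplingBox_sub_mem hp.2 hp'.2

namespace ReferenceFlow

variable {Ω B C lam₀ L D Z δ : ℝ} {P : Coeffs} {χ g : ℕ → ℝ} {κ R M a h A q r₀ a₁ : ℝ}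
  {ψ : ∀ j, W j × Coupling → W (j + 1)} {ρ : ∀ j, W j × Coupling → Coupling}

theorem cube_pos (hE : ReferenceFlow Ω B C lam₀ L D Z δ P χ g) (j : ℕ) : 0 < χ j * g j ^ 3 :=
  mul_pos (hE.weight.pos j) (pow_pos (hE.coupling.pos j) 3)

theorem cube_le (hE : ReferenceFlow Ω B C lam₀ L D Z δ P χ g) (j : ℕ) :
    χ j * g j ^ 3 ≤ Ω * (1 + 7 * δ) * (χ (j + 1) * g (j + 1) ^ 3) := by
  have hg := hE.coupling.pos j
  have hg' := hE.coupling.pos (j + 1)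
  have hΩχ := (hE.weight.pos j).le.trans (hE.weight.le_mul_succ j)
  calc χ j * g j ^ 3 ≤ (Ω * χ (j + 1)) * ((1 + δ) * g (j + 1)) ^ 3 := by
        gcongr
        · exact hE.weight.le_mul_succ j
        · exact hE.le_succ j
    _ = (Ω * χ (j + 1)) * ((1 + δ) ^ 3 * g (j + 1) ^ 3) := by ring
    _ ≤ (Ω * χ (j + 1)) * ((1 + 7 * δ) * g (j + 1) ^ 3) := by
        gcongr
        exact hE.one_add_delta_pow_three_le
    _ = _ := by ring

theorem cube_succ_le (hE : ReferenceFlow Ω B C lam₀ L D Z δ P χ g) (j : ℕ) :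
    χ (j + 1) * g (j + 1) ^ 3 ≤ 8 * (χ j * g j ^ 3) := by
  have hg' := hE.coupling.pos (j + 1)
  have hχ := hE.weight.pos j
  calc χ (j + 1) * g (j + 1) ^ 3 ≤ χ j * (2 * g j) ^ 3 := by
        gcongr
        · exact hE.weight.antitone (Nat.le_succ j)
        · exact hE.coupling.quasi_antitone j 1
    _ = _ := by ring

theorem sq_mul_logWeight_le_cube_succ (hE : ReferenceFlow Ω B C lam₀ L D Z δ P χ g) (j : ℕ) :
    χ (j + 1) * g (j + 1) ^ 2 * logWeight (g j) ≤ 2 * δ * (χ (j + 1) * g (j + 1) ^ 3) := by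
  have hg' := hE.coupling.pos (j + 1)
  have hχ' := hE.weight.pos (j + 1)
  have hδ := hE.delta_pos
  calc χ (j + 1) * g (j + 1) ^ 2 * logWeight (g j)
      ≤ χ (j + 1) * g (j + 1) ^ 2 * (δ * (2 * g (j + 1))) := by
        gcongr
        exact (hE.logWeight_le j).trans (mul_le_mul_of_nonneg_left (hE.le_two_mul_succ j) hδ.le)
    _ = _ := by ring

theorem sq_mul_logWeight_le_cube (hE : ReferenceFlow Ω B C lam₀ L D Z δ P χ g) (j : ℕ) :
    χ (j + 1) * g (j + 1) ^ 2 * logWeight (g j) ≤ 4 * δ * (χ j * g j ^ 3) := by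
  have hg' := hE.coupling.pos (j + 1)
  have hχ := hE.weight.pos j
  calc χ (j + 1) * g (j + 1) ^ 2 * logWeight (g j)
      ≤ χ j * (2 * g j) ^ 2 * (δ * g j) := by
        gcongr
        · exact (hE.logWeight_pos j).le
        · exact hE.weight.antitone (Nat.le_succ j)
        · exact hE.coupling.quasi_antitone j 1
        · exact hE.logWeight_le j
    _ = _ := by ring

theorem tube_mono (hE : ReferenceFlow Ω B C lam₀ L D Z δ P χ g) {a' h' : ℝ} (ha : a ≤ a')
    (hh : h ≤ h') (j : ℕ) : tube W P χ g a h j ⊆ tube W P χ g a' h' j := fun _ hp =>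
  ⟨hp.1.trans (mul_le_mul_of_nonneg_right ha (hE.cube_pos j).le), hE.couplingBox_mono hh j hp.2⟩

theorem zero_mem_tube (hE : ReferenceFlow Ω B C lam₀ L D Z δ P χ g) (ha : 0 ≤ a)
    {j : ℕ} {V : Coupling} (hV : V - barFlow P g j ∈ couplingBox χ g h j) :
    ((0, V) : W j × Coupling) ∈ tube W P χ g a h j :=
  ⟨by simpa only [norm_zero] using mul_nonneg ha (hE.cube_pos j).le, hV⟩

theorem barFlow_mem_tube (hE : ReferenceFlow Ω B C lam₀ L D Z δ P χ g) (ha : 0 ≤ a) (hh : 0 ≤ h)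
    (j : ℕ) : ((0, barFlow P g j) : W j × Coupling) ∈ tube W P χ g a h j := by
  refine hE.zero_mem_tube ha ?_
  rw [sub_self]
  exact hE.zero_mem_couplingBox hh j

theorem norm_psi_sub_le_of_mem_couplingBox (hE : ReferenceFlow Ω B C lam₀ L D Z δ P χ g)
    (hκ : 0 ≤ κ) (hM : 0 ≤ M) (hp : PertBounds κ R M χ g (tube W P χ g a h) ψ ρ) {X r : ℝ} {j : ℕ}
    {p p' : W j × Coupling} (hpD : p ∈ tube W P χ g a h j) (hpD' : p' ∈ tube W P χ g a h j)
    (hK : ‖p.1 - p'.1‖ ≤ X * (χ j * g j ^ 3)) (hV : p.2 - p'.2 ∈ couplingBox χ g r j) :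
    ‖ψ j p - ψ j p'‖ ≤ (κ * Ω * (1 + 7 * δ) * X + 2 * M * r * δ) * (χ (j + 1) * g (j + 1) ^ 3) := by
  have hχ' := hE.weight.pos (j + 1)
  have hX : 0 ≤ X := nonneg_of_mul_nonneg_left ((norm_nonneg _).trans hK) (hE.cube_pos j)
  have hr := hE.radius_nonneg hV
  have hVnorm : ‖p.2 - p'.2‖ ≤ r * logWeight (g j) := hE.norm_le_of_mem_couplingBox hV
  calc ‖ψ j p - ψ j p'‖
      ≤ κ * (X * (χ j * g j ^ 3)) + M * (χ (j + 1) * g (j + 1) ^ 2) * (r * logWeight (g j)) := by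
        refine (hp.psi_lip j p hpD p' hpD').trans ?_
        gcongr
    _ = κ * (X * (χ j * g j ^ 3))
        + M * (r * (χ (j + 1) * g (j + 1) ^ 2 * logWeight (g j))) := by ring
    _ ≤ κ * (X * (Ω * (1 + 7 * δ) * (χ (j + 1) * g (j + 1) ^ 3)))
        + M * (r * (2 * δ * (χ (j + 1) * g (j + 1) ^ 3))) := by
        have hcube_le := hE.cube_le j
        have hsq_le := hE.sq_mul_logWeight_le_cube_succ j
        gcongr ?_ * (?_ * ?_) + ?_ * (?_ * ?_)
    _ = _ := by ring

theorem norm_psi_sub_le (hE : ReferenceFlow Ω B C lam₀ L D Z δ P χ g)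
    (hc : PicardConst Ω κ R M δ a h A q r₀ a₁) (hp : PertBounds κ R M χ g (tube W P χ g a h) ψ ρ)
    {d : ℝ} (hd : 0 ≤ d) {j : ℕ} {p p' : W j × Coupling} (hpD : p ∈ tube W P χ g a h j)
    (hpD' : p' ∈ tube W P χ g a h j) (hpp : p - p' ∈ tubeBox W χ g (d * a) (d * h) j) :
    ‖ψ j p - ψ j p'‖ ≤ d * (q * a) * (χ (j + 1) * g (j + 1) ^ 3) := by
  refine (hE.norm_psi_sub_le_of_mem_couplingBox hc.κ_nonneg hc.M_nonneg hp hpD hpD' hpp.1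
    hpp.2).trans (mul_le_mul_of_nonneg_right ?_ (hE.cube_pos _).le)
  calc κ * Ω * (1 + 7 * δ) * (d * a) + 2 * M * (d * h) * δ
      = d * (κ * Ω * (1 + 7 * δ) * a + 2 * M * h * δ) := by ring
    _ ≤ d * (q * a) := mul_le_mul_of_nonneg_left hc.K_cond hd

theorem norm_psi_le (hE : ReferenceFlow Ω B C lam₀ L D Z δ P χ g)
    (hc : PicardConst Ω κ R M δ a h A q r₀ a₁) (hp : PertBounds κ R M χ g (tube W P χ g a h) ψ ρ)
    {j : ℕ} {p : W j × Coupling} (hpD : p ∈ tube W P χ g a₁ h j) :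
    ‖ψ j p‖ ≤ a₁ * (χ (j + 1) * g (j + 1) ^ 3) := by
  have hκ := hc.κ_nonneg
  have ha₁ := hc.a₁_nonneg
  have hpa : p ∈ tube W P χ g a h j := hE.tube_mono hc.a₁_le le_rfl j hpD
  have hp0 : ((0, p.2) : W j × Coupling) ∈ tube W P χ g a h j :=
    hE.zero_mem_tube (ha₁.trans hc.a₁_le) hpD.2
  have hlip := hp.psi_lip j p hpa _ hp0
  rw [sub_self, norm_zero, mul_zero, add_zero, sub_zero] at hlip
  calc ‖ψ j p‖ ≤ ‖ψ j (0, p.2)‖ + ‖ψ j p - ψ j (0, p.2)‖ := norm_le_norm_add_norm_sub' _ _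
    _ ≤ R * (χ (j + 1) * g (j + 1) ^ 3)
        + κ * (a₁ * (Ω * (1 + 7 * δ) * (χ (j + 1) * g (j + 1) ^ 3))) := by
        refine add_le_add (hp.psi_zero_le j p hpa) (hlip.trans ?_)
        have := hE.cube_le j
        gcongr
        exact hpD.1.trans (by gcongr)
    _ = (R + κ * Ω * (1 + 7 * δ) * a₁) * (χ (j + 1) * g (j + 1) ^ 3) := by ring
    _ ≤ _ := mul_le_mul_of_nonneg_right hc.K_self (hE.cube_pos (j + 1)).le

theorem norm_rho_sub_le (hE : ReferenceFlow Ω B C lam₀ L D Z δ P χ g)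
    (hc : PicardConst Ω κ R M δ a h A q r₀ a₁) (hp : PertBounds κ R M χ g (tube W P χ g a h) ψ ρ)
    {d : ℝ} (hd : 0 ≤ d) {j : ℕ} {p p' : W j × Coupling} (hpD : p ∈ tube W P χ g a h j)
    (hpD' : p' ∈ tube W P χ g a h j) (hpp : p - p' ∈ tubeBox W χ g (d * a) (d * h) j) :
    ‖ρ j p - ρ j p'‖ ≤ d * (A * (χ j * g j ^ 3)) := by
  have hM := hc.M_nonneg
  have hχ' := hE.weight.pos (j + 1)
  have hcube := hE.cube_pos j
  have hdh := hE.radius_nonneg hpp.2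
  have hV : ‖p.2 - p'.2‖ ≤ d * h * logWeight (g j) := hE.norm_le_of_mem_couplingBox hpp.2
  calc ‖ρ j p - ρ j p'‖
      ≤ M * (d * a * (χ j * g j ^ 3))
        + M * (χ (j + 1) * g (j + 1) ^ 2) * (d * h * logWeight (g j)) := by
        refine (hp.rho_lip j p hpD p' hpD').trans ?_
        gcongr
        exact hpp.1
    _ = M * (d * a * (χ j * g j ^ 3))
        + M * (d * h * (χ (j + 1) * g (j + 1) ^ 2 * logWeight (g j))) := by ring
    _ ≤ M * (d * a * (χ j * g j ^ 3)) + M * (d * h * (4 * δ * (χ j * g j ^ 3))) := by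
        have hsq_le := hE.sq_mul_logWeight_le_cube j
        gcongr _ + ?_ * (?_ * ?_)
    _ = d * (M * (a + 4 * (h * δ)) * (χ j * g j ^ 3)) := by ring
    _ ≤ _ := by
        gcongr
        exact hc.lip_le

theorem norm_rho_le (hE : ReferenceFlow Ω B C lam₀ L D Z δ P χ g)
    (hc : PicardConst Ω κ R M δ a h A q r₀ a₁) (hp : PertBounds κ R M χ g (tube W P χ g a h) ψ ρ)
    {j : ℕ} {p : W j × Coupling} (hpD : p ∈ tube W P χ g a h j) :
    ‖ρ j p‖ ≤ r₀ * A * (χ j * g j ^ 3) := by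
  have hM := hc.M_nonneg
  have hcube := hE.cube_pos j
  calc ‖ρ j p‖ ≤ M * (8 * (χ j * g j ^ 3)) :=
        (hp.rho_le j p hpD).trans (mul_le_mul_of_nonneg_left (hE.cube_succ_le j) hM)
    _ = 8 * M * (χ j * g j ^ 3) := by ring
    _ ≤ _ := mul_le_mul_of_nonneg_right hc.rho_le hcube.le

theorem inputDist_pertInput_center (hE : ReferenceFlow Ω B C lam₀ L D Z δ P χ g)
    (hc : PicardConst Ω κ R M δ a h A q r₀ a₁) (hA : 0 ≤ A)
    (hp : PertBounds κ R M χ g (tube W P χ g a h) ψ ρ) {u : ℝ} (hu : |u - g 0| ≤ g 0 ^ 2)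
    {x : ∀ j, W j × Coupling} (hx : ∀ j, x j ∈ tube W P χ g a h j) {r : ℝ} (hr : r₀ ≤ r)
    (hxr : ∀ j, (x j).2 - barFlow P g j ∈ couplingBox χ g (r * h) j) :
    InputDist h A χ g r (pertInput ρ u x) (centerInput P g) := by
  have hrA : r₀ * A ≤ r * A := mul_le_mul_of_nonneg_right hr hA
  refine ⟨hu.trans ?_, fun j => ?_, hxr⟩
  · rw [← mul_assoc]
    exact le_mul_of_one_le_left (sq_nonneg _) (hc.one_le.trans hrA)
  · have hcube := hE.cube_pos j
    simp only [pertInput, centerInput, Pi.zero_apply, sub_zero]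
    rw [← mul_assoc]
    exact (hE.norm_rho_le hc hp (hx j)).trans (mul_le_mul_of_nonneg_right hrA hcube.le)

theorem inputDist_pertInput (hE : ReferenceFlow Ω B C lam₀ L D Z δ P χ g)
    (hc : PicardConst Ω κ R M δ a h A q r₀ a₁) (hA : 0 ≤ A)
    (hp : PertBounds κ R M χ g (tube W P χ g a h) ψ ρ) (u : ℝ) {d : ℝ} (hd : 0 ≤ d)
    {x y : ∀ j, W j × Coupling} (hx : ∀ j, x j ∈ tube W P χ g a h j)
    (hy : ∀ j, y j ∈ tube W P χ g a h j) (hxy : ∀ j, x j - y j ∈ tubeBox W χ g (d * a) (d * h) j) :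
    InputDist h A χ g d (pertInput ρ u x) (pertInput ρ u y) where
  init := by
    rw [pertInput, pertInput, sub_self, abs_zero]
    positivity
  source j := hE.norm_rho_sub_le hc hp hd (hx j) (hy j) (hxy j)
  arg j := (hxy j).2

theorem picard_sub_mem (hE : ReferenceFlow Ω B C lam₀ L D Z δ P χ g)
    (hcV : CouplingConst B C lam₀ L Z δ h A q) (hc : PicardConst Ω κ R M δ a h A q r₀ a₁)
    (hp : PertBounds κ R M χ g (tube W P χ g a h) ψ ρ) {u₀ : W 0 × ℝ}
    (hu : |u₀.2 - g 0| ≤ g 0 ^ 2) {x y : ∀ j, W j × Coupling}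
    (hx : ∀ j, x j ∈ tube W P χ g a h j) (hy : ∀ j, y j ∈ tube W P χ g a h j) {d : ℝ} (hd : 0 ≤ d)
    (hxy : ∀ j, x j - y j ∈ tubeBox W χ g (d * a) (d * h) j) (j : ℕ) :
    picard P g ψ ρ u₀ x j - picard P g ψ ρ u₀ y j
      ∈ tubeBox W χ g (q * d * a) (q * d * h) j := by
  have hcenter : ∀ {w : ∀ j, W j × Coupling}, (∀ j, w j ∈ tube W P χ g a h j) →
      InputDist h A χ g 1 (pertInput ρ u₀.2 w) (centerInput P g) := fun hw =>
    hE.inputDist_pertInput_center hc hcV.A_nonneg hp hu hw hc.r₀_le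
      (by simpa only [one_mul] using fun j => (hw j).2)
  refine ⟨?_, ?_⟩
  · cases j with
    | zero =>
      have ha := hc.a₁_nonneg.trans hc.a₁_le
      have hq := hc.q_nonneg
      have hcube := hE.cube_pos 0
      simp only [picard, picardK, Prod.fst_sub, sub_self, norm_zero]
      positivity
    | succ j =>
      rw [mul_comm q, mul_assoc d]
      exact hE.norm_psi_sub_le hc hp hd (hx j) (hy j) (hxy j)
  · rw [mul_comm q, mul_assoc d]
    exact hE.couplingPicard_sub_mem hcV (hcenter hx) (hcenter hy)
      (hE.inputDist_pertInput hc hcV.A_nonneg hp u₀.2 hd hx hy hxy) j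

theorem picard_mem_tube (hE : ReferenceFlow Ω B C lam₀ L D Z δ P χ g)
    (hcV : CouplingConst B C lam₀ L Z δ h A q) (hc : PicardConst Ω κ R M δ a h A q r₀ a₁)
    (hp : PertBounds κ R M χ g (tube W P χ g a h) ψ ρ) {u₀ : W 0 × ℝ}
    (huK : ‖u₀.1‖ ≤ a₁ * (χ 0 * g 0 ^ 3)) (hu : |u₀.2 - g 0| ≤ g 0 ^ 2)
    {x : ∀ j, W j × Coupling} (hx : ∀ j, x j ∈ tube W P χ g a₁ (r₀ * h) j) (j : ℕ) :
    picard P g ψ ρ u₀ x j ∈ tube W P χ g a₁ (r₀ * h) j := by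
  have hh := hcV.h_pos.le
  have hr₀h : r₀ * h ≤ h := mul_le_of_le_one_left hh hc.r₀_le
  have hxa : ∀ j, x j ∈ tube W P χ g a h j := fun j => hE.tube_mono hc.a₁_le hr₀h j (hx j)
  refine ⟨?_, ?_⟩
  · cases j with
    | zero => exact huK
    | succ j => exact hE.norm_psi_le hc hp (hE.tube_mono le_rfl hr₀h j (hx j))
  · have hmem := hE.couplingPicard_sub_mem hcV
      (hE.inputDist_pertInput_center hc hcV.A_nonneg hp hu hxa hc.r₀_le
        (by simpa only [one_mul] using fun j => (hxa j).2)) (hE.inputDist_center hcV)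
      (hE.inputDist_pertInput_center hc hcV.A_nonneg hp hu hxa le_rfl fun j => (hx j).2) j
    rw [hE.couplingPicard_center] at hmem
    exact hE.couplingBox_mono (mul_le_mul_of_nonneg_left
      (mul_le_of_le_one_left hh hc.q_lt_one.le) hc.r₀_nonneg) j hmem

theorem norm_le_of_mem_tubeBox (hE : ReferenceFlow Ω B C lam₀ L D Z δ P χ g) (ha : 0 ≤ a)
    (hh : 0 < h) (hhδ : h * δ ≤ 1) {d : ℝ} {j : ℕ} {p : W j × Coupling}
    (hp : p ∈ tubeBox W χ g (d * a) (d * h) j) : ‖p‖ ≤ (a + 1) * d := by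
  have hd : 0 ≤ d := nonneg_of_mul_nonneg_left (hE.radius_nonneg hp.2) hh
  have hda : 0 ≤ d * a := mul_nonneg hd ha
  have hcube : χ j * g j ^ 3 ≤ 1 := mul_le_one₀ (hE.weight.le_one j)
    (pow_nonneg (hE.coupling.pos j).le 3)
    (pow_le_one₀ (hE.coupling.pos j).le (hE.coupling.le_one j))
  have hlog : h * logWeight (g j) ≤ 1 :=
    (hE.mul_logWeight_le hh.le hhδ j).trans (hE.coupling.le_one j)
  refine max_le ?_ ?_
  · linarith [hp.1, mul_le_of_le_one_right hda hcube]
  · have hV := hE.norm_le_of_mem_couplingBox hp.2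
    rw [mul_assoc] at hV
    linarith [mul_le_of_le_one_right hd hlog]

theorem isGaugeContraction_picard (hE : ReferenceFlow Ω B C lam₀ L D Z δ P χ g)
    (hcV : CouplingConst B C lam₀ L Z δ h A q) (hc : PicardConst Ω κ R M δ a h A q r₀ a₁)
    (hp : PertBounds κ R M χ g (tube W P χ g a h) ψ ρ) {u₀ : W 0 × ℝ}
    (hu : |u₀.2 - g 0| ≤ g 0 ^ 2) :
    IsGaugeContraction (picard P g ψ ρ u₀) {x | ∀ j, x j ∈ tube W P χ g a h j}
      (fun d => {v | ∀ j, v j ∈ tubeBox W χ g (d * a) (d * h) j}) (a + 1) q 2 where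
  ratio_nonneg := hc.q_nonneg
  ratio_lt_one := hc.q_lt_one
  diam_nonneg := zero_le_two
  isClosed d := by
    rw [Set.ofPred_forall]
    exact isClosed_iInter fun j => (isClosed_tubeBox χ g _ _ j).preimage (continuous_apply j)
  norm_le _ _ hv j := hE.norm_le_of_mem_tubeBox (hc.a₁_nonneg.trans hc.a₁_le) hcV.h_pos
    hcV.h_mul_le (hv j)
  sub_mem _ hx _ hy j := tube_sub_mem (hx j) (hy j)
  map_sub_mem _ hx _ hy _ hd hxy := hE.picard_sub_mem hcV hc hp hu hx hy hd hxy

theorem exists_fixedPt_picard [∀ j, CompleteSpace (W j)]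
    (hE : ReferenceFlow Ω B C lam₀ L D Z δ P χ g)
    (hcV : CouplingConst B C lam₀ L Z δ h A q) (hc : PicardConst Ω κ R M δ a h A q r₀ a₁)
    (hp : PertBounds κ R M χ g (tube W P χ g a h) ψ ρ) {u₀ : W 0 × ℝ}
    (huK : ‖u₀.1‖ ≤ a₁ * (χ 0 * g 0 ^ 3)) (hu : |u₀.2 - g 0| ≤ g 0 ^ 2) :
    ∃ x : ∀ j, W j × Coupling, (∀ j, x j ∈ tube W P χ g a₁ (r₀ * h) j) ∧
      picard P g ψ ρ u₀ x = x ∧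
      (∀ y, (∀ j, y j ∈ tube W P χ g a h j) → picard P g ψ ρ u₀ y = y → y = x) ∧
      ∀ k j, ‖(picard P g ψ ρ u₀)^[k] (fun j => (0, barFlow P g j)) j - x j‖
        ≤ (a + 1) * (q ^ k * 2) := by
  have hclosed : IsClosed {x : ∀ j, W j × Coupling | ∀ j, x j ∈ tube W P χ g a₁ (r₀ * h) j} := by
    rw [Set.ofPred_forall]
    exact isClosed_iInter fun j => (isClosed_tube P χ g _ _ j).preimage (continuous_apply j)
  refine (hE.isGaugeContraction_picard hcV hc hp hu).exists_fixedPt (fun x hx j => ?_) hclosed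
    (fun x hx => hE.picard_mem_tube hcV hc hp huK hu hx) (fun j => ?_)
  · exact hE.tube_mono hc.a₁_le (mul_le_of_le_one_left hcV.h_pos.le hc.r₀_le) j (hx j)
  · exact hE.barFlow_mem_tube hc.a₁_nonneg (mul_nonneg hc.r₀_nonneg hcV.h_pos.le) j

end ReferenceFlow

end Picard

/-! ### Fixed points of the Picard map and flows -/

namespace ReferenceFlow

section Couplings

variable {Ω B C lam₀ L D Z δ h A q r : ℝ} {P : Coeffs} {χ g : ℕ → ℝ} {I : PicardInput}
  {V : ℕ → Coupling}

theorem tendsto_zero_of_sub_mem_couplingBox (hE : ReferenceFlow Ω B C lam₀ L D Z δ P χ g)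
    (hV : ∀ j, V j - barFlow P g j ∈ couplingBox χ g r j) :
    Tendsto (fun j => (V j).2.1) atTop (𝓝 0) ∧ Tendsto (fun j => (V j).2.2) atTop (𝓝 0) := by
  have hlim : ∀ w y : ℕ → ℝ, (∀ j, |y j| ≤ Z * (χ j * g j)) →
      (∀ j, |w j - y j| ≤ r * (χ j * logWeight (g j))) → Tendsto w atTop (𝓝 0) := by
    intro w y hy hw
    refine hE.coupling.tendsto_zero_of_abs_le (Z := r * δ + Z) fun j => ?_
    have hdev : r * (χ j * logWeight (g j)) ≤ r * (χ j * (δ * g j)) :=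
      mul_le_mul_of_nonneg_left
        (mul_le_mul_of_nonneg_left (hE.logWeight_le j) (hE.weight.pos j).le)
        (hE.radius_nonneg (hV 0))
    calc |w j| = |(w j - y j) + y j| := by rw [sub_add_cancel]
      _ ≤ |w j - y j| + |y j| := abs_add_le _ _
      _ ≤ r * (χ j * (δ * g j)) + Z * (χ j * g j) := add_le_add ((hw j).trans hdev) (hy j)
      _ = _ := by ring
  exact ⟨hlim _ _ hE.z_le fun j => (hV j).2.1, hlim _ _ hE.mu_le fun j => (hV j).2.2⟩

theorem lam_ne_zero (hE : ReferenceFlow Ω B C lam₀ L D Z δ P χ g) (j : ℕ) : P.lam j ≠ 0 :=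
  (one_pos.trans (hE.one_lt_lam.trans_le (hE.coeff.le_lam j))).ne'

theorem picardG_succ_of_eq (hE : ReferenceFlow Ω B C lam₀ L D Z δ P χ g) {j : ℕ}
    (hG : picardG P g I j = (I.arg j).1) :
    picardG P g I (j + 1) = (quadMap P j (I.arg j) + I.source j).1 := by
  rw [picardG, gRemainder, hG, hE.g_succ, Prod.fst_add, quadMap]
  ring

theorem zCoeff_mul_add_zSource {j : ℕ} (hG : picardG P g I j = (I.arg j).1) (w : ℝ) :
    zCoeff P g j * w + zSource P g I j
      = zCoeff P g j * (w - (I.arg j).2.1) + (quadMap P j (I.arg j) + I.source j).2.1 := by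
  simp only [zCoeff, zSource, hG, quadMap, Prod.fst_add, Prod.snd_add]
  ring

theorem picardZ_succ (hE : ReferenceFlow Ω B C lam₀ L D Z δ P χ g)
    (hc : CouplingConst B C lam₀ L Z δ h A q)
    (hI : InputDist h A χ g 1 I (centerInput P g)) (j : ℕ) :
    picardZ P g I (j + 1) = zCoeff P g j * picardZ P g I j + zSource P g I j :=
  backSum_succ (hE.half_le_prod.ne_zero j) (summable_backTerm (hE.sum_abs_zSourceTerm_le hc hI j))

theorem picardMu_eq_iff (hE : ReferenceFlow Ω B C lam₀ L D Z δ P χ g) {j : ℕ}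
    (hG : picardG P g I j = (I.arg j).1) (hZ : picardZ P g I j = (I.arg j).2.1) :
    picardMu P g I j = (I.arg j).2.2
      ↔ (I.arg (j + 1)).2.2 = (quadMap P j (I.arg j) + I.source j).2.2 := by
  rw [picardMu, hG, hZ, inv_mul_eq_iff_eq_mul₀ (hE.lam_ne_zero j), Prod.snd_add, Prod.snd_add,
    quadMap_mu, sub_eq_iff_eq_add, sub_eq_iff_eq_add, add_right_comm]

theorem arg_succ_of_couplingPicard_eq (hE : ReferenceFlow Ω B C lam₀ L D Z δ P χ g)
    (hc : CouplingConst B C lam₀ L Z δ h A q)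
    (hI : InputDist h A χ g 1 I (centerInput P g)) (hfix : couplingPicard P g I = I.arg) (j : ℕ) :
    I.arg (j + 1) = quadMap P j (I.arg j) + I.source j := by
  have hG : ∀ j, picardG P g I j = (I.arg j).1 := fun j => congrArg Prod.fst (congrFun hfix j)
  have hZ : ∀ j, picardZ P g I j = (I.arg j).2.1 := fun j =>
    congrArg (fun V : Coupling => V.2.1) (congrFun hfix j)
  have hMu : ∀ j, picardMu P g I j = (I.arg j).2.2 := fun j =>
    congrArg (fun V : Coupling => V.2.2) (congrFun hfix j)
  refine Prod.ext ?_ (Prod.ext ?_ ((hE.picardMu_eq_iff (hG j) (hZ j)).1 (hMu j)))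
  · rw [← hG, hE.picardG_succ_of_eq (hG j)]
  · rw [← hZ, hE.picardZ_succ hc hI, zCoeff_mul_add_zSource (hG j), hZ, sub_self, mul_zero,
      zero_add]

theorem couplingPicard_eq_of_arg_succ (hE : ReferenceFlow Ω B C lam₀ L D Z δ P χ g)
    (hc : CouplingConst B C lam₀ L Z δ h A q)
    (hI : InputDist h A χ g 1 I (centerInput P g)) (hinit : (I.arg 0).1 = I.init)
    (hstep : ∀ j, I.arg (j + 1) = quadMap P j (I.arg j) + I.source j) :
    couplingPicard P g I = I.arg := by
  have hG : ∀ j, picardG P g I j = (I.arg j).1 := by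
    intro j
    induction j with
    | zero => exact hinit.symm
    | succ j ih => rw [hE.picardG_succ_of_eq ih, ← hstep]
  have hZ : ∀ j, picardZ P g I j = (I.arg j).2.1 := fun j => sub_eq_zero.1 <| by
    have hpicard : ∀ j, couplingPicard P g I j - barFlow P g j
        ∈ couplingBox χ g (1 * (q * h)) j := by
      simpa only [hE.couplingPicard_center] using
        hE.couplingPicard_sub_mem hc hI (hE.inputDist_center hc) hI
    have hlim := (hE.tendsto_zero_of_sub_mem_couplingBox hpicard).1.sub
      (hE.tendsto_zero_of_sub_mem_couplingBox hI.arg).1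
    rw [sub_zero] at hlim
    refine eq_zero_of_recursion (a := zCoeff P g) (d := fun j => picardZ P g I j - (I.arg j).2.1)
      one_half_pos (fun j l => (hE.half_le_prod j l).trans (le_abs_self _)) (fun j => ?_) hlim j
    rw [hE.picardZ_succ hc hI, zCoeff_mul_add_zSource (hG j), ← hstep, add_sub_cancel_right]
  funext j
  refine Prod.ext (hG j) (Prod.ext (hZ j) ((hE.picardMu_eq_iff (hG j) (hZ j)).2 ?_))
  rw [← hstep]

end Couplings

variable {W : ℕ → Type*} [∀ j, NormedAddCommGroup (W j)]
  {Ω B C lam₀ L D Z δ : ℝ} {P : Coeffs} {χ g : ℕ → ℝ} {κ R M a h A q r₀ a₁ : ℝ}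
  {ψ : ∀ j, W j × Coupling → W (j + 1)} {ρ : ∀ j, W j × Coupling → Coupling}

theorem inputDist_of_mem_tube (hE : ReferenceFlow Ω B C lam₀ L D Z δ P χ g)
    (hc : PicardConst Ω κ R M δ a h A q r₀ a₁) (hA : 0 ≤ A)
    (hp : PertBounds κ R M χ g (tube W P χ g a h) ψ ρ) {u : ℝ} (hu : |u - g 0| ≤ g 0 ^ 2)
    {x : ∀ j, W j × Coupling} (hx : ∀ j, x j ∈ tube W P χ g a h j) :
    InputDist h A χ g 1 (pertInput ρ u x) (centerInput P g) :=
  hE.inputDist_pertInput_center hc hA hp hu hx hc.r₀_le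
    (by simpa only [one_mul] using fun j => (hx j).2)

theorem isGlobalFlow_iff (hE : ReferenceFlow Ω B C lam₀ L D Z δ P χ g)
    (hcV : CouplingConst B C lam₀ L Z δ h A q) (hc : PicardConst Ω κ R M δ a h A q r₀ a₁)
    (hp : PertBounds κ R M χ g (tube W P χ g a h) ψ ρ) {u₀ : W 0 × ℝ}
    (hu : |u₀.2 - g 0| ≤ g 0 ^ 2) {x : ∀ j, W j × Coupling}
    (hx : ∀ j, x j ∈ tube W P χ g a h j) :
    IsGlobalFlow P ψ ρ u₀ x ↔ picard P g ψ ρ u₀ x = x := by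
  have hI := hE.inputDist_of_mem_tube hc hcV.A_nonneg hp hu hx
  constructor
  · intro hflow
    have hV : couplingPicard P g (pertInput ρ u₀.2 x) = fun j => (x j).2 :=
      hE.couplingPicard_eq_of_arg_succ hcV hI hflow.init_g fun j =>
        congrArg Prod.snd (hflow.step j)
    funext j
    refine Prod.ext ?_ (congrFun hV j)
    cases j with
    | zero => exact hflow.init_K.symm
    | succ j => exact (congrArg Prod.fst (hflow.step j)).symm
  · intro hfix
    have hK : ∀ j, picardK ψ u₀.1 x j = (x j).1 := fun j => congrArg Prod.fst (congrFun hfix j)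
    have hV : couplingPicard P g (pertInput ρ u₀.2 x) = fun j => (x j).2 :=
      funext fun j => congrArg Prod.snd (congrFun hfix j)
    have hlim := hE.tendsto_zero_of_sub_mem_couplingBox fun j => (hx j).2
    exact ⟨(hK 0).symm, (congrArg Prod.fst (congrFun hV 0)).symm,
      fun j => Prod.ext (hK (j + 1)).symm (hE.arg_succ_of_couplingPicard_eq hcV hI hV j),
      hlim.1, hlim.2⟩

theorem exists_isGlobalFlow [∀ j, CompleteSpace (W j)]
    (hE : ReferenceFlow Ω B C lam₀ L D Z δ P χ g)
    (hcV : CouplingConst B C lam₀ L Z δ h A q) (hc : PicardConst Ω κ R M δ a h A q r₀ a₁)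
    (hp : PertBounds κ R M χ g (tube W P χ g a h) ψ ρ) {u₀ : W 0 × ℝ}
    (huK : ‖u₀.1‖ ≤ a₁ * (χ 0 * g 0 ^ 3)) (hu : |u₀.2 - g 0| ≤ g 0 ^ 2) :
    ∃ x : ∀ j, W j × Coupling, (∀ j, x j ∈ tube W P χ g a₁ (r₀ * h) j) ∧
      IsGlobalFlow P ψ ρ u₀ x ∧
      (∀ y, (∀ j, y j ∈ tube W P χ g a h j) → IsGlobalFlow P ψ ρ u₀ y → y = x) ∧
      ∀ k j, ‖(picard P g ψ ρ u₀)^[k] (fun j => (0, barFlow P g j)) j - x j‖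
        ≤ (a + 1) * (q ^ k * 2) := by
  obtain ⟨x, hx, hfix, huniq, hlim⟩ := hE.exists_fixedPt_picard hcV hc hp huK hu
  have hxa : ∀ j, x j ∈ tube W P χ g a h j := fun j =>
    hE.tube_mono hc.a₁_le (mul_le_of_le_one_left hcV.h_pos.le hc.r₀_le) j (hx j)
  exact ⟨x, hx, (hE.isGlobalFlow_iff hcV hc hp hu hxa).2 hfix,
    fun y hy hflow => huniq y hy ((hE.isGlobalFlow_iff hcV hc hp hu hy).1 hflow), hlim⟩

end ReferenceFlow

/-! ### Continuity in the parameters -/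

section Continuity

variable {X : Type*} [TopologicalSpace X]

theorem continuous_backSum_of_decay {a f : X → ℕ → ℝ} (ha : ∀ j, Continuous fun x => a x j)
    (hf : ∀ j, Continuous fun x => f x j) (hprod : ∀ x, HalfLeProd (a x)) {A : ℝ}
    (hA : ∀ x, ∀ l : ℕ, |f x l| ≤ A * (1 / ((l : ℝ) + 1) ^ 2)) (j : ℕ) :
    Continuous fun x => backSum (a x) (f x) j := by
  refine continuousOn_univ.1 <| continuousOn_backSum (fun j => (ha j).continuousOn)
    (fun j => (hf j).continuousOn) (fun x _ => (hprod x).ne_zero)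
    (((summable_nat_add_iff j).2 summable_one_div_succ_sq).mul_left (2 * A)) fun x _ l => ?_
  rw [add_comm l j, mul_assoc]
  exact ((hprod x).abs_backTerm_le _ j l).trans (mul_le_mul_of_nonneg_left (hA x _) zero_le_two)

theorem continuous_backSum_of_lt {a f : X → ℕ → ℝ} (ha : ∀ j, Continuous fun x => a x j)
    (hf : ∀ j, Continuous fun x => f x j) {q F : ℝ} (hq : 1 < q) (hqa : ∀ x j, q ≤ a x j)
    (hF : ∀ x j, |f x j| ≤ F) (j : ℕ) : Continuous fun x => backSum (a x) (f x) j := by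
  have hq₀ : 0 < q := one_pos.trans hq
  have hsum : Summable fun l : ℕ => q⁻¹ ^ (l + 1) * F :=
    ((summable_nat_add_iff 1).2 (summable_geometric_of_lt_one (inv_nonneg.2 hq₀.le)
      (inv_lt_one_of_one_lt₀ hq))).mul_right F
  refine continuousOn_univ.1 <| continuousOn_backSum (fun j => (ha j).continuousOn)
    (fun j => (hf j).continuousOn) (fun x _ j => (hq₀.trans_le (hqa x j)).ne') hsum fun x _ l => ?_
  refine (abs_backTerm_le_of_pow hq₀ (fun j => (hqa x j).trans (le_abs_self _)) _ j l).trans ?_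
  gcongr
  exact hF x _

variable {P : X → Coeffs}

theorem ContinuousCoeffs.comp (hP : ContinuousCoeffs P) {Y : Type*} [TopologicalSpace Y]
    {m : Y → X} (hm : Continuous m) : ContinuousCoeffs fun y => P (m y) where
  eta j := (hP.eta j).comp hm
  gamma j := (hP.gamma j).comp hm
  lam j := (hP.lam j).comp hm
  beta j := (hP.beta j).comp hm
  theta j := (hP.theta j).comp hm
  zeta j := (hP.zeta j).comp hm
  ups_gg j := (hP.ups_gg j).comp hm
  ups_gz j := (hP.ups_gz j).comp hm
  ups_gmu j := (hP.ups_gmu j).comp hm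
  ups_zz j := (hP.ups_zz j).comp hm
  ups_zmu j := (hP.ups_zmu j).comp hm

theorem continuous_muForcing (hP : ContinuousCoeffs P) {V : X → Coupling} (hV : Continuous V)
    (j : ℕ) : Continuous fun x => muForcing (P x) j (V x) := by
  obtain ⟨hη, hγ, -, -, -, -, hgg, hgz, hgμ, hzz, hzμ⟩ := hP
  have := hη j; have := hγ j; have := hgg j; have := hgz j; have := hgμ j; have := hzz j
  have := hzμ j
  unfold muForcing
  fun_prop

theorem continuous_quadMap (hP : ContinuousCoeffs P) {V : X → Coupling} (hV : Continuous V)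
    (j : ℕ) : Continuous fun x => quadMap (P x) j (V x) := by
  have hβ := hP.beta j
  have hθ := hP.theta j
  have hζ := hP.zeta j
  have hmu : Continuous fun x => (quadMap (P x) j (V x)).2.2 := by
    simp only [quadMap_mu]
    exact ((hP.lam j).mul hV.snd.snd).add (continuous_muForcing hP hV j)
  refine Continuous.prodMk ?_ (Continuous.prodMk ?_ hmu) <;> fun_prop

variable {g : X → ℕ → ℝ}

theorem continuous_picardG (hP : ContinuousCoeffs P) (hg : ∀ j, Continuous fun x => g x j)
    {I : X → PicardInput} (hinit : Continuous fun x => (I x).init)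
    (hsource : ∀ j, Continuous fun x => (I x).source j)
    (harg : ∀ j, Continuous fun x => (I x).arg j) (j : ℕ) :
    Continuous fun x => picardG (P x) (g x) (I x) j := by
  induction j with
  | zero => exact hinit
  | succ j ih =>
    have := hP.beta j; have := hg j; have := hg (j + 1); have := hsource j; have := harg j
    simp only [picardG, gRemainder]
    fun_prop

theorem continuous_couplingPicard (hP : ContinuousCoeffs P) (hg : ∀ j, Continuous fun x => g x j)
    {I : X → PicardInput} (hinit : Continuous fun x => (I x).init)
    (hsource : ∀ j, Continuous fun x => (I x).source j)
    (harg : ∀ j, Continuous fun x => (I x).arg j) (hlam : ∀ x j, (P x).lam j ≠ 0)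
    (hprod : ∀ x, HalfLeProd (zCoeff (P x) (g x))) {Q : ℝ}
    (hQ : ∀ x, ∀ l : ℕ, |zSource (P x) (g x) (I x) l| ≤ Q * (1 / ((l : ℝ) + 1) ^ 2)) (j : ℕ) :
    Continuous fun x => couplingPicard (P x) (g x) (I x) j := by
  have hG := continuous_picardG hP hg hinit hsource harg
  have hZ : ∀ j, Continuous fun x => picardZ (P x) (g x) (I x) j := by
    refine continuous_backSum_of_decay (fun j => ?_) (fun j => ?_) hprod hQ
    · exact continuous_const.sub ((hP.zeta j).mul (hg j))
    · have := hP.theta j; have := hP.zeta j; have := hg j; have := hsource j; have := harg j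
      have := hG j
      simp only [zSource]
      fun_prop
  refine (hG j).prodMk ((hZ j).prodMk ?_)
  exact ((hP.lam j).inv₀ fun x => hlam x j).mul
    (((harg (j + 1)).snd.snd.sub
      (continuous_muForcing hP ((hG j).prodMk ((hZ j).prodMk (harg j).snd.snd)) j)).sub
        (hsource j).snd.snd)

theorem continuous_barFlow (hP : ContinuousCoeffs P) (hg : ∀ j, Continuous fun x => g x j)
    (hprod : ∀ x, HalfLeProd (zCoeff (P x) (g x))) {Q : ℝ}
    (hQ : ∀ x, ∀ l : ℕ, |-((P x).theta l * g x l ^ 2)| ≤ Q * (1 / ((l : ℝ) + 1) ^ 2))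
    {q F : ℝ} (hq : 1 < q) (hqa : ∀ x j, q ≤ muCoeff (P x) (g x) (zBar (P x) (g x)) j)
    (hF : ∀ x j, |muSource (P x) (g x) (zBar (P x) (g x)) j| ≤ F) (j : ℕ) :
    Continuous fun x => barFlow (P x) (g x) j := by
  have hz : ∀ j, Continuous fun x => zBar (P x) (g x) j :=
    continuous_backSum_of_decay (fun j => continuous_const.sub ((hP.zeta j).mul (hg j)))
      (fun j => ((hP.theta j).mul ((hg j).pow 2)).neg) hprod hQ
  refine (hg j).prodMk ((hz j).prodMk (continuous_backSum_of_lt (fun j => ?_) (fun j => ?_) hq hqa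
    hF j))
  · exact ((hP.lam j).sub ((hP.ups_gmu j).mul (hg j))).sub ((hP.ups_zmu j).mul (hz j))
  · exact continuous_muForcing hP ((hg j).prodMk ((hz j).prodMk continuous_const)) j

end Continuity

/-! ### From the assumptions to the reference flow -/

theorem setOf_le_cutoffTime_beta_lt {Ω c : ℝ} (β : ℕ → ℝ) :
    {j : ℕ | (j : ℕ∞) ≤ cutoffTime Ω β ∧ 0 < c * chi Ω β j - β j}
      = {j : ℕ | (j : ℕ∞) ≤ cutoffTime Ω β ∧ β j < c} := by
  ext j
  refine and_congr_right fun hj => ?_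
  rw [chi_eq_one_of_le_cutoffTime hj, mul_one, sub_pos]

theorem AssumptionA1.betaBounds {Ω B c : ℝ} {P : Coeffs} (h : AssumptionA1 Ω B c P) (hΩ : 1 < Ω)
    (hc : 0 < c) :
    BetaBounds Ω |B| c ((c + |B|) * (c⁻¹ + (Ω - 1)⁻¹)) (chi Ω P.beta) P.beta := by
  have hβ := abs_beta_le_chi hΩ fun j => (h.beta_bdd j).trans (le_abs_self B)
  refine ⟨hc, cutoffWeight_chi hΩ P.beta, hβ,
    posPartSumLE_of_le_chi (β := P.beta) hΩ (by positivity) (fun j => ?_) ?_ ?_⟩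
  · linarith [neg_le_of_abs_le (hβ j)]
  · rw [setOf_le_cutoffTime_beta_lt]
    exact h.exceptional_finite
  · rw [setOf_le_cutoffTime_beta_lt]
    exact h.exceptional_card

theorem AssumptionA2.coeffBounds {Ω c lam₀ C : ℝ} {P : Coeffs} (h : AssumptionA2 Ω c lam₀ C P)
    (hΩ : 1 < Ω) : CoeffBounds |C| lam₀ (chi Ω P.beta) P := by
  have hC : ∀ j, C * chi Ω P.beta j ≤ |C| * chi Ω P.beta j := fun j =>
    mul_le_mul_of_nonneg_right (le_abs_self C) ((cutoffWeight_chi hΩ P.beta).pos j).le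
  exact ⟨h.le_lam, fun j => (h.eta_le j).trans (hC j), fun j => (h.gamma_le j).trans (hC j),
    fun j => (h.theta_le j).trans (hC j), fun j => (h.zeta_le j).trans (hC j),
    fun j => (h.ups_gg_le j).trans (hC j), fun j => (h.ups_gz_le j).trans (hC j),
    fun j => (h.ups_gmu_le j).trans (hC j), fun j => (h.ups_zz_le j).trans (hC j),
    fun j => (h.ups_zmu_le j).trans (hC j)⟩

theorem AssumptionA2.posPartSumLE_zeta {Ω c lam₀ C : ℝ} {P : Coeffs}
    (h : AssumptionA2 Ω c lam₀ C P) (hΩ : 1 < Ω) :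
    PosPartSumLE (|C| * (c⁻¹ + (Ω - 1)⁻¹)) P.zeta :=
  posPartSumLE_of_le_chi hΩ (abs_nonneg C)
    (fun j => le_of_abs_le ((h.coeffBounds hΩ).zeta_le j)) h.exceptional_finite h.exceptional_card

/-- The form in which (A1) and (A2) enter the analysis of the flow of `φ̄`: `S` and `S'` bound the
exceptional sets of indices, `A` the growth of `χ_l (l + 1)²`. -/
structure QuadMapBounds (Ω B c S S' A C lam₀ : ℝ) (χ : ℕ → ℝ) (P : Coeffs) : Prop where
  one_lt : 1 < Ω
  one_lt_lam : 1 < lam₀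
  beta : BetaBounds Ω B c S χ P.beta
  coeff : CoeffBounds C lam₀ χ P
  zeta : PosPartSumLE S' P.zeta
  chi_mul_sq_le : ∀ l : ℕ,
    χ l * ((l : ℝ) + 1) ^ 2 ≤ A * (1 + ∑ k ∈ Finset.range l, χ k) ^ 2

theorem exists_quadMapBounds {Ω c lam₀ : ℝ} (B C : ℝ) (hΩ : 1 < Ω) (hc : 0 < c) (hlam : 1 < lam₀) :
    ∃ S S' A : ℝ, ∀ P, AssumptionA1 Ω B c P → AssumptionA2 Ω c lam₀ C P →
      QuadMapBounds Ω |B| c S S' A |C| lam₀ (chi Ω P.beta) P := by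
  obtain ⟨A, hA⟩ := exists_chi_mul_sq_le hΩ
  exact ⟨_, _, A, fun P h1 h2 => ⟨hΩ, hlam, h1.betaBounds hΩ hc, h2.coeffBounds hΩ,
    h2.posPartSumLE_zeta hΩ, hA P.beta⟩⟩

theorem eventually_mul_le (k : ℝ) {e : ℝ} (he : 0 < e) : ∀ᶠ δ in 𝓝[>] (0 : ℝ), k * δ ≤ e := by
  have h : Tendsto (fun δ : ℝ => k * δ) (𝓝 0) (𝓝 0) := by
    simpa only [mul_zero] using (continuous_const_mul k).tendsto (0 : ℝ)
  exact (h.mono_left nhdsWithin_le_nhds).eventually_le_const he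

theorem exists_of_eventually_nhdsGT {p : ℝ → Prop} (h : ∀ᶠ t in 𝓝[>] (0 : ℝ), p t) :
    ∃ t₁, 0 < t₁ ∧ ∀ t, 0 < t → t ≤ t₁ → p t := by
  obtain ⟨t₁, ht₁, hsub⟩ := mem_nhdsGT_iff_exists_Ioc_subset.1 h
  exact ⟨t₁, ht₁, fun t ht htt => hsub ⟨ht, htt⟩⟩

theorem eventually_mul_log_sq_le {δ : ℝ} (hδ : 0 < δ) :
    ∀ᶠ t in 𝓝[>] (0 : ℝ), t * |Real.log t| ^ 2 ≤ δ := by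
  have hlim : Tendsto (fun t : ℝ => (Real.log t * t ^ (1 / 2 : ℝ)) ^ 2) (𝓝[>] 0) (𝓝 0) := by
    simpa only [ne_eq, OfNat.ofNat_ne_zero, not_false_eq_true, zero_pow]
      using (tendsto_log_mul_rpow_nhdsGT_zero (by norm_num : (0 : ℝ) < 1 / 2)).pow 2
  filter_upwards [hlim.eventually_le_const hδ, self_mem_nhdsWithin] with t ht ht0
  rwa [mul_pow, ← Real.sqrt_eq_rpow, Real.sq_sqrt (le_of_lt ht0), mul_comm, ← sq_abs] at ht

/-- The conditions on the initial coupling under which the flow of `φ̄` is well behaved on the scale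
`δ`; `S` and `S'` are the bounds of `QuadMapBounds` and `L` the bound of `CouplingBounds`. -/
structure IsSmallInitial (B S S' C L lam₀ δ g₀ : ℝ) : Prop extends IsSmallCoupling B S g₀ where
  mul_B_le_delta : 4 * B * g₀ ≤ δ
  mul_zeta_le : 4 * S' * g₀ ≤ 1
  mul_C_le : 4 * C * (1 + 2 * C * L) * g₀ ≤ lam₀ - 1
  log_le : ∀ t, 0 < t → t ≤ 2 * g₀ → Real.log t ≤ -1
  log_sq_le : ∀ t, 0 < t → t ≤ 2 * g₀ → t * |Real.log t| ^ 2 ≤ δ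

theorem exists_isSmallInitial (B S S' C L : ℝ) {lam₀ δ : ℝ} (hlam : 1 < lam₀) (hδ : 0 < δ) :
    ∃ g₁, 0 < g₁ ∧ ∀ g₀, 0 < g₀ → g₀ ≤ g₁ → IsSmallInitial B S S' C L lam₀ δ g₀ := by
  obtain ⟨t₁, ht₁, hlog⟩ := exists_of_eventually_nhdsGT
    ((Real.tendsto_log_nhdsGT_zero.eventually_le_atBot (-1)).and (eventually_mul_log_sq_le hδ))
  apply exists_of_eventually_nhdsGT
  filter_upwards [self_mem_nhdsWithin, eventually_mul_le (4 * B) one_pos,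
    eventually_mul_le (4 * S) one_pos, eventually_mul_le 8 one_pos, eventually_mul_le (4 * B) hδ,
    eventually_mul_le (4 * S') one_pos,
    eventually_mul_le (4 * C * (1 + 2 * C * L)) (sub_pos.2 hlam), eventually_mul_le 2 ht₁]
    with g₀ hpos hB hS h8 hBδ hS' hC h2
  exact ⟨⟨hpos, hB, hS, h8⟩, hBδ, hS', hC, fun t ht htg => (hlog t ht (htg.trans h2)).1,
    fun t ht htg => (hlog t ht (htg.trans h2)).2⟩

theorem coupling_step_bounds {t b δ : ℝ} (ht : 0 < t) (hδ1 : δ ≤ 1) (hb : |b * t| ≤ δ / 2) :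
    t - b * t ^ 2 ≤ (1 + δ) * t ∧ t ≤ (1 + δ) * (t - b * t ^ 2) := by
  obtain ⟨h1, h2⟩ := abs_le.1 hb
  have hstep : t - b * t ^ 2 = t * (1 - b * t) := by ring
  have hfactor : 1 ≤ (1 + δ) * (1 - b * t) := by nlinarith
  rw [hstep]
  constructor <;> nlinarith

theorem abs_log_le_of_le_mul {s t δ : ℝ} (hs : 0 < s) (hs1 : s ≤ 1) (ht : 0 < t)
    (hlog : Real.log t ≤ -1) (hδ : 0 ≤ δ) (hts : t ≤ (1 + δ) * s) :
    |Real.log s| ≤ (1 + δ) * |Real.log t| := by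
  have hts' : Real.log t ≤ δ + Real.log s := by
    calc Real.log t ≤ Real.log ((1 + δ) * s) := Real.log_le_log ht hts
      _ = Real.log (1 + δ) + Real.log s := Real.log_mul (by positivity) hs.ne'
      _ ≤ δ + Real.log s := by
        linarith [Real.log_le_sub_one_of_pos (by positivity : 0 < 1 + δ)]
  rw [abs_of_nonpos (Real.log_nonpos hs.le hs1), abs_of_nonpos (by linarith)]
  nlinarith

/-- The constant `L` of `CouplingBounds` for the sequence `ḡ`. -/
def sumConst (Ω c : ℝ) : ℝ := 3 * c⁻¹ + (1 - Ω⁻¹)⁻¹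

/-- The constant `A` of `CouplingBounds` for the sequence `ḡ`. -/
def decayConst (c A : ℝ) : ℝ := A / (min 1 c) ^ 2

/-- A bound on `z̄ / (χ ḡ)` and `μ̄ / (χ ḡ)`. -/
def sizeConst (C L lam₀ : ℝ) : ℝ := 2 * C * L + 44 * C * (1 + 2 * C * L) ^ 2 / (lam₀ - 1)

namespace QuadMapBounds

section

variable {Ω B c S S' A C lam₀ δ g₀ : ℝ} {χ : ℕ → ℝ} {P : Coeffs}

theorem couplingBounds (hQ : QuadMapBounds Ω B c S S' A C lam₀ χ P) (hg : IsSmallCoupling B S g₀) :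
    CouplingBounds (sumConst Ω c) (decayConst c A) χ (gSeq P.beta g₀) where
  chi_pos := hQ.beta.weight.pos
  chi_le_one := hQ.beta.weight.le_one
  chi_antitone := hQ.beta.weight.antitone
  pos j := (hQ.beta.gSeq_bounds hg j).1
  le_one j := by linarith [(hQ.beta.gSeq_bounds hg j).2, hg.le]
  quasi_antitone := hQ.beta.gSeq_quasi_antitone hg
  sum_sq_le := hQ.beta.sum_chi_gSeq_sq_le hQ.one_lt hg
  decay l := hQ.beta.chi_gSeq_sq_decay hg (hQ.chi_mul_sq_le l)

variable (hQ : QuadMapBounds Ω B c S S' A C lam₀ χ P)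
  (hg : IsSmallInitial B S S' C (sumConst Ω c) lam₀ δ g₀)
include hQ hg

theorem halfLeProd : HalfLeProd (zCoeff P (gSeq P.beta g₀)) :=
  halfLeProd_one_sub_mul hQ.zeta (fun j => (hQ.beta.gSeq_bounds hg.1 j).1)
    (fun j => (hQ.beta.gSeq_bounds hg.1 j).2) (by linarith [hg.mul_zeta_le])

theorem abs_zBar_le (j : ℕ) :
    |zBar P (gSeq P.beta g₀) j| ≤ 2 * C * sumConst Ω c * (χ j * gSeq P.beta g₀ j) :=
  QuadFlow.abs_zBar_le hQ.coeff (hQ.couplingBounds hg.1) (hQ.halfLeProd hg) j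

theorem coeff_mul_gSeq_le (j : ℕ) :
    2 * C * (1 + 2 * C * sumConst Ω c) * gSeq P.beta g₀ j ≤ lam₀ - 1 := by
  have hC := (hQ.couplingBounds hg.1).coeff_nonneg hQ.coeff
  have hL := (hQ.couplingBounds hg.1).mass_nonneg
  calc 2 * C * (1 + 2 * C * sumConst Ω c) * gSeq P.beta g₀ j
      ≤ 2 * C * (1 + 2 * C * sumConst Ω c) * (2 * g₀) := by
        gcongr
        exact (hQ.beta.gSeq_bounds hg.1 j).2
    _ = 4 * C * (1 + 2 * C * sumConst Ω c) * g₀ := by ring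
    _ ≤ lam₀ - 1 := hg.mul_C_le

theorem le_muCoeff (j : ℕ) :
    (1 + lam₀) / 2 ≤ muCoeff P (gSeq P.beta g₀) (zBar P (gSeq P.beta g₀)) j :=
  QuadFlow.le_muCoeff hQ.coeff (hQ.couplingBounds hg.1) (hQ.abs_zBar_le hg)
    (hQ.coeff_mul_gSeq_le hg) j

theorem abs_muSource_le (j : ℕ) :
    |muSource P (gSeq P.beta g₀) (zBar P (gSeq P.beta g₀)) j|
      ≤ 11 * C * (1 + 2 * C * sumConst Ω c) ^ 2 := by
  have hG := hQ.couplingBounds hg.1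
  have hC := hG.coeff_nonneg hQ.coeff
  refine (QuadFlow.abs_muSource_le hQ.coeff hG (hQ.abs_zBar_le hg) j).trans
    (mul_le_of_le_one_right (by positivity) ?_)
  exact mul_le_one₀ (hG.chi_le_one j) (hG.pos j).le (hG.le_one j)

theorem isQuadFlow : IsQuadFlow P g₀ (barFlow P (gSeq P.beta g₀)) :=
  isQuadFlow_barFlow hQ.coeff (hQ.couplingBounds hg.1) hQ.one_lt_lam (hQ.halfLeProd hg)
    (hQ.coeff_mul_gSeq_le hg)

theorem eq_barFlow {V : ℕ → Coupling} (hV : IsQuadFlow P g₀ V) :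
    V = barFlow P (gSeq P.beta g₀) :=
  (hQ.isQuadFlow hg).eq hV (hQ.halfLeProd hg) fun j =>
    (by linarith [hQ.one_lt_lam] : 1 ≤ (1 + lam₀) / 2).trans
      ((hQ.le_muCoeff hg j).trans (le_abs_self _))

theorem existsUnique_isQuadFlow : ∃! V, IsQuadFlow P g₀ V :=
  ⟨_, hQ.isQuadFlow hg, fun _ => hQ.eq_barFlow hg⟩

theorem quadFlow_eq : quadFlow P g₀ = barFlow P (gSeq P.beta g₀) :=
  hQ.eq_barFlow hg (Classical.epsilon_spec ⟨_, hQ.isQuadFlow hg⟩)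

theorem log_gSeq_le (j : ℕ) : Real.log (gSeq P.beta g₀ j) ≤ -1 :=
  hg.log_le _ (hQ.beta.gSeq_bounds hg.1 j).1 (hQ.beta.gSeq_bounds hg.1 j).2

theorem abs_log_gSeq (j : ℕ) : |Real.log (gSeq P.beta g₀ j)| = -Real.log (gSeq P.beta g₀ j) :=
  abs_of_nonpos (by linarith [hQ.log_gSeq_le hg j])

theorem gSeq_step_bounds (hδ1 : δ ≤ 1) (j : ℕ) :
    gSeq P.beta g₀ (j + 1) ≤ (1 + δ) * gSeq P.beta g₀ j ∧
      gSeq P.beta g₀ j ≤ (1 + δ) * gSeq P.beta g₀ (j + 1) := by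
  obtain ⟨hpos, hle⟩ := hQ.beta.gSeq_bounds hg.1 j
  refine coupling_step_bounds hpos hδ1 ?_
  have hβ : |P.beta j| ≤ B := (hQ.beta.abs_beta_le j).trans <|
    mul_le_of_le_one_right ((abs_nonneg _).trans ((hQ.beta.abs_beta_le 0).trans_eq (by
      rw [hQ.beta.weight.zero, mul_one]))) (hQ.beta.weight.le_one j)
  calc |P.beta j * gSeq P.beta g₀ j| = |P.beta j| * gSeq P.beta g₀ j := by
        rw [abs_mul, abs_of_pos hpos]
    _ ≤ B * (2 * g₀) := mul_le_mul hβ hle hpos.le ((abs_nonneg _).trans hβ)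
    _ ≤ δ / 2 := by linarith [hg.mul_B_le_delta]

theorem sum_chi_gSeq_le (j : ℕ) :
    ∑ k ∈ Finset.range j, χ k * gSeq P.beta g₀ k
      ≤ sumConst Ω c * |Real.log (gSeq P.beta g₀ j)| := by
  have hc := inv_pos.2 hQ.beta.c_pos
  have hΩ := inv_pos.2 (sub_pos.2 (inv_lt_one_of_one_lt₀ hQ.one_lt))
  calc _ ≤ c⁻¹ * -Real.log (gSeq P.beta g₀ j) :=
        hQ.beta.sum_chi_gSeq_le hg.1 (hQ.log_gSeq_le hg 0) j
    _ ≤ sumConst Ω c * |Real.log (gSeq P.beta g₀ j)| := by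
        rw [← hQ.abs_log_gSeq hg]
        refine mul_le_mul_of_nonneg_right ?_ (abs_nonneg _)
        rw [sumConst]
        linarith

theorem referenceFlow (hδ1 : δ ≤ 1) :
    ReferenceFlow Ω B C lam₀ (sumConst Ω c) (decayConst c A) (sizeConst C (sumConst Ω c) lam₀) δ
      P χ (gSeq P.beta g₀) := by
  have hG := hQ.couplingBounds hg.1
  have hC := hG.coeff_nonneg hQ.coeff
  have hL := hG.mass_nonneg
  have hlam := sub_pos.2 hQ.one_lt_lam
  have hχg : ∀ j, 0 ≤ χ j * gSeq P.beta g₀ j := fun j => mul_nonneg (hG.chi_pos j).le (hG.pos j).le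
  have hδ : 0 ≤ δ := (mul_nonneg (hG.pos 0).le (sq_nonneg _)).trans
    (hg.log_sq_le _ (hG.pos 0) (hQ.beta.gSeq_bounds hg.1 0).2)
  exact
    { weight := hQ.beta.weight
      beta_le := hQ.beta.abs_beta_le
      coeff := hQ.coeff
      one_lt_lam := hQ.one_lt_lam
      coupling := hG
      step := (hQ.isQuadFlow hg).step
      z_le := fun j => (hQ.abs_zBar_le hg j).trans
        (mul_le_mul_of_nonneg_right (le_add_of_nonneg_right (by positivity)) (hχg j))
      mu_le := fun j => (abs_muBar_le hQ.coeff hG hQ.one_lt_lam (hQ.abs_zBar_le hg)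
        (hQ.coeff_mul_gSeq_le hg) j).trans
          (mul_le_mul_of_nonneg_right (le_add_of_nonneg_left (by positivity)) (hχg j))
      half_le_prod := hQ.halfLeProd hg
      sum_le_log := hQ.sum_chi_gSeq_le hg
      one_le_log := fun j => by rw [hQ.abs_log_gSeq hg]; linarith [hQ.log_gSeq_le hg j]
      log_sq_le := fun j => hg.log_sq_le _ (hG.pos j) (hQ.beta.gSeq_bounds hg.1 j).2
      delta_le_one := hδ1
      succ_le := fun j => (hQ.gSeq_step_bounds hg hδ1 j).1
      le_succ := fun j => (hQ.gSeq_step_bounds hg hδ1 j).2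
      log_succ_le := fun j => abs_log_le_of_le_mul (hG.pos _) (hG.le_one _) (hG.pos j)
        (hQ.log_gSeq_le hg j) hδ (hQ.gSeq_step_bounds hg hδ1 j).2 }

end

/-- The bounds are uniform in the external parameter `m`, so `V̄` depends continuously on it. -/
theorem continuous_barFlow {X : Type*} [TopologicalSpace X] {Ω B c S S' A C lam₀ δ : ℝ}
    {P : X → Coeffs} {χ : X → ℕ → ℝ}
    {g₀ : ℝ} (hQ : ∀ m, QuadMapBounds Ω B c S S' A C lam₀ (χ m) (P m)) (hlam : 1 < lam₀)
    (hC : 0 ≤ C) (hg : IsSmallInitial B S S' C (sumConst Ω c) lam₀ δ g₀)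
    (hP : ContinuousCoeffs P) (j : ℕ) :
    Continuous fun m => barFlow (P m) (gSeq (P m).beta g₀) j := by
  refine QuadFlow.continuous_barFlow hP (continuous_gSeq hP.beta g₀)
    (fun m => (hQ m).halfLeProd hg) (Q := C * decayConst c A) (fun m l => ?_)
    (by linarith : 1 < (1 + lam₀) / 2) (fun m => (hQ m).le_muCoeff hg)
    (fun m => (hQ m).abs_muSource_le hg) j
  calc _ ≤ C * (χ m l * gSeq (P m).beta g₀ l ^ 2) := abs_zForcing_le (hQ m).coeff l
    _ ≤ C * (decayConst c A * (1 / ((l : ℝ) + 1) ^ 2)) :=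
        mul_le_mul_of_nonneg_left (((hQ m).couplingBounds hg.1).decay l) hC
    _ = C * decayConst c A * (1 / ((l : ℝ) + 1) ^ 2) := by ring

end QuadMapBounds

/-! ### Lipschitz bounds on the perturbation -/

theorem norm_sub_le_of_derivK_le_of_derivV_le {A F : Type*} [NormedAddCommGroup A]
    [NormedSpace ℝ A] [NormedAddCommGroup F] [NormedSpace ℝ F] {f : A × Coupling → F} {s : Set A}
    {t : Set Coupling} (hs : Convex ℝ s) (ht : Convex ℝ t) (hf : DifferentiableOn ℝ f (s ×ˢ t))
    {cK cV : ℝ} (hK : ∀ x ∈ s ×ˢ t, ‖derivK f (s ×ˢ t) x‖ ≤ cK)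
    (hV : ∀ x ∈ s ×ˢ t, ‖derivV f (s ×ˢ t) x‖ ≤ cV) {p p' : A × Coupling}
    (hp : p ∈ s ×ˢ t) (hp' : p' ∈ s ×ˢ t) :
    ‖f p - f p'‖ ≤ cK * ‖p.1 - p'.1‖ + cV * ‖p.2 - p'.2‖ := by
  have hstepK : ‖f (p.1, p.2) - f (p'.1, p.2)‖ ≤ cK * ‖p.1 - p'.1‖ :=
    hs.norm_image_sub_le_of_norm_hasFDerivWithin_le (f := fun k => f (k, p.2))
      (f' := fun k => derivK f (s ×ˢ t) (k, p.2))
      (fun k hk => (hf (k, p.2) ⟨hk, hp.2⟩).hasFDerivWithinAt.comp k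
        (hasFDerivAt_prodMk_left k p.2).hasFDerivWithinAt fun _ hk' => Set.mk_mem_prod hk' hp.2)
      (fun k hk => hK _ ⟨hk, hp.2⟩) hp'.1 hp.1
  have hstepV : ‖f (p'.1, p.2) - f (p'.1, p'.2)‖ ≤ cV * ‖p.2 - p'.2‖ :=
    ht.norm_image_sub_le_of_norm_hasFDerivWithin_le (f := fun v => f (p'.1, v))
      (f' := fun v => derivV f (s ×ˢ t) (p'.1, v))
      (fun v hv => (hf (p'.1, v) ⟨hp'.1, hv⟩).hasFDerivWithinAt.comp v
        (hasFDerivAt_prodMk_right p'.1 v).hasFDerivWithinAt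
        fun _ hv' => Set.mk_mem_prod hp'.1 hv')
      (fun v hv => hV _ ⟨hp'.1, hv⟩) hp'.2 hp.2
  calc ‖f p - f p'‖ = ‖(f (p.1, p.2) - f (p'.1, p.2)) + (f (p'.1, p.2) - f (p'.1, p'.2))‖ := by
        rw [sub_add_sub_cancel]
    _ ≤ _ := (norm_add_le _ _).trans (add_le_add hstepK hstepV)

section Domain

variable {W : ℕ → Type*} [∀ j, NormedAddCommGroup (W j)]

theorem gbar_eq {g₀ : ℝ} {P : Coeffs} {g : ℕ → ℝ} (hq : quadFlow P g₀ = barFlow P g) :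
    gbar P g₀ = g := by
  funext j
  rw [gbar, hq, barFlow]

theorem domain_eq_tube {Ω g₀ : ℝ} {P : Coeffs} {g : ℕ → ℝ}
    (hq : quadFlow P g₀ = barFlow P g) (a h : ℝ) :
    domain W Ω a h g₀ P = tube W P (chi Ω P.beta) g a h := by
  funext j
  simp only [domain, tube, couplingBox, gbar, hq, barFlow, logWeight, mul_assoc]
  rfl

theorem convex_couplingBox (χ g : ℕ → ℝ) (r : ℝ) (j : ℕ) : Convex ℝ (couplingBox χ g r j) := by
  have hbox : couplingBox χ g r j = Metric.closedBall 0 (r * logWeight (g j)) ×ˢ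
      Metric.closedBall 0 (r * (χ j * logWeight (g j))) ×ˢ
        Metric.closedBall 0 (r * (χ j * logWeight (g j))) := by
    ext v
    simp only [couplingBox, Set.mem_ofPred_eq, Set.mem_prod, mem_closedBall_zero_iff,
      Real.norm_eq_abs]
  rw [hbox]
  exact (convex_closedBall _ _).prod ((convex_closedBall _ _).prod (convex_closedBall _ _))

theorem domain_eq_prod (Ω a h g₀ : ℝ) (P : Coeffs) (j : ℕ) :
    domain W Ω a h g₀ P j = Metric.closedBall 0 (a * (chi Ω P.beta j * gbar P g₀ j ^ 3)) ×ˢ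
      ((fun v => -quadFlow P g₀ j + v) ⁻¹' couplingBox (chi Ω P.beta) (gbar P g₀) h j) := by
  ext p
  simp only [domain, couplingBox, logWeight, Set.mem_ofPred_eq, Set.mem_prod,
    mem_closedBall_zero_iff, Set.mem_preimage, neg_add_eq_sub, Prod.fst_sub, Prod.snd_sub, gbar,
    mul_assoc]

variable [∀ j, NormedSpace ℝ (W j)] {Ω a h κ R M g₀ : ℝ} {P : Coeffs}

theorem norm_sub_le_on_domain {j : ℕ} {F : Type*} [NormedAddCommGroup F] [NormedSpace ℝ F]
    {f : W j × Coupling → F} (hf : DifferentiableOn ℝ f (domain W Ω a h g₀ P j)) {cK cV : ℝ}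
    (hK : ∀ x ∈ domain W Ω a h g₀ P j, ‖derivK f (domain W Ω a h g₀ P j) x‖ ≤ cK)
    (hV : ∀ x ∈ domain W Ω a h g₀ P j, ‖derivV f (domain W Ω a h g₀ P j) x‖ ≤ cV)
    {p p' : W j × Coupling} (hp : p ∈ domain W Ω a h g₀ P j) (hp' : p' ∈ domain W Ω a h g₀ P j) :
    ‖f p - f p'‖ ≤ cK * ‖p.1 - p'.1‖ + cV * ‖p.2 - p'.2‖ := by
  rw [domain_eq_prod] at hf hK hV hp hp'
  exact norm_sub_le_of_derivK_le_of_derivV_le (convex_closedBall _ _)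
    ((convex_couplingBox _ _ h j).translate_preimage_right _) hf hK hV hp hp'

theorem AssumptionA3.pertBounds {ψ : ∀ j, W j × Coupling → W (j + 1)}
    {ρ : ∀ j, W j × Coupling → Coupling} (h3 : AssumptionA3 Ω a h κ R M g₀ P ψ ρ) :
    PertBounds κ R M (chi Ω P.beta) (gbar P g₀) (domain W Ω a h g₀ P) ψ ρ where
  psi_zero_le := h3.psi_le
  psi_lip j _ hp _ hp' := norm_sub_le_on_domain
    ((h3.psi_contDiff j).differentiableOn (by norm_num)) (h3.derivK_psi_le j) (h3.derivV_psi_le j)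
    hp hp'
  rho_le := h3.rho_le
  rho_lip j _ hp _ hp' := norm_sub_le_on_domain
    ((h3.rho_contDiff j).differentiableOn (by norm_num)) (h3.derivK_rho_le j) (h3.derivV_rho_le j)
    hp hp'

end Domain

/-! ### The constants -/

theorem exists_ratio {k lam₀ : ℝ} (hk : k < 1) (hlam : 1 < lam₀) :
    ∃ q, q < 1 ∧ (1 + k) / 2 ≤ q ∧ (lam₀ + 1) / 2 ≤ lam₀ * q := by
  have hlam0 : 0 < lam₀ := one_pos.trans hlam
  refine ⟨max ((1 + k) / 2) ((1 + lam₀⁻¹) / 2), max_lt (by linarith) ?_, le_max_left _ _, ?_⟩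
  · linarith [inv_lt_one_of_one_lt₀ hlam]
  · calc (lam₀ + 1) / 2 = lam₀ * ((1 + lam₀⁻¹) / 2) := by field_simp
      _ ≤ _ := mul_le_mul_of_nonneg_left (le_max_right _ _) hlam0.le

theorem exists_sourceConst {r₀ M a : ℝ} (hr₀ : 0 < r₀) (hM : 0 ≤ M) (ha : 0 ≤ a) :
    ∃ A, 0 < A ∧ 8 * M + 1 ≤ r₀ * A ∧ M * (a + 1) ≤ A := by
  have hquot : 0 < (8 * M + 1) / r₀ := by positivity
  have hprod : 0 ≤ M * (a + 1) := by positivity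
  refine ⟨(8 * M + 1) / r₀ + M * (a + 1), by positivity, ?_, le_add_of_nonneg_left hquot.le⟩
  rw [mul_add, mul_div_cancel₀ _ hr₀.ne']
  exact le_add_of_nonneg_right (mul_nonneg hr₀.le hprod)

theorem exists_couplingConst (B : ℝ) {C lam₀ L Z A q : ℝ} (hC : 0 ≤ C) (hlam : 1 < lam₀)
    (hL : 0 ≤ L) (hZ : 0 ≤ Z) (hA : 0 < A) (hq : 1 / 2 ≤ q) (hq1 : q ≤ 1)
    (hlamq : (lam₀ + 1) / 2 ≤ lam₀ * q) :
    ∃ hStar, 0 < hStar ∧ ∀ h, hStar ≤ h →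
      ∀ᶠ δ in 𝓝[>] 0, CouplingConst B C lam₀ L Z δ h A q := by
  have hG : 0 ≤ gConst L A := by unfold gConst; positivity
  have hZc : 0 ≤ zConst C L Z A := by unfold zConst; positivity
  have hgap : 0 < lam₀ - 1 := sub_pos.2 hlam
  set T := C * (gConst L A + zConst C L Z A) + A
  have hTgap : 0 ≤ 4 * T / (lam₀ - 1) := by positivity
  refine ⟨1 + 2 * gConst L A + 2 * zConst C L Z A + 4 * T / (lam₀ - 1), by positivity,
    fun h hh => ?_⟩
  have hh0 : 0 < h := by linarith
  have hTh : T ≤ (lam₀ - 1) / 4 * h := by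
    have hTle : 4 * T / (lam₀ - 1) ≤ h := by linarith
    rw [div_le_iff₀ hgap] at hTle
    linarith
  have hqh : 1 / 2 * h ≤ q * h := mul_le_mul_of_nonneg_right hq hh0.le
  have hlamqh := mul_le_mul_of_nonneg_right hlamq hh0.le
  filter_upwards [eventually_mul_le h one_pos,
    eventually_mul_le (B ^ 2 * h + 2 * B * h ^ 2) hA,
    eventually_mul_le (7 + 10 * C * (Z + 2)) (show 0 < (lam₀ - 1) / 4 by linarith)]
    with δ hhδ hgδ hmuδ
  have hmuδh := mul_le_mul_of_nonneg_right hmuδ hh0.le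
  exact
    { h_pos := hh0
      A_nonneg := hA.le
      q_le_one := hq1
      h_mul_le := hhδ
      g_cond := hgδ
      gConst_le := by linarith
      zConst_le := by linarith
      mu_cond := by linarith }

theorem eventually_picardConst {Ω κ R M a A q r₀ a₁ : ℝ} (h : ℝ) (hκ : 0 ≤ κ) (hM : 0 ≤ M)
    (hκΩ : κ * Ω < 1) (ha : 0 < a) (ha₁ : 0 ≤ a₁) (ha₁a : a₁ ≤ a) (hRa₁ : R < a₁ * (1 - κ * Ω))
    (hq0 : 0 ≤ q) (hq1 : q < 1) (hq : (1 + κ * Ω) / 2 ≤ q) (hr₀ : 0 ≤ r₀) (hr₀1 : r₀ ≤ 1)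
    (hrA : 8 * M + 1 ≤ r₀ * A) (hMA : M * (a + 1) ≤ A) :
    ∀ᶠ δ in 𝓝[>] 0, PicardConst Ω κ R M δ a h A q r₀ a₁ := by
  have hqa := mul_le_mul_of_nonneg_right hq ha.le
  filter_upwards [eventually_mul_le (7 * (κ * Ω) * a + 2 * M * h)
      (show 0 < (1 - κ * Ω) / 2 * a from mul_pos (by linarith) ha),
    eventually_mul_le (4 * h) one_pos,
    eventually_mul_le (7 * (κ * Ω) * a₁) (sub_pos.2 hRa₁)] with δ hKδ hlipδ hselfδ
  exact
    { κ_nonneg := hκ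
      M_nonneg := hM
      q_nonneg := hq0
      q_lt_one := hq1
      r₀_nonneg := hr₀
      r₀_le := hr₀1
      a₁_nonneg := ha₁
      a₁_le := ha₁a
      K_cond := by linarith
      lip_le := (mul_le_mul_of_nonneg_left (by linarith) hM).trans hMA
      rho_le := by linarith
      one_le := by linarith
      K_self := by linarith }

/-- The radius, between `aStar` and `a`, of the `K`-component of the tube that contains both the
flow and the approximate flow. -/
def midRadius (a aStar b : ℝ) : ℝ := aStar + (1 - b) * (a - aStar) / 4

theorem lt_midRadius {a aStar b : ℝ} (haa : aStar < a) (hb1 : b < 1) :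
    aStar < midRadius a aStar b :=
  lt_add_of_pos_right _ (div_pos (mul_pos (sub_pos.2 hb1) (sub_pos.2 haa)) four_pos)

theorem midRadius_le {a aStar b : ℝ} (haa : aStar ≤ a) (hb : 0 ≤ b) : midRadius a aStar b ≤ a := by
  have hprod : 0 ≤ b * (a - aStar) := mul_nonneg hb (sub_nonneg.2 haa)
  unfold midRadius
  linarith

/-- The smallness conditions under which the flow exists, is close to the approximate flow, and is
unique among the sequences satisfying `FlowBounds`. -/
structure FlowConst (Ω B C lam₀ L Z κ R M a aStar h b A q r₀ δ : ℝ) : Prop where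
  coupling : CouplingConst B C lam₀ L Z δ h A q
  picard : PicardConst Ω κ R M δ a h A q r₀ (midRadius a aStar b)
  b_nonneg : 0 ≤ b
  aStar_le : aStar ≤ a
  h_mul_le : h * δ ≤ (1 - b) / 10
  r₀_le_b : r₀ ≤ b / 4
  r₀_le : r₀ ≤ (1 - b) / 4
  K_close : κ * Ω * (1 + 7 * δ) * (b * (a - aStar) / 2) + 4 * M * h * δ ≤ b * (a - aStar) / 2

theorem exists_flowConst (B : ℝ) {Ω C lam₀ L Z κ R M a aStar b : ℝ} (hΩ : 0 < Ω) (hC : 0 ≤ C)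
    (hlam : 1 < lam₀) (hL : 0 ≤ L) (hZ : 0 ≤ Z) (hκ : 0 ≤ κ) (hκΩ : κ < Ω⁻¹) (hR : 0 ≤ R)
    (hM : 0 ≤ M) (haStar : R / (1 - κ * Ω) < aStar) (haa : aStar < a) (hb : 0 < b) (hb1 : b < 1) :
    ∃ A q r₀ hStar, 0 < hStar ∧ ∀ h, hStar ≤ h → ∃ δ, 0 < δ ∧ δ ≤ 1 ∧
      FlowConst Ω B C lam₀ L Z κ R M a aStar h b A q r₀ δ := by
  have hκ1 : κ * Ω < 1 := by rwa [← lt_inv_mul_iff₀' hΩ, mul_one]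
  have haStar0 : 0 < aStar := (div_nonneg hR (sub_pos.2 hκ1).le).trans_lt haStar
  have ha₁ : aStar < midRadius a aStar b := lt_midRadius haa hb1
  have hRa₁ : R < midRadius a aStar b * (1 - κ * Ω) :=
    (div_lt_iff₀ (sub_pos.2 hκ1)).1 (haStar.trans ha₁)
  set r₀ := min b (1 - b) / 4
  have hr₀pos : 0 < r₀ := div_pos (lt_min hb (sub_pos.2 hb1)) four_pos
  have hrb : r₀ ≤ b / 4 := div_le_div_of_nonneg_right (min_le_left _ _) four_pos.le
  have hrb' : r₀ ≤ (1 - b) / 4 := div_le_div_of_nonneg_right (min_le_right _ _) four_pos.le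
  obtain ⟨A, hA, hrA, hMA⟩ := exists_sourceConst hr₀pos hM (haStar0.trans haa).le
  obtain ⟨q, hq1, hq, hlamq⟩ := exists_ratio hκ1 hlam
  have hq2 : 1 / 2 ≤ q := by linarith [mul_nonneg hκ hΩ.le]
  obtain ⟨hStar, hpos, hcoupling⟩ := exists_couplingConst B hC hlam hL hZ hA hq2 hq1.le hlamq
  refine ⟨A, q, r₀, hStar, hpos, fun h hh => ?_⟩
  have hX : 0 < b * (a - aStar) / 2 := half_pos (mul_pos hb (sub_pos.2 haa))
  have hpicard := eventually_picardConst h hκ hM hκ1 (haStar0.trans haa) (haStar0.trans ha₁).le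
    (midRadius_le haa.le hb.le) hRa₁ (one_half_pos.le.trans hq2) hq1 hq hr₀pos.le (by linarith)
    hrA hMA
  have hsmall := (eventually_mul_le h (show 0 < (1 - b) / 10 by linarith)).and
    (eventually_mul_le (7 * (κ * Ω) * (b * (a - aStar) / 2) + 4 * M * h)
      (mul_pos (sub_pos.2 hκ1) hX))
  obtain ⟨δ, ⟨⟨⟨⟨hc, hp⟩, hhδ, hKδ⟩, hδ1⟩, hδ⟩⟩ := ((((hcoupling h hh).and hpicard).and
    hsmall).and (eventually_mul_le 1 one_pos)).and self_mem_nhdsWithin |>.exists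
  exact ⟨δ, hδ, by linarith, hc, hp, hb.le, haa.le, hhδ, hrb, hrb', by linarith⟩

/-! ### Comparison with the approximate flow -/

section Comparison

variable {s t η : ℝ}

theorem pos_of_abs_sub_le (hs : 0 < s) (hη : η < 1) (ht : |t - s| ≤ η * s) : 0 < t := by
  have hpos : 0 < (1 - η) * s := mul_pos (sub_pos.2 hη) hs
  linarith [(abs_le.1 ht).1]

theorem abs_log_sub_log_le (hs : 0 < s) (hη : η ≤ 1 / 10) (ht : |t - s| ≤ η * s) :
    |Real.log t - Real.log s| ≤ 2 * η := by
  have ht0 : 0 < t := pos_of_abs_sub_le hs (by linarith) ht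
  have hη0 : 0 ≤ η := nonneg_of_mul_nonneg_left ((abs_nonneg _).trans ht) hs
  obtain ⟨hlo, hhi⟩ := abs_le.1 ht
  have hup : Real.log t - Real.log s ≤ t / s - 1 := by
    rw [← Real.log_div ht0.ne' hs.ne']
    exact Real.log_le_sub_one_of_pos (div_pos ht0 hs)
  have hdown : Real.log s - Real.log t ≤ s / t - 1 := by
    rw [← Real.log_div hs.ne' ht0.ne']
    exact Real.log_le_sub_one_of_pos (div_pos hs ht0)
  have hts : t / s - 1 ≤ 2 * η := by
    rw [div_sub_one hs.ne', div_le_iff₀ hs]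
    linarith [mul_nonneg hη0 hs.le]
  have hst : s / t - 1 ≤ 2 * η := by
    rw [div_sub_one ht0.ne', div_le_iff₀ ht0]
    nlinarith [mul_nonneg hη0 hs.le]
  exact abs_sub_le_iff.2 ⟨hup.trans hts, hdown.trans hst⟩

theorem abs_log_le_mul (hs : 0 < s) (hlog : 1 ≤ |Real.log s|) (hη : η ≤ 1 / 10)
    (ht : |t - s| ≤ η * s) : |Real.log t| ≤ (1 + 2 * η) * |Real.log s| := by
  have hη0 : 0 ≤ η := nonneg_of_mul_nonneg_left ((abs_nonneg _).trans ht) hs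
  linarith [abs_sub_abs_le_abs_sub (Real.log t) (Real.log s), abs_log_sub_log_le hs hη ht,
    mul_le_mul_of_nonneg_left hlog (mul_nonneg two_pos.le hη0)]

theorem mul_abs_log_le_abs_log (hs : 0 < s) (hlog : 1 ≤ |Real.log s|) (hη : η ≤ 1 / 10)
    (ht : |t - s| ≤ η * s) : (1 - 2 * η) * |Real.log s| ≤ |Real.log t| := by
  have hη0 : 0 ≤ η := nonneg_of_mul_nonneg_left ((abs_nonneg _).trans ht) hs
  linarith [abs_sub_abs_le_abs_sub (Real.log s) (Real.log t), abs_log_sub_log_le hs hη ht,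
    abs_sub_comm (Real.log s) (Real.log t),
    mul_le_mul_of_nonneg_left hlog (mul_nonneg two_pos.le hη0)]

theorem logWeight_le_mul_logWeight (hs : 0 < s) (hlog : 1 ≤ |Real.log s|) (hη : η ≤ 1 / 10)
    (ht : |t - s| ≤ η * s) : logWeight t ≤ (1 + 5 * η) * logWeight s := by
  have ht0 : 0 < t := pos_of_abs_sub_le hs (by linarith) ht
  have hη0 : 0 ≤ η := nonneg_of_mul_nonneg_left ((abs_nonneg _).trans ht) hs
  have hts : t ≤ (1 + η) * s := by linarith [(abs_le.1 ht).2]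
  calc t ^ 2 * |Real.log t| ≤ ((1 + η) * s) ^ 2 * ((1 + 2 * η) * |Real.log s|) := by
        gcongr
        exact abs_log_le_mul hs hlog hη ht
    _ = (1 + η) ^ 2 * (1 + 2 * η) * (s ^ 2 * |Real.log s|) := by ring
    _ ≤ (1 + 5 * η) * (s ^ 2 * |Real.log s|) := by
        gcongr
        nlinarith [mul_nonneg hη0 hη0]

theorem logWeight_le_two_mul_logWeight (hs : 0 < s) (hlog : 1 ≤ |Real.log s|) (hη : η ≤ 1 / 10)
    (ht : |t - s| ≤ η * s) : logWeight s ≤ 2 * logWeight t := by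
  have hst : 9 / 10 * s ≤ t := by
    linarith [(abs_le.1 ht).1, mul_le_mul_of_nonneg_right hη hs.le]
  have hloglog : 8 / 10 * |Real.log s| ≤ |Real.log t| :=
    (mul_le_mul_of_nonneg_right (by linarith) (abs_nonneg _)).trans
      (mul_abs_log_le_abs_log hs hlog hη ht)
  calc s ^ 2 * |Real.log s| ≤ 2 * ((9 / 10 * s) ^ 2 * (8 / 10 * |Real.log s|)) := by
        nlinarith [mul_nonneg (sq_nonneg s) (abs_nonneg (Real.log s))]
    _ ≤ 2 * (t ^ 2 * |Real.log t|) := by gcongr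

theorem pow_three_le_mul_pow_three (hs : 0 < s) (hη : η ≤ 1 / 10) (ht : |t - s| ≤ η * s) :
    t ^ 3 ≤ (1 + 5 * η) * s ^ 3 := by
  have ht0 : 0 < t := pos_of_abs_sub_le hs (by linarith) ht
  have hη0 : 0 ≤ η := nonneg_of_mul_nonneg_left ((abs_nonneg _).trans ht) hs
  have hts : t ≤ (1 + η) * s := by linarith [(abs_le.1 ht).2]
  calc t ^ 3 ≤ ((1 + η) * s) ^ 3 := by gcongr
    _ = (1 + η) ^ 3 * s ^ 3 := mul_pow _ _ _
    _ ≤ (1 + 5 * η) * s ^ 3 := by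
        gcongr
        nlinarith [mul_nonneg hη0 hη0]

theorem pow_three_le_two_mul_pow_three (hs : 0 < s) (hη : η ≤ 1 / 10) (ht : |t - s| ≤ η * s) :
    s ^ 3 ≤ 2 * t ^ 3 := by
  have hst : 9 / 10 * s ≤ t := by
    linarith [(abs_le.1 ht).1, mul_le_mul_of_nonneg_right hη hs.le]
  calc s ^ 3 ≤ 2 * (9 / 10 * s) ^ 3 := by nlinarith [pow_pos hs 3]
    _ ≤ 2 * t ^ 3 := by gcongr

end Comparison

section Boxes

variable {W : ℕ → Type*} [∀ j, NormedAddCommGroup (W j)] {P : Coeffs} {χ g γ : ℕ → ℝ}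
  {a h a' h' c : ℝ} {j : ℕ}

theorem couplingBox_subset (hχ : 0 ≤ χ j) (hh : 0 ≤ h)
    (hw : logWeight (g j) ≤ c * logWeight (γ j)) :
    couplingBox χ g h j ⊆ couplingBox χ γ (c * h) j := by
  have hhw : h * logWeight (g j) ≤ c * h * logWeight (γ j) :=
    (mul_le_mul_of_nonneg_left hw hh).trans_eq (by ring)
  have hχhw : h * (χ j * logWeight (g j)) ≤ c * h * (χ j * logWeight (γ j)) :=
    (mul_le_mul_of_nonneg_left (mul_le_mul_of_nonneg_left hw hχ) hh).trans_eq (by ring)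
  exact fun v hv => ⟨hv.1.trans hhw, hv.2.1.trans hχhw, hv.2.2.trans hχhw⟩

theorem tubeBox_subset (hχ : 0 ≤ χ j) (ha : 0 ≤ a) (hh : 0 ≤ h) (hg : g j ^ 3 ≤ c * γ j ^ 3)
    (hw : logWeight (g j) ≤ c * logWeight (γ j)) :
    tubeBox W χ g a h j ⊆ tubeBox W χ γ (c * a) (c * h) j := fun _ hp =>
  ⟨hp.1.trans ((mul_le_mul_of_nonneg_left (mul_le_mul_of_nonneg_left hg hχ) ha).trans_eq (by ring)),
    couplingBox_subset hχ hh hw hp.2⟩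

theorem couplingBox_add_mem {r s : ℝ} {v w : Coupling} (hv : v ∈ couplingBox χ g r j)
    (hw : w ∈ couplingBox χ g s j) : v + w ∈ couplingBox χ g (r + s) j := by
  simp only [couplingBox, Set.mem_ofPred_eq, add_mul]
  exact ⟨(abs_add_le _ _).trans (add_le_add hv.1 hw.1),
    (abs_add_le _ _).trans (add_le_add hv.2.1 hw.2.1),
    (abs_add_le _ _).trans (add_le_add hv.2.2 hw.2.2)⟩

theorem mem_tube_of_sub_mem {p p' : W j × Coupling} (hpp : p - p' ∈ tubeBox W χ g a' h' j)
    (hp' : p' ∈ tube W P χ g a h j) : p ∈ tube W P χ g (a' + a) (h' + h) j := by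
  constructor
  · calc ‖p.1‖ = ‖(p - p').1 + p'.1‖ := by rw [Prod.fst_sub, sub_add_cancel]
      _ ≤ a' * (χ j * g j ^ 3) + a * (χ j * g j ^ 3) :=
        (norm_add_le _ _).trans (add_le_add hpp.1 hp'.1)
      _ = _ := (add_mul _ _ _).symm
  · have hadd := couplingBox_add_mem hpp.2 hp'.2
    rwa [Prod.snd_sub, sub_add_sub_cancel] at hadd

theorem flowBounds_iff {Ω aStar b : ℝ} {ψ : ∀ j, W j × Coupling → W (j + 1)} {u₀ : W 0 × ℝ}
    {x : ∀ j, W j × Coupling} :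
    FlowBounds Ω a aStar h b P ψ u₀ x ↔ ∀ j, x j - approxFlow P ψ u₀ j ∈
      tubeBox W (chi Ω P.beta) (gbar P u₀.2) (b * (a - aStar)) (b * h) j := by
  simp only [tubeBox, couplingBox, logWeight, Set.mem_ofPred_eq, ← mul_assoc (chi _ _ _)]
  exact ⟨fun hx j => ⟨hx.K_le j, hx.g_le j, hx.z_le j, hx.mu_le j⟩, fun hx =>
    ⟨fun j => (hx j).1, fun j => (hx j).2.1, fun j => (hx j).2.2.1, fun j => (hx j).2.2.2⟩⟩

end Boxes

theorem approxFlow_eq {W : ℕ → Type*} {P : Coeffs} {ψ : ∀ j, W j × Coupling → W (j + 1)}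
    {u₀ : W 0 × ℝ} {x : ∀ j, W j × Coupling} (huniq : ∃! V, IsQuadFlow P u₀.2 V)
    (hx : IsGlobalFlow P ψ (fun _ _ => 0) u₀ x) : approxFlow P ψ u₀ = x := by
  have hV : IsQuadFlow P u₀.2 fun j => (x j).2 :=
    { init := hx.init_g
      step := fun j => (congrArg Prod.snd (hx.step j)).trans (add_zero _)
      z_lim := hx.z_lim
      mu_lim := hx.mu_lim }
  have hq : quadFlow P u₀.2 = fun j => (x j).2 :=
    huniq.unique (Classical.epsilon_spec huniq.exists) hV
  have hK : ∀ j, approxK ψ (quadFlow P u₀.2) u₀.1 j = (x j).1 := by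
    intro j
    induction j with
    | zero => exact hx.init_K.symm
    | succ j ih => rw [approxK, ih, hx.step j, hq]; rfl
  exact funext fun j => Prod.ext (hK j) (congrFun hq j)

section ApproxFlow

variable {W : ℕ → Type*} [∀ j, NormedAddCommGroup (W j)]

theorem PertBounds.zero {κ R M : ℝ} {χ g : ℕ → ℝ} {D : ∀ j, Set (W j × Coupling)}
    {ψ : ∀ j, W j × Coupling → W (j + 1)} {ρ : ∀ j, W j × Coupling → Coupling}
    (hp : PertBounds κ R M χ g D ψ ρ) : PertBounds κ R M χ g D ψ fun _ _ => 0 where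
  psi_zero_le := hp.psi_zero_le
  psi_lip := hp.psi_lip
  rho_le j p hpD := norm_zero.trans_le ((norm_nonneg _).trans (hp.rho_le j p hpD))
  rho_lip j p hpD p' hpD' := by
    rw [sub_self, norm_zero]
    exact (norm_nonneg _).trans (hp.rho_lip j p hpD p' hpD')

namespace ReferenceFlow

variable {Ω B C lam₀ L D Z δ : ℝ} {P : Coeffs} {κ R M a aStar h b A q r₀ : ℝ}
  {ψ : ∀ j, W j × Coupling → W (j + 1)} {ρ : ∀ j, W j × Coupling → Coupling} {u₀ : W 0 × ℝ}
  {x y : ∀ j, W j × Coupling}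

section Weight

variable {χ g : ℕ → ℝ}

theorem abs_fst_sub_le_of_mem_tube (hE : ReferenceFlow Ω B C lam₀ L D Z δ P χ g) {j : ℕ}
    {p : W j × Coupling} (hp : p ∈ tube W P χ g a h j) : |p.2.1 - g j| ≤ h * δ * g j :=
  calc |p.2.1 - g j| ≤ h * logWeight (g j) := hp.2.1
    _ ≤ h * (δ * g j) :=
      mul_le_mul_of_nonneg_left (hE.logWeight_le j) (hE.radius_nonneg hp.2)
    _ = h * δ * g j := (mul_assoc _ _ _).symm

theorem norm_fst_sub_le (hE : ReferenceFlow Ω B C lam₀ L D Z δ P χ g) (hκ : 0 ≤ κ) (hM : 0 ≤ M)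
    (hp : PertBounds κ R M χ g (tube W P χ g a h) ψ ρ) {X : ℝ} (hX : 0 ≤ X)
    (hXle : κ * Ω * (1 + 7 * δ) * X + 4 * M * h * δ ≤ X) (hx : ∀ j, x j ∈ tube W P χ g a h j)
    (hy : ∀ j, y j ∈ tube W P χ g a h j) (hinit : (x 0).1 = (y 0).1)
    (hxs : ∀ j, (x (j + 1)).1 = ψ j (x j)) (hys : ∀ j, (y (j + 1)).1 = ψ j (y j)) (j : ℕ) :
    ‖(x j).1 - (y j).1‖ ≤ X * (χ j * g j ^ 3) := by
  induction j with
  | zero =>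
    rw [hinit, sub_self, norm_zero]
    exact mul_nonneg hX (hE.cube_pos 0).le
  | succ j ih =>
    rw [hxs, hys]
    refine (hE.norm_psi_sub_le_of_mem_couplingBox hκ hM hp (hx j) (hy j) ih
      (tube_sub_mem (hx j) (hy j)).2).trans (mul_le_mul_of_nonneg_right ?_ (hE.cube_pos _).le)
    linarith

end Weight

variable {g : ℕ → ℝ}

theorem flowBounds_of_mem_tube (hE : ReferenceFlow Ω B C lam₀ L D Z δ P (chi Ω P.beta) g)
    (hF : FlowConst Ω B C lam₀ L Z κ R M a aStar h b A q r₀ δ)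
    (hp : PertBounds κ R M (chi Ω P.beta) g (tube W P (chi Ω P.beta) g a h) ψ ρ)
    (happrox : ∀ j, approxFlow P ψ u₀ j ∈
      tube W P (chi Ω P.beta) g (midRadius a aStar b) (r₀ * h) j)
    (hx : ∀ j, x j ∈ tube W P (chi Ω P.beta) g (midRadius a aStar b) (r₀ * h) j)
    (hflow : IsGlobalFlow P ψ ρ u₀ x) : FlowBounds Ω a aStar h b P ψ u₀ x := by
  have hh := hF.coupling.h_pos
  have hb := hF.b_nonneg
  have hsub : ∀ j, tube W P (chi Ω P.beta) g (midRadius a aStar b) (r₀ * h) j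
      ⊆ tube W P (chi Ω P.beta) g a h j :=
    hE.tube_mono hF.picard.a₁_le (mul_le_of_le_one_left hh.le hF.picard.r₀_le)
  have hX : 0 ≤ b * (a - aStar) / 2 :=
    div_nonneg (mul_nonneg hb (sub_nonneg.2 hF.aStar_le)) two_pos.le
  have hr₀h : 2 * (r₀ * h) ≤ b * h / 2 := by
    linarith [mul_le_mul_of_nonneg_right hF.r₀_le_b hh.le]
  have hη : h * δ ≤ 1 / 10 := hF.h_mul_le.trans (by linarith)
  refine flowBounds_iff.2 fun j => ?_
  have hmem : x j - approxFlow P ψ u₀ j ∈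
      tubeBox W (chi Ω P.beta) g (b * (a - aStar) / 2) (b * h / 2) j :=
    ⟨hE.norm_fst_sub_le hF.picard.κ_nonneg hF.picard.M_nonneg hp hX hF.K_close
        (fun j => hsub j (hx j)) (fun j => hsub j (happrox j)) hflow.init_K
        (fun j => congrArg Prod.fst (hflow.step j)) (fun _ => rfl) j,
      hE.couplingBox_mono hr₀h j (tube_sub_mem (hx j) (happrox j)).2⟩
  have hγ : |gbar P u₀.2 j - g j| ≤ h * δ * g j :=
    hE.abs_fst_sub_le_of_mem_tube (hsub j (happrox j))
  have hdouble := tubeBox_subset (hE.weight.pos j).le hX (by positivity)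
    (pow_three_le_two_mul_pow_three (hE.coupling.pos j) hη hγ)
    (logWeight_le_two_mul_logWeight (hE.coupling.pos j) (hE.one_le_log j) hη hγ) hmem
  rwa [two_mul, add_halves, two_mul, add_halves] at hdouble

theorem mem_tube_of_flowBounds (hE : ReferenceFlow Ω B C lam₀ L D Z δ P (chi Ω P.beta) g)
    (hF : FlowConst Ω B C lam₀ L Z κ R M a aStar h b A q r₀ δ)
    (happrox : ∀ j, approxFlow P ψ u₀ j ∈
      tube W P (chi Ω P.beta) g (midRadius a aStar b) (r₀ * h) j)
    (hx : FlowBounds Ω a aStar h b P ψ u₀ x) (j : ℕ) :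
    x j ∈ tube W P (chi Ω P.beta) g a h j := by
  have hh := hF.coupling.h_pos
  have hb := hF.b_nonneg
  have hX : 0 ≤ b * (a - aStar) := mul_nonneg hb (sub_nonneg.2 hF.aStar_le)
  have hη : h * δ ≤ 1 / 10 := hF.h_mul_le.trans (by linarith)
  have hη0 : 0 ≤ h * δ := mul_nonneg hh.le hE.delta_pos.le
  have hb1 : b ≤ 1 := by linarith [hF.h_mul_le]
  have hratio : (1 + 5 * (h * δ)) * b + (1 - b) / 4 ≤ 1 := by
    nlinarith [hF.h_mul_le]
  have hγ : |gbar P u₀.2 j - g j| ≤ h * δ * g j := hE.abs_fst_sub_le_of_mem_tube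
    (hE.tube_mono le_rfl (mul_le_of_le_one_left hh.le hF.picard.r₀_le) j (happrox j))
  have hbox := tubeBox_subset (hE.weight.pos j).le hX (by positivity)
    (pow_three_le_mul_pow_three (hE.coupling.pos j) hη hγ)
    (logWeight_le_mul_logWeight (hE.coupling.pos j) (hE.one_le_log j) hη hγ)
    (flowBounds_iff.1 hx j)
  refine hE.tube_mono ?_ ?_ j (mem_tube_of_sub_mem hbox (happrox j))
  · have hgap := mul_le_mul_of_nonneg_right hratio (sub_nonneg.2 hF.aStar_le)
    unfold midRadius
    linarith
  · have hsum : (1 + 5 * (h * δ)) * b + r₀ ≤ 1 := by linarith [hF.r₀_le]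
    calc (1 + 5 * (h * δ)) * (b * h) + r₀ * h = ((1 + 5 * (h * δ)) * b + r₀) * h := by ring
      _ ≤ h := mul_le_of_le_one_left hh.le hsum

theorem exists_flow [∀ j, CompleteSpace (W j)]
    (hE : ReferenceFlow Ω B C lam₀ L D Z δ P (chi Ω P.beta) g)
    (hF : FlowConst Ω B C lam₀ L Z κ R M a aStar h b A q r₀ δ)
    (hp : PertBounds κ R M (chi Ω P.beta) g (tube W P (chi Ω P.beta) g a h) ψ ρ)
    (huniq : ∃! V, IsQuadFlow P u₀.2 V)
    (huK : ‖u₀.1‖ ≤ midRadius a aStar b * (chi Ω P.beta 0 * g 0 ^ 3))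
    (hu : |u₀.2 - g 0| ≤ g 0 ^ 2) :
    (∀ j, approxFlow P ψ u₀ j ∈ tube W P (chi Ω P.beta) g a h j) ∧
      ∃ x : ∀ j, W j × Coupling, (∀ j, x j ∈ tube W P (chi Ω P.beta) g a h j) ∧
        IsGlobalFlow P ψ ρ u₀ x ∧ FlowBounds Ω a aStar h b P ψ u₀ x ∧
        (∀ y, IsGlobalFlow P ψ ρ u₀ y → FlowBounds Ω a aStar h b P ψ u₀ y → y = x) ∧
        ∀ k j, ‖(picard P g ψ ρ u₀)^[k] (fun j => (0, barFlow P g j)) j - x j‖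
          ≤ (a + 1) * (q ^ k * 2) := by
  obtain ⟨xBar, hxBar, hxBarFlow, -⟩ :=
    hE.exists_isGlobalFlow hF.coupling hF.picard hp.zero huK hu
  obtain ⟨x, hx, hflow, hunique, hlim⟩ :=
    hE.exists_isGlobalFlow hF.coupling hF.picard hp huK hu
  rw [← approxFlow_eq huniq hxBarFlow] at hxBar
  have hsub := hE.tube_mono (W := W) hF.picard.a₁_le
    (mul_le_of_le_one_left hF.coupling.h_pos.le hF.picard.r₀_le)
  exact ⟨fun j => hsub j (hxBar j), x, fun j => hsub j (hx j), hflow,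
    hE.flowBounds_of_mem_tube hF hp hxBar hx hflow,
    fun y hy hyb => hunique y (hE.mem_tube_of_flowBounds hF hxBar hyb) hy, hlim⟩

end ReferenceFlow

end ApproxFlow

section Continuity

variable {W : ℕ → Type*} [∀ j, NormedAddCommGroup (W j)] {Ω B C lam₀ L D Z δ : ℝ}
  {κ R M a h A q r₀ a₁ : ℝ}

theorem ReferenceFlow.iterate_picard_mem_tube {P : Coeffs} {χ g : ℕ → ℝ}
    {ψ : ∀ j, W j × Coupling → W (j + 1)} {ρ : ∀ j, W j × Coupling → Coupling}
    (hE : ReferenceFlow Ω B C lam₀ L D Z δ P χ g)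
    (hcV : CouplingConst B C lam₀ L Z δ h A q) (hc : PicardConst Ω κ R M δ a h A q r₀ a₁)
    (hp : PertBounds κ R M χ g (tube W P χ g a h) ψ ρ) {u₀ : W 0 × ℝ}
    (huK : ‖u₀.1‖ ≤ a₁ * (χ 0 * g 0 ^ 3)) (hu : |u₀.2 - g 0| ≤ g 0 ^ 2) (k j : ℕ) :
    (picard P g ψ ρ u₀)^[k] (fun j => (0, barFlow P g j)) j ∈ tube W P χ g a₁ (r₀ * h) j := by
  induction k generalizing j with
  | zero => exact hE.barFlow_mem_tube hc.a₁_nonneg (mul_nonneg hc.r₀_nonneg hcV.h_pos.le) j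
  | succ k ih =>
    rw [Function.iterate_succ_apply']
    exact hE.picard_mem_tube hcV hc hp huK hu ih j

variable {X : Type*} [TopologicalSpace X] {P : X → Coeffs} {χ g : X → ℕ → ℝ}
  {ψ : X → ∀ j, W j × Coupling → W (j + 1)} {ρ : X → ∀ j, W j × Coupling → Coupling}
  {u : X → W 0 × ℝ} {x : X → ∀ j, W j × Coupling}

theorem continuous_picard (hP : ContinuousCoeffs P) (hg : ∀ j, Continuous fun p => g p j)
    (hE : ∀ p, ReferenceFlow Ω B C lam₀ L D Z δ (P p) (χ p) (g p))
    (hcV : CouplingConst B C lam₀ L Z δ h A q) (hc : PicardConst Ω κ R M δ a h A q r₀ a₁)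
    (hp : ∀ p, PertBounds κ R M (χ p) (g p) (tube W (P p) (χ p) (g p) a h) (ψ p) (ρ p))
    (hu : Continuous u) (hug : ∀ p, |(u p).2 - g p 0| ≤ g p 0 ^ 2)
    (hx : ∀ j, Continuous fun p => x p j)
    (hxD : ∀ p j, x p j ∈ tube W (P p) (χ p) (g p) a h j)
    (hev : ∀ j, Continuous fun p => evolution (P p) (ψ p) (ρ p) j (x p j)) (j : ℕ) :
    Continuous fun p => picard (P p) (g p) (ψ p) (ρ p) (u p) (x p) j := by
  have hK : Continuous fun p => picardK (ψ p) (u p).1 (x p) j := by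
    cases j with
    | zero => exact hu.fst
    | succ j => exact (hev j).fst
  have hρ : ∀ j, Continuous fun p => ρ p j (x p j) := fun j =>
    ((hev j).snd.sub (continuous_quadMap hP (hx j).snd j)).congr fun p => add_sub_cancel_left _ _
  refine hK.prodMk (continuous_couplingPicard hP hg hu.snd hρ (fun j => (hx j).snd)
    (fun p => (hE p).lam_ne_zero) (fun p => (hE p).half_le_prod)
    (Q := (C + (C * gConst L A * (3 * Z + 7) + A)) * D) (fun p l => ?_) j)
  have hsource := (hE p).abs_zSource_le hcV
    ((hE p).inputDist_of_mem_tube hc hcV.A_nonneg (hp p) (hug p) (hxD p)) l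
  have hQ : 0 ≤ C + (C * gConst L A * (3 * Z + 7) + A) :=
    nonneg_of_mul_nonneg_left ((abs_nonneg _).trans hsource)
      (mul_pos ((hE p).weight.pos l) (pow_pos ((hE p).coupling.pos l) 2))
  rw [mul_assoc]
  exact hsource.trans (mul_le_mul_of_nonneg_left ((hE p).coupling.decay l) hQ)

theorem continuous_iterate_picard (hP : ContinuousCoeffs P)
    (hbar : ∀ j, Continuous fun p => barFlow (P p) (g p) j)
    (hE : ∀ p, ReferenceFlow Ω B C lam₀ L D Z δ (P p) (χ p) (g p))
    (hcV : CouplingConst B C lam₀ L Z δ h A q) (hc : PicardConst Ω κ R M δ a h A q r₀ a₁)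
    (hp : ∀ p, PertBounds κ R M (χ p) (g p) (tube W (P p) (χ p) (g p) a h) (ψ p) (ρ p))
    (hu : Continuous u) (huK : ∀ p, ‖(u p).1‖ ≤ a₁ * (χ p 0 * g p 0 ^ 3))
    (hug : ∀ p, |(u p).2 - g p 0| ≤ g p 0 ^ 2)
    (hcont : ∀ (j : ℕ) (y : X → W j × Coupling), Continuous y →
      (∀ p, y p ∈ tube W (P p) (χ p) (g p) a h j) →
      Continuous fun p => evolution (P p) (ψ p) (ρ p) j (y p)) (k j : ℕ) :
    Continuous fun p =>
      (picard (P p) (g p) (ψ p) (ρ p) (u p))^[k] (fun j => (0, barFlow (P p) (g p) j)) j := by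
  induction k generalizing j with
  | zero => exact continuous_const.prodMk (hbar j)
  | succ k ih =>
    have hmem : ∀ p j, (picard (P p) (g p) (ψ p) (ρ p) (u p))^[k]
        (fun j => (0, barFlow (P p) (g p) j)) j ∈ tube W (P p) (χ p) (g p) a h j := fun p j =>
      (hE p).tube_mono hc.a₁_le (mul_le_of_le_one_left hcV.h_pos.le hc.r₀_le) j
        ((hE p).iterate_picard_mem_tube hcV hc (hp p) (huK p) (hug p) k j)
    simp only [Function.iterate_succ_apply']
    exact continuous_picard hP (fun j => (hbar j).fst) hE hcV hc hp hu hug ih hmem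
      (fun j => hcont j _ (ih j) fun p => hmem p j) j

theorem continuous_flow (hP : ContinuousCoeffs P)
    (hbar : ∀ j, Continuous fun p => barFlow (P p) (g p) j)
    (hE : ∀ p, ReferenceFlow Ω B C lam₀ L D Z δ (P p) (χ p) (g p))
    (hcV : CouplingConst B C lam₀ L Z δ h A q) (hc : PicardConst Ω κ R M δ a h A q r₀ a₁)
    (hp : ∀ p, PertBounds κ R M (χ p) (g p) (tube W (P p) (χ p) (g p) a h) (ψ p) (ρ p))
    (hu : Continuous u) (huK : ∀ p, ‖(u p).1‖ ≤ a₁ * (χ p 0 * g p 0 ^ 3))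
    (hug : ∀ p, |(u p).2 - g p 0| ≤ g p 0 ^ 2)
    (hcont : ∀ (j : ℕ) (y : X → W j × Coupling), Continuous y →
      (∀ p, y p ∈ tube W (P p) (χ p) (g p) a h j) →
      Continuous fun p => evolution (P p) (ψ p) (ρ p) j (y p))
    (hx : ∀ p k j, ‖(picard (P p) (g p) (ψ p) (ρ p) (u p))^[k]
      (fun j => (0, barFlow (P p) (g p) j)) j - x p j‖ ≤ (a + 1) * (q ^ k * 2)) (j : ℕ) :
    Continuous fun p => x p j := by
  have hlim : Tendsto (fun k => (a + 1) * (q ^ k * 2)) atTop (𝓝 0) := by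
    simpa only [zero_mul, mul_zero] using ((tendsto_pow_atTop_nhds_zero_of_lt_one hc.q_nonneg
      hc.q_lt_one).mul_const 2).const_mul (a + 1)
  have hunif : TendstoUniformly (fun k p => (picard (P p) (g p) (ψ p) (ρ p) (u p))^[k]
      (fun j => (0, barFlow (P p) (g p) j)) j) (fun p => x p j) atTop := by
    refine Metric.tendstoUniformly_iff.2 fun ε hε => ?_
    filter_upwards [hlim.eventually_lt_const hε] with k hk p
    rw [dist_comm, dist_eq_norm]
    exact (hx p k j).trans_lt hk
  exact hunif.continuous <| Frequently.of_forall fun k =>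
    continuous_iterate_picard hP hbar hE hcV hc hp hu huK hug hcont k j

end Continuity

/-! ### The flow for initial conditions near `(K₀', g₀')` -/

theorem sumConst_nonneg {Ω c : ℝ} (hΩ : 1 < Ω) (hc : 0 < c) : 0 ≤ sumConst Ω c := by
  have hΩ' := inv_pos.2 (sub_pos.2 (inv_lt_one_of_one_lt₀ hΩ))
  unfold sumConst
  positivity

theorem sizeConst_nonneg {C L lam₀ : ℝ} (hC : 0 ≤ C) (hL : 0 ≤ L) (hlam : 1 < lam₀) :
    0 ≤ sizeConst C L lam₀ := by
  have := sub_pos.2 hlam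
  unfold sizeConst
  positivity

section Main

/-- The initial conditions `(K₀, g₀)` close enough to `(0, t)` for the flow to be constructed around
the reference flow started at `g = t`: the neighbourhood `N` of the theorem. -/
def initialSet (A : Type*) [Norm A] (a₁ t : ℝ) : Set (A × ℝ) :=
  {u | ‖u.1‖ ≤ a₁ * t ^ 3 ∧ |u.2 - t| ≤ t ^ 2}

theorem initialSet_mem_nhds {A : Type*} [SeminormedAddGroup A] {a₁ t : ℝ} {K : A} (ht : t ≠ 0)
    (hK : ‖K‖ < a₁ * t ^ 3) : initialSet A a₁ t ∈ 𝓝 (K, t) := by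
  have hsub : ∀ᶠ u : A × ℝ in 𝓝 (K, t), |u.2 - t| < t ^ 2 := by
    refine (((continuous_snd.sub continuous_const).abs).tendsto (K, t)).eventually_lt_const ?_
    simpa only [Pi.sub_apply, sub_self, abs_zero] using sq_pos_of_ne_zero ht
  filter_upwards [(continuous_fst.norm.tendsto (K, t)).eventually_lt_const hK, hsub]
    with u huK hug using ⟨huK.le, hug.le⟩

theorem mem_Ioc_of_mem_initialSet {A : Type*} [Norm A] {a₁ t t₁ : ℝ} {u : A × ℝ} (ht : 0 < t)
    (ht1 : t ≤ 1 / 2) (htt : 2 * t ≤ t₁) (hu : u ∈ initialSet A a₁ t) : u.2 ∈ Set.Ioc 0 t₁ := by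
  obtain ⟨hlow, hupp⟩ := abs_le.1 hu.2
  constructor <;> nlinarith

variable {W : ℕ → Type*} [∀ j, NormedAddCommGroup (W j)]
  {Ω B c S S' A C lam₀ δ : ℝ} {κ R M a aStar h b A' q r₀ g₀ : ℝ}

theorem QuadMapBounds.exists_flow [∀ j, CompleteSpace (W j)] {P : Coeffs}
    {ψ : ∀ j, W j × Coupling → W (j + 1)} {ρ : ∀ j, W j × Coupling → Coupling}
    (hQ : QuadMapBounds Ω B c S S' A C lam₀ (chi Ω P.beta) P)
    (hF : FlowConst Ω B C lam₀ (sumConst Ω c) (sizeConst C (sumConst Ω c) lam₀) κ R M a aStar h b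
      A' q r₀ δ) (hδ : δ ≤ 1)
    (hp : PertBounds κ R M (chi Ω P.beta) (gbar P g₀) (domain W Ω a h g₀ P) ψ ρ)
    (hg : IsSmallInitial B S S' C (sumConst Ω c) lam₀ δ g₀) {u₀ : W 0 × ℝ}
    (hu : u₀ ∈ initialSet (W 0) (midRadius a aStar b) g₀)
    (hug : IsSmallInitial B S S' C (sumConst Ω c) lam₀ δ u₀.2) :
    (∃! V, IsQuadFlow P u₀.2 V) ∧ (∀ j, approxFlow P ψ u₀ j ∈ domain W Ω a h g₀ P j) ∧
      ∃ x : ∀ j, W j × Coupling, (∀ j, x j ∈ domain W Ω a h g₀ P j) ∧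
        IsGlobalFlow P ψ ρ u₀ x ∧ FlowBounds Ω a aStar h b P ψ u₀ x ∧
        (∀ y, IsGlobalFlow P ψ ρ u₀ y → FlowBounds Ω a aStar h b P ψ u₀ y → y = x) ∧
        ∀ k j, ‖(picard P (gSeq P.beta g₀) ψ ρ u₀)^[k]
            (fun j => (0, barFlow P (gSeq P.beta g₀) j)) j - x j‖ ≤ (a + 1) * (q ^ k * 2) := by
  have hq := hQ.quadFlow_eq hg
  rw [domain_eq_tube hq] at hp ⊢
  rw [gbar_eq hq] at hp
  have huniq := hQ.existsUnique_isQuadFlow hug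
  refine ⟨huniq, (hQ.referenceFlow hg hδ).exists_flow hF hp huniq ?_ hu.2⟩
  rw [hQ.beta.weight.zero, one_mul]
  exact hu.1

theorem QuadMapBounds.continuousOn_flow {E : Type*} [TopologicalSpace E] {P : E → Coeffs}
    {ψ : E → ∀ j, W j × Coupling → W (j + 1)} {ρ : E → ∀ j, W j × Coupling → Coupling}
    {x : E → W 0 × ℝ → ∀ j, W j × Coupling}
    (hQ : ∀ m, QuadMapBounds Ω B c S S' A C lam₀ (chi Ω (P m).beta) (P m))
    (hlam : 1 < lam₀) (hC : 0 ≤ C)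
    (hF : FlowConst Ω B C lam₀ (sumConst Ω c) (sizeConst C (sumConst Ω c) lam₀) κ R M a aStar h b
      A' q r₀ δ) (hδ : δ ≤ 1)
    (hp : ∀ m, PertBounds κ R M (chi Ω (P m).beta) (gbar (P m) g₀) (domain W Ω a h g₀ (P m))
      (ψ m) (ρ m))
    (hg : IsSmallInitial B S S' C (sumConst Ω c) lam₀ δ g₀) (hP : ContinuousCoeffs P)
    (hev : ∀ j, ContinuousOn
      (fun p : (W j × Coupling) × E => evolution (P p.2) (ψ p.2) (ρ p.2) j p.1)
      ((⋃ m, domain W Ω a h g₀ (P m) j) ×ˢ Set.univ))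
    (hx : ∀ m, ∀ u₀ ∈ initialSet (W 0) (midRadius a aStar b) g₀, ∀ k j,
      ‖(picard (P m) (gSeq (P m).beta g₀) (ψ m) (ρ m) u₀)^[k]
        (fun j => (0, barFlow (P m) (gSeq (P m).beta g₀) j)) j - x m u₀ j‖
          ≤ (a + 1) * (q ^ k * 2)) (j : ℕ) :
    ContinuousOn (fun p : E × (W 0 × ℝ) => x p.1 p.2 j)
      (Set.univ ×ˢ initialSet (W 0) (midRadius a aStar b) g₀) := by
  have hq := fun m => (hQ m).quadFlow_eq hg
  have hdom := fun m => domain_eq_tube (W := W) (Ω := Ω) (hq m) a h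
  simp only [hdom, fun m => gbar_eq (hq m)] at hp hev
  rw [continuousOn_iff_continuous_domRestrict]
  have hm : Continuous fun p : ↥((Set.univ : Set E) ×ˢ
    initialSet (W 0) (midRadius a aStar b) g₀) => p.1.1 := continuous_subtype_val.fst
  refine continuous_flow (hP.comp hm)
    (fun j => (continuous_barFlow hQ hlam hC hg hP j).comp hm)
    (fun p => (hQ p.1.1).referenceFlow hg hδ) hF.coupling hF.picard (fun p => hp p.1.1)
    (u := fun p => p.1.2) continuous_subtype_val.snd (fun p => ?_) (fun p => p.2.2.2)
    (fun j y hy hmem => (hev j).comp_continuous (hy.prodMk hm) fun p =>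
      ⟨Set.mem_iUnion.2 ⟨p.1.1, hmem p⟩, trivial⟩)
    (fun p => hx p.1.1 p.1.2 p.2.2) j
  rw [(hQ p.1.1).beta.weight.zero, one_mul]
  exact p.2.2.1

end Main

end QuadFlow

end

theorem corollary1p6_general
    (Ω B c lam₀ C a κ R M aStar b : ℝ)
    (hΩ : 1 < Ω) (hc : 0 < c) (hlam : 1 < lam₀)
    (hκ : 0 ≤ κ) (hκΩ : κ < Ω⁻¹) (hR : 0 ≤ R) (hM : 0 ≤ M)
    (haStar : R / (1 - κ * Ω) < aStar) (haStar_lt : aStar < a) (hb : 0 < b) (hb1 : b < 1) :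
    ∃ hStar : ℝ, 0 < hStar ∧ ∀ h : ℝ, hStar ≤ h →
    ∃ gStar : ℝ, 0 < gStar ∧
    ∀ (W : ℕ → Type*) [∀ j, NormedAddCommGroup (W j)] [∀ j, CompleteSpace (W j)]
      (E : Type*) [TopologicalSpace E] (P : E → Coeffs)
      (ψ : E → ∀ j, W j × Coupling → W (j + 1)) (ρ : E → ∀ j, W j × Coupling → Coupling)
      (K₀' : W 0) (g₀' : ℝ),
      0 < g₀' → g₀' ≤ gStar → ‖K₀'‖ ≤ aStar * g₀' ^ 3 →
      ContinuousCoeffs P →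
      (∀ j, ContinuousOn
        (fun p : (W j × Coupling) × E => evolution (P p.2) (ψ p.2) (ρ p.2) j p.1)
        ((⋃ m, domain W Ω a h g₀' (P m) j) ×ˢ Set.univ)) →
      (∀ m, AssumptionA1 Ω B c (P m)) →
      (∀ m, AssumptionA2 Ω c lam₀ C (P m)) →
      (∀ m, PertBounds κ R M (chi Ω (P m).beta) (gbar (P m) g₀') (domain W Ω a h g₀' (P m))
        (ψ m) (ρ m)) →
      ∃ N ∈ 𝓝 (K₀', g₀'), ∃ x : E → W 0 × ℝ → ∀ j, W j × Coupling,
        (∀ m, ∀ u₀ ∈ N,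
          (∃! V, IsQuadFlow (P m) u₀.2 V) ∧
          (∀ j, approxFlow (P m) (ψ m) u₀ j ∈ domain W Ω a h g₀' (P m) j) ∧
          (∀ j, x m u₀ j ∈ domain W Ω a h g₀' (P m) j) ∧
          IsGlobalFlow (P m) (ψ m) (ρ m) u₀ (x m u₀) ∧
          FlowBounds Ω a aStar h b (P m) (ψ m) u₀ (x m u₀) ∧
          ∀ y : ∀ j, W j × Coupling, IsGlobalFlow (P m) (ψ m) (ρ m) u₀ y →
            FlowBounds Ω a aStar h b (P m) (ψ m) u₀ y → y = x m u₀) ∧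
        ∀ j, ContinuousOn (fun p : E × (W 0 × ℝ) => x p.1 p.2 j) (Set.univ ×ˢ N) := by
  obtain ⟨S, S', A, hQ⟩ := exists_quadMapBounds B C hΩ hc hlam
  obtain ⟨A', q, r₀, hStar, hpos, hconst⟩ := exists_flowConst |B| (one_pos.trans hΩ)
    (abs_nonneg C) hlam (sumConst_nonneg hΩ hc)
    (sizeConst_nonneg (abs_nonneg C) (sumConst_nonneg hΩ hc) hlam) hκ hκΩ hR hM haStar haStar_lt
    hb hb1
  refine ⟨hStar, hpos, fun h hh => ?_⟩
  obtain ⟨δ, hδ, hδ1, hF⟩ := hconst h hh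
  obtain ⟨g₁, hg₁, hsmall⟩ := exists_isSmallInitial |B| S S' |C| (sumConst Ω c) hlam hδ
  refine ⟨min (g₁ / 2) (1 / 2), lt_min (half_pos hg₁) one_half_pos, ?_⟩
  intro W _ _ E _ P ψ ρ K₀' g₀' hg₀ hg₀_le hK₀ hP hev h1 h2 hp
  obtain ⟨hg₀₁, hg₀_half⟩ := le_min_iff.1 hg₀_le
  have hQP := fun m => hQ (P m) (h1 m) (h2 m)
  have hg := hsmall g₀' hg₀ (by linarith)
  have hflow := fun m u₀ (hu : u₀ ∈ initialSet (W 0) (midRadius a aStar b) g₀') =>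
    have hu₂ := mem_Ioc_of_mem_initialSet hg₀ hg₀_half (by linarith : 2 * g₀' ≤ g₁) hu
    (hQP m).exists_flow hF hδ1 (hp m) hg hu (hsmall u₀.2 hu₂.1 hu₂.2)
  choose! x hxmem hxflow hxbound hxuniq hxlim using fun m u₀ hu => (hflow m u₀ hu).2.2
  refine ⟨_, initialSet_mem_nhds hg₀.ne' (hK₀.trans_lt
    (mul_lt_mul_of_pos_right (lt_midRadius haStar_lt hb1) (pow_pos hg₀ 3))), x, ?_,
    QuadMapBounds.continuousOn_flow hQP hlam (abs_nonneg C) hF hδ1 hp hg hP hev hxlim⟩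
  exact fun m u₀ hu => ⟨(hflow m u₀ hu).1, (hflow m u₀ hu).2.1, hxmem m u₀ hu, hxflow m u₀ hu,
    hxbound m u₀ hu, hxuniq m u₀ hu⟩

theorem corollary1p6
    (Ω B c lam₀ C a κ R M aStar b : ℝ)
    (hΩ : 1 < Ω) (hc : 0 < c) (hlam : 1 < lam₀) (ha : 0 < a)
    (hκ : 0 < κ) (hκΩ : κ < Ω⁻¹) (hR : 0 < R) (hRa : R < a * (1 - κ * Ω)) (hM : 0 < M)
    (haStar : R / (1 - κ * Ω) < aStar) (haStar_lt : aStar < a) (hb : 0 < b) (hb1 : b < 1) :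
    ∃ hStar : ℝ, 0 < hStar ∧ ∀ h : ℝ, hStar ≤ h →
    ∃ gStar : ℝ, 0 < gStar ∧
    ∀ (W : ℕ → Type*) [∀ j, NormedAddCommGroup (W j)] [∀ j, NormedSpace ℝ (W j)]
      [∀ j, CompleteSpace (W j)] (E : Type*) [MetricSpace E]
      (P : E → Coeffs)
      (ψ : E → ∀ j, W j × Coupling → W (j + 1)) (ρ : E → ∀ j, W j × Coupling → Coupling)
      (K₀' : W 0) (g₀' : ℝ),
      0 < g₀' → g₀' ≤ gStar → ‖K₀'‖ ≤ aStar * g₀' ^ 3 →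
      ContinuousCoeffs P →
      (∀ j, ContinuousOn
        (fun p : (W j × Coupling) × E => evolution (P p.2) (ψ p.2) (ρ p.2) j p.1)
        ((⋃ m, domain W Ω a h g₀' (P m) j) ×ˢ Set.univ)) →
      (∀ m, AssumptionA1 Ω B c (P m)) →
      (∀ m, AssumptionA2 Ω c lam₀ C (P m)) →
      (∀ m, AssumptionA3 Ω a h κ R M g₀' (P m) (ψ m) (ρ m)) →
      ∃ N ∈ 𝓝 (K₀', g₀'), ∃ x : E → W 0 × ℝ → ∀ j, W j × Coupling,
        (∀ m, ∀ u₀ ∈ N,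
          (∃! V, IsQuadFlow (P m) u₀.2 V) ∧
          (∀ j, approxFlow (P m) (ψ m) u₀ j ∈ domain W Ω a h g₀' (P m) j) ∧
          (∀ j, x m u₀ j ∈ domain W Ω a h g₀' (P m) j) ∧
          IsGlobalFlow (P m) (ψ m) (ρ m) u₀ (x m u₀) ∧
          FlowBounds Ω a aStar h b (P m) (ψ m) u₀ (x m u₀) ∧
          ∀ y : ∀ j, W j × Coupling, IsGlobalFlow (P m) (ψ m) (ρ m) u₀ y →
            FlowBounds Ω a aStar h b (P m) (ψ m) u₀ y → y = x m u₀) ∧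
        ∀ j, ContinuousOn (fun p : E × (W 0 × ℝ) => x p.1 p.2 j) (Set.univ ×ˢ N) := by
  obtain ⟨hStar, hpos, H⟩ := corollary1p6_general Ω B c lam₀ C a κ R M aStar b hΩ hc hlam hκ.le hκΩ
    hR.le hM.le haStar haStar_lt hb hb1
  refine ⟨hStar, hpos, fun h hh => (H h hh).imp fun gStar H => ⟨H.1, ?_⟩⟩
  exact fun W _ _ _ E _ P ψ ρ K₀' g₀' h0 h0' hK hP hev h1 h2 h3 =>
    H.2 W E P ψ ρ K₀' g₀' h0 h0' hK hP hev h1 h2 fun m => (h3 m).pertBounds
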